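/- Let $1<\alpha\le 2$, let $\mathbb D=\{z\in\mathbb C:|z|<1\}$, and let $Co(\alpha)$ be the class of functions $f$ that are analytic and injective in $\mathbb D$ with $f(0)=0$, $f'(0)=1$ and $f(1)=\infty$ (that is, $f(z)\to\infty$ as $z\to 1$, $z\in\mathbb D$), such that $\mathbb C\setminus f(\mathbb D)$ is convex and the opening angle of $f(\mathbb D)$ at $\infty$ is at most $\pi\alpha$. (The opening angle of a domain $\Omega$ at $\infty$ is the measure of the set of $\theta\in(-\pi,\pi]$ for which $re^{i\theta}\in\Omega$ for all sufficiently large $r$.) For $f\in Co(\alpha)$ write $f(z)=z+\sum_{k\ge 2}a_kz^k$, $a_1=1$, and $s(z)=(1-z)^{\alpha+1}f'(z)=\sum_{n\ge 0}b_nz^n$. All powers are principal branches. (a) For every $f\in Co(\alpha)$ and every integer $n\ge 1$, $$b_n=(-1)^n\sum_{k=0}^n(-1)^k\binom{\alpha+1}{n-k}(k+1)a_{k+1},\qquad |b_n|=\left|\sum_{k=0}^n(-1)^k\binom{\alpha+1}{n-k}(k+1)a_{k+1}\right|\le\frac{\alpha-1}{n},$$ and equality holds in the last inequality if and only if there is a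 real $\theta$ such that $$f'(z)=\frac{(1-e^{i\theta}z^n)^{(\alpha-1)/n}}{(1-z)^{\alpha+1}}\qquad(z\in\mathbb D).$$ (b) The inequality is sharp: for every $n\ge 1$ and every real $\theta$ there is a function $f\in Co(\alpha)$ with this derivative. (c) In particular, for every $f\in Co(\alpha)$, $$\left|a_2-\frac{\alpha+1}{2}\right|\le\frac{\alpha-1}{2}\quad\text{and}\quad\left|3a_3-2(\alpha+1)a_2+\frac{\alpha(\alpha+1)}{2}\right|\le\frac{\alpha-1}{2}.$$ -/

import Mathlib

open Set Filter Topology Bornology MeasureTheory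

noncomputable section

/-- The `n`-th Taylor coefficient at the origin of a function analytic near `0`. -/
def taylorCoeff (f : ℂ → ℂ) (n : ℕ) : ℂ :=
  iteratedDeriv n f 0 / (n.factorial : ℂ)

/-- The opening angle at `∞` of a plane domain: the angular measure of the set of those directions
in which the ray from the origin eventually stays in the domain. When the complement of the domain
is a closed convex set, this is `2 * π` minus the angle of the cone of directions of the rays
contained in the complement, and it does not depend on the choice of the origin. For example, it
is `β` for a sector of angle `β`, and `2 * π` for a plane slit along a half-line. -/
def openingAngleAtInfinity (Ω : Set ℂ) : ℝ :=
  volume.real {θ : ℝ | θ ∈ Ioc (-Real.pi) Real.pi ∧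
    ∀ᶠ r : ℝ in atTop, (r : ℂ) * Complex.exp ((θ : ℂ) * Complex.I) ∈ Ω}

/-- The class `Co(α)` of concave univalent functions on the unit disk with opening angle at `∞`
at most `π * α`. Only the values of `f` on the open unit disk matter. -/
structure IsConcaveUnivalent (α : ℝ) (f : ℂ → ℂ) : Prop where
  analytic : AnalyticOnNhd ℂ f (Metric.ball 0 1)
  map_zero : f 0 = 0
  deriv_zero : deriv f 0 = 1
  /-- the condition `f(1) = ∞` -/
  tendsto_infinity : Tendsto f (𝓝[Metric.ball 0 1] 1) (cobounded ℂ)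
  injective : InjOn f (Metric.ball 0 1)
  convex_compl : Convex ℝ (f '' Metric.ball 0 1)ᶜ
  opening_angle : openingAngleAtInfinity (f '' Metric.ball 0 1) ≤ Real.pi * α

/-- The function `s(z) = (1 - z) ^ (α + 1) * f'(z)` (principal branch). -/
def concaveFactor (α : ℝ) (f : ℂ → ℂ) (z : ℂ) : ℂ :=
  (1 - z) ^ ((α : ℂ) + 1) * deriv f z

/-- The sum `∑_{k=0}^n (-1)^k C(α+1, n-k) (k+1) a_{k+1}`, with generalized binomial coefficients
and with `a_j` the Taylor coefficients of `f`. -/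
def concaveCoeffSum (α : ℝ) (f : ℂ → ℂ) (n : ℕ) : ℂ :=
  ∑ k ∈ Finset.range (n + 1),
    (-1 : ℂ) ^ k * ((Ring.choose (α + 1) (n - k) : ℝ) : ℂ) * ((k : ℂ) + 1) * taylorCoeff f (k + 1)

/-- The function `(1 - e^{iθ} z^n)^{(α-1)/n} / (1 - z)^{α+1}` (principal branches). -/
def extremalDeriv (α : ℝ) (n : ℕ) (θ : ℝ) (z : ℂ) : ℂ :=
  (1 - Complex.exp ((θ : ℂ) * Complex.I) * z ^ n) ^ (((α : ℂ) - 1) / (n : ℂ)) /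
    (1 - z) ^ ((α : ℂ) + 1)

end

/-! Put β = α - 1. Everything in (a) and (c) follows from Re (z s'/s) ≤ β/2 on the disk, where s =
(1 - z)^(α+1) f' is zero-free with s(0) = 1.

This bound is proved in the half-plane: F = f ∘ `cayley` moves the point 1 to ∞. For an omitted
point k the dilations w ↦ w + s(w - k), s ≥ 0, preserve the image because the complement is convex.
Conjugated by F they are self-maps of the half-plane with generator (F - k)/F', and Schwarz–Pick
together with F(∞) = ∞ gives Re F'/(F - k) ≥ 0 (`re_logDeriv_nonneg`). A boundary version of this
and the minimum principle give Re (F'(v)/(F(v) - F(ζ)) - 1/(v - ζ)) ≥ 0, hence Re F''/F' ≥ 0 on the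
diagonal (`re_deriv_deriv_div_nonneg`): arg F' increases along upward vertical lines. The opening
angle limits the oscillation of arg F' to πβ (`im_sub_im_le`), because no value of F' makes an acute
angle with a direction of recession of the complement. Comparing h = log F' with its composition
with small rotations of the half-plane about 1 (`im_rotation_nonneg`) and differentiating yields Re
(βv + (1 - v²) F''/F') ≥ 0, which is the disk inequality in the variable v.

The coefficients b_k of s are then handled by Clunie's method. The bound says that z s' = ω (z s' -
β s) with |ω| ≤ 1 and ω(0) = 0; truncating the second factor and comparing mean squares on circles
gives ∑_{k ≤ n} k²|b_k|² ≤ ∑_{k < n} (k - β)²|b_k|² (`sum_sq_le`). Since β ≤ 1, the terms with 1 ≤ k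
< n only help, so n|b_n| ≤ β. Equality kills b_1, …, b_{n-1}, forces ω = c z^n with |c| = 1, and the
resulting linear differential equation has the single solution (1 - c z^n)^(β/n) with value 1 at 0.

For sharpness, the logarithm h of F' belonging to the extremal derivative satisfies Re h' ≥ 0, and h
- b Log v converges at ∞ for some 0 ≤ b ≤ β. These properties alone (`IsConcavePrimitive`) imply
that F is injective, omits a convex set and has opening angle at most π(1 + b). -/

/-! ### Maximum and minimum principles on the right half-plane. -/

/-- The open right half-plane. -/
def rightHalfPlane : Set ℂ := {z | 0 < z.re}

theorem mem_rightHalfPlane {z : ℂ} : z ∈ rightHalfPlane ↔ 0 < z.re := Iff.rfl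

theorem isOpen_rightHalfPlane : IsOpen rightHalfPlane :=
  isOpen_lt continuous_const Complex.continuous_re

theorem convex_rightHalfPlane : Convex ℝ rightHalfPlane :=
  convex_halfSpace_re_gt 0

theorem isPreconnected_rightHalfPlane : IsPreconnected rightHalfPlane :=
  convex_rightHalfPlane.isPreconnected

/-- Maximum principle on the right half-plane, with limits superior at the boundary. -/
theorem norm_le_of_forall_boundary {g : ℂ → ℂ} (hg : DifferentiableOn ℂ g rightHalfPlane) {M : ℝ}
    (hb : ∀ y : ℝ, ∀ η > 0, ∀ᶠ v in 𝓝[rightHalfPlane] (y * Complex.I : ℂ), ‖g v‖ ≤ M + η)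
    (hi : ∀ η > 0, ∀ᶠ v in cobounded ℂ ⊓ 𝓟 rightHalfPlane, ‖g v‖ ≤ M + η)
    {v : ℂ} (hv : v ∈ rightHalfPlane) : ‖g v‖ ≤ M := by
  refine le_of_forall_pos_le_add fun η hη => ?_
  by_contra! hlt
  -- The boundary hypotheses make this superlevel set compact, so |g| attains its maximum; then |g|
  -- is constant and the set contains arbitrarily large real numbers.
  set S : Set ℂ := {u | u ∈ rightHalfPlane ∧ ‖g v‖ ≤ ‖g u‖} with hS
  obtain ⟨η', hη', hη'2⟩ : ∃ η' > 0, M + η' < ‖g v‖ := ⟨η, hη, hlt⟩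
  have hbdd : IsBounded S := by
    have h1 := hi η' hη'
    rw [eventually_inf_principal, (hasBasis_cobounded_norm).eventually_iff] at h1
    obtain ⟨R, -, hR⟩ := h1
    rw [isBounded_iff_forall_norm_le]
    refine ⟨R, fun u hu => ?_⟩
    by_contra! h
    have := hR (show R ≤ ‖u‖ from h.le) hu.1
    linarith [hu.2]
  have hclosed : IsClosed S := by
    rw [isClosed_iff_clusterPt]
    intro u hu
    have hfreq : ∃ᶠ w in 𝓝 u, w ∈ S := by
      rw [clusterPt_principal_iff_frequently] at hu; exact hu
    have hure : 0 ≤ u.re := by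
      have : u ∈ closure rightHalfPlane :=
        closure_mono (fun w hw => hw.1) (mem_closure_iff_clusterPt.2 hu)
      have h2 : closure rightHalfPlane ⊆ {z : ℂ | 0 ≤ z.re} :=
        closure_minimal (fun z (hz : 0 < z.re) => hz.le) (isClosed_le continuous_const Complex.continuous_re)
      exact h2 this
    rcases hure.eq_or_lt with h0 | h0
    · exfalso
      have h1 := hb u.im η' hη'
      have hu' : (u.im * Complex.I : ℂ) = u := by
        apply Complex.ext <;> simp [← h0]
      rw [hu', eventually_nhdsWithin_iff] at h1
      obtain ⟨w, hw, hw2⟩ := (hfreq.and_eventually h1).exists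
      have := hw2 hw.1
      linarith [hw.2]
    · refine ⟨h0, ?_⟩
      have hc : ContinuousAt (fun w => ‖g w‖) u :=
        (hg.continuousOn.continuousAt (isOpen_rightHalfPlane.mem_nhds h0)).norm
      refine ge_of_tendsto_of_frequently hc (hfreq.mono fun w hw => hw.2)
  have hcomp : IsCompact S := Metric.isCompact_of_isClosed_isBounded hclosed hbdd
  have hvS : v ∈ S := ⟨hv, le_rfl⟩
  have hcont : ContinuousOn (fun w => ‖g w‖) S := (hg.continuousOn.mono fun w hw => hw.1).norm
  obtain ⟨u, huS, humax⟩ := hcomp.exists_isMaxOn ⟨v, hvS⟩ hcont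
  have hmax : IsMaxOn (norm ∘ g) rightHalfPlane u := by
    intro w hw
    by_cases hwS : w ∈ S
    · exact humax hwS
    · have : ‖g w‖ < ‖g v‖ := by
        by_contra! h; exact hwS ⟨hw, h⟩
      exact (this.le.trans huS.2)
  have heq := Complex.norm_eqOn_of_isPreconnected_of_isMaxOn isPreconnected_rightHalfPlane
    isOpen_rightHalfPlane hg huS.1 hmax
  rw [isBounded_iff_forall_norm_le] at hbdd
  obtain ⟨R, hR⟩ := hbdd
  have hmem : ((|R| + 1 : ℝ) : ℂ) ∈ rightHalfPlane := by
    rw [mem_rightHalfPlane, Complex.ofReal_re]; positivity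
  have h3 : ((|R| + 1 : ℝ) : ℂ) ∈ S := ⟨hmem, by
    have := heq hmem
    simp only [Function.comp_apply, Function.const_apply] at this
    rw [this]; exact huS.2⟩
  have h4 := hR _ h3
  rw [Complex.norm_real, Real.norm_eq_abs, abs_of_pos (by positivity)] at h4
  linarith [le_abs_self R]

/-- Minimum principle for the real part on the right half-plane. -/
theorem re_nonneg_of_forall_boundary {g : ℂ → ℂ} (hg : DifferentiableOn ℂ g rightHalfPlane)
    (hb : ∀ y : ℝ, ∀ η > 0, ∀ᶠ v in 𝓝[rightHalfPlane] (y * Complex.I : ℂ), -η ≤ (g v).re)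
    (hi : ∀ η > 0, ∀ᶠ v in cobounded ℂ ⊓ 𝓟 rightHalfPlane, -η ≤ (g v).re)
    {v : ℂ} (hv : v ∈ rightHalfPlane) : 0 ≤ (g v).re := by
  -- |exp (-g)| = exp (-Re g), so a lower bound for Re g is an upper bound for a modulus.
  have key : ∀ η > 0, ∀ u : ℂ, -(Real.log (1 + η)) ≤ (g u).re →
      ‖Complex.exp (-g u)‖ ≤ 1 + η := by
    intro η hη u hu
    rw [Complex.norm_exp, Complex.neg_re]
    calc Real.exp (-(g u).re) ≤ Real.exp (Real.log (1 + η)) := Real.exp_le_exp.2 (by linarith)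
      _ = 1 + η := Real.exp_log (by linarith)
  have h := norm_le_of_forall_boundary (g := fun u => Complex.exp (-g u)) (M := 1) hg.neg.cexp
    (fun y η hη => (hb y _ (Real.log_pos (by linarith : 1 < 1 + η))).mono fun u => key η hη u)
    (fun η hη => (hi _ (Real.log_pos (by linarith : 1 < 1 + η))).mono fun u => key η hη u) hv
  rw [Complex.norm_exp, Complex.neg_re, Real.exp_le_one_iff] at h
  linarith

/-! ### The Schwarz–Pick inequality in the half-plane. -/

theorem add_conj_ne_zero {a b : ℂ} (ha : 0 ≤ a.re) (hb : 0 < b.re) :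
    a + (starRingEnd ℂ) b ≠ 0 := by
  intro h
  have := congrArg Complex.re h
  simp at this
  linarith

/-- Through this identity, bounds on the pseudohyperbolic distance |a - b|/|a + conj b| become
polynomial inequalities. -/
theorem normSq_add_conj (a b : ℂ) :
    Complex.normSq (a + (starRingEnd ℂ) b) = Complex.normSq (a - b) + 4 * a.re * b.re := by
  simp [Complex.normSq_apply]; ring

theorem norm_div_add_conj_le_one {a b : ℂ} (ha : 0 ≤ a.re) (hb : 0 < b.re) :
    ‖(a - b) / (a + (starRingEnd ℂ) b)‖ ≤ 1 := by
  rw [norm_div]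
  apply div_le_one_of_le₀ _ (norm_nonneg _)
  rw [← sq_le_sq₀ (norm_nonneg _) (norm_nonneg _), ← Complex.normSq_eq_norm_sq,
    ← Complex.normSq_eq_norm_sq, normSq_add_conj]
  have := mul_nonneg ha hb.le
  linarith

/-- The Schwarz–Pick inequality for self-maps of the right half-plane, base point with image
in the open half-plane. -/
theorem schwarzPick_of_pos {φ : ℂ → ℂ} (hφ : DifferentiableOn ℂ φ rightHalfPlane)
    (hre : ∀ v ∈ rightHalfPlane, 0 ≤ (φ v).re) {u v : ℂ} (hu : u ∈ rightHalfPlane)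
    (hv : v ∈ rightHalfPlane) (hφv : 0 < (φ v).re) :
    Complex.normSq (φ u - φ v) * (u.re * v.re) ≤
      Complex.normSq (u - v) * ((φ u).re * (φ v).re) := by
  have hv' : 0 < v.re := hv
  have hu' : 0 < u.re := hu
  -- `c` maps the disk to the half-plane with 0 ↦ v, and `m` below is φ ∘ c followed by the
  -- analogous map sending φ v to 0. Schwarz's lemma is applied to `m` at the point z with c z = u.
  set c : ℂ → ℂ := fun z => (v + (starRingEnd ℂ) v * z) / (1 - z) with hc
  have hcre : ∀ z ∈ Metric.ball (0 : ℂ) 1, c z ∈ rightHalfPlane := by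
    intro z hz
    have hz1 : Complex.normSq z < 1 := by
      rw [Complex.normSq_eq_norm_sq]
      have : ‖z‖ < 1 := by simpa using hz
      nlinarith [norm_nonneg z]
    have hne : 1 - z ≠ 0 := by
      intro h
      have : z = 1 := by linear_combination -h
      rw [this] at hz1; simp at hz1
    rw [mem_rightHalfPlane, hc]
    simp only [Complex.div_re]
    rw [← add_div]
    apply div_pos _ (Complex.normSq_pos.2 hne)
    rw [Complex.normSq_apply] at hz1
    simp
    nlinarith
  have h1z : ∀ z ∈ Metric.ball (0 : ℂ) 1, 1 - z ≠ 0 := by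
    intro z hz h
    have : z = 1 := by linear_combination -h
    rw [this] at hz; simp at hz
  set m : ℂ → ℂ := fun z => (φ (c z) - φ v) / (φ (c z) + (starRingEnd ℂ) (φ v)) with hm
  have hcd : DifferentiableOn ℂ c (Metric.ball 0 1) := by
    apply DifferentiableOn.div
    · fun_prop
    · fun_prop
    · exact h1z
  have hφc : DifferentiableOn ℂ (fun z => φ (c z)) (Metric.ball 0 1) := hφ.comp hcd hcre
  have hmd : DifferentiableOn ℂ m (Metric.ball 0 1) :=
    (hφc.sub_const _).div (hφc.add_const _)
      fun z hz => add_conj_ne_zero (hre _ (hcre z hz)) hφv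
  have hmap : MapsTo m (Metric.ball 0 1) (Metric.closedBall 0 1) := by
    intro z hz
    rw [mem_closedBall_zero_iff]
    exact norm_div_add_conj_le_one (hre _ (hcre z hz)) hφv
  have hm0 : m 0 = 0 := by simp [hm, hc]
  set z : ℂ := (u - v) / (u + (starRingEnd ℂ) v) with hz
  have huv := add_conj_ne_zero hu'.le hv'
  have hz1 : ‖z‖ < 1 := by
    rw [hz, norm_div, div_lt_one (norm_pos_iff.2 huv), ← sq_lt_sq₀ (norm_nonneg _) (norm_nonneg _),
      ← Complex.normSq_eq_norm_sq, ← Complex.normSq_eq_norm_sq, normSq_add_conj]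
    have := mul_pos hu' hv'
    linarith
  have hcz : c z = u := by
    have h1 := h1z z (by simpa using hz1)
    rw [hc]
    simp only
    rw [div_eq_iff h1, hz]
    field_simp
    ring
  have h := Complex.norm_le_norm_of_mapsTo_ball hmd hmap hm0 hz1
  rw [hm] at h
  simp only [hcz] at h
  have hw := add_conj_ne_zero (hre u hu) hφv
  rw [hz, norm_div, norm_div, div_le_div_iff₀ (norm_pos_iff.2 hw) (norm_pos_iff.2 huv),
    ← sq_le_sq₀ (by positivity) (by positivity), mul_pow, mul_pow, ← Complex.normSq_eq_norm_sq,
    ← Complex.normSq_eq_norm_sq, ← Complex.normSq_eq_norm_sq, ← Complex.normSq_eq_norm_sq,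
    normSq_add_conj, normSq_add_conj] at h
  linarith

/-- The Schwarz–Pick inequality for maps of the right half-plane to its closure. -/
theorem schwarzPick {φ : ℂ → ℂ} (hφ : DifferentiableOn ℂ φ rightHalfPlane)
    (hre : ∀ v ∈ rightHalfPlane, 0 ≤ (φ v).re) {u v : ℂ} (hu : u ∈ rightHalfPlane)
    (hv : v ∈ rightHalfPlane) :
    Complex.normSq (φ u - φ v) * (u.re * v.re) ≤
      Complex.normSq (u - v) * ((φ u).re * (φ v).re) := by
  -- Adding ε > 0 pushes the values into the open half-plane; then ε → 0.
  have h : ∀ ε > (0 : ℝ), Complex.normSq (φ u - φ v) * (u.re * v.re) ≤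
      Complex.normSq (u - v) * (((φ u).re + ε) * ((φ v).re + ε)) := by
    intro ε hε
    have := schwarzPick_of_pos (φ := fun w => φ w + ε) (hφ.add_const _)
      (fun w hw => by simpa using by linarith [hre w hw]) hu hv (by simpa using by linarith [hre v hv])
    simpa using this
  have ht : Tendsto (fun ε : ℝ => Complex.normSq (u - v) * (((φ u).re + ε) * ((φ v).re + ε)))
      (𝓝[>] 0) (𝓝 (Complex.normSq (u - v) * (((φ u).re + 0) * ((φ v).re + 0)))) := by
    apply Tendsto.mono_left _ nhdsWithin_le_nhds
    exact Continuous.tendsto (by fun_prop) 0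
  simpa using ge_of_tendsto ht (eventually_mem_nhdsWithin.mono fun ε hε => h ε hε)

/-! ### Injective holomorphic functions and their inverses. -/

/-- An injective holomorphic function has nonvanishing derivative. -/
theorem deriv_ne_zero_of_injOn {f : ℂ → ℂ} {U : Set ℂ} (hU : IsOpen U)
    (hf : DifferentiableOn ℂ f U) (hinj : InjOn f U) {z : ℂ} (hz : z ∈ U) : deriv f z ≠ 0 := by
  intro hd
  have hUz := hU.mem_nhds hz
  have hfa : AnalyticAt ℂ f z := hf.analyticAt hUz
  have hga : AnalyticAt ℂ (fun w => f w - f z) z := hfa.sub analyticAt_const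
  have hne : ¬ ∀ᶠ w in 𝓝 z, f w - f z = 0 := by
    intro h
    have h2 : ∀ᶠ w in 𝓝[≠] z, w = z := by
      filter_upwards [nhdsWithin_le_nhds h, nhdsWithin_le_nhds hUz] with w hw hwU
      exact hinj hwU hz (sub_eq_zero.1 hw)
    have h3 : ∀ᶠ w in 𝓝[≠] z, False := by
      filter_upwards [h2, self_mem_nhdsWithin] with w hw hw2
      exact hw2 hw
    simp at h3
    exact NeBot.ne inferInstance h3
  -- If f' z = 0, then f - f z = φ ^ n near z with n ≥ 2 and φ a local coordinate. With ζ a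
  -- primitive n-th root of unity, the points where φ equals e and ζ e have the same image under f.
  obtain ⟨n, k, hka, hk0, hk⟩ := hga.exists_eventuallyEq_pow_smul_nonzero_iff.2 hne
  have hn0 : n ≠ 0 := by
    rintro rfl
    have := hk.self_of_nhds
    simp at this
    exact hk0 this.symm
  have hn1 : n ≠ 1 := by
    rintro rfl
    have h1 : HasDerivAt (fun w => (w - z) ^ 1 • k w) (k z) z := by
      have := ((hasDerivAt_id z).sub_const z).mul hka.differentiableAt.hasDerivAt
      simpa using! this
    have h2 : HasDerivAt (fun w => f w - f z) 0 z := by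
      have := hfa.differentiableAt.hasDerivAt.sub_const (f z)
      rwa [hd] at this
    exact hk0 ((h1.congr_of_eventuallyEq hk).unique h2)
  have hnC : (n : ℂ) ≠ 0 := by exact_mod_cast hn0
  obtain ⟨c, hc⟩ : ∃ c : ℂ, c ^ n = k z := by
    refine ⟨Complex.exp (Complex.log (k z) / n), ?_⟩
    rw [← Complex.exp_nat_mul, mul_div_cancel₀ _ hnC, Complex.exp_log hk0]
  have hc0 : c ≠ 0 := by
    rintro rfl
    rw [zero_pow hn0] at hc
    exact hk0 hc.symm
  set κ : ℂ → ℂ := fun w => c * Complex.exp (Complex.log (k w / k z) / n) with hκ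
  have hκz : κ z = c := by simp [hκ, hk0]
  have hκa : AnalyticAt ℂ κ z := by
    refine analyticAt_const.mul (AnalyticAt.cexp' ((AnalyticAt.clog (hka.div analyticAt_const hk0)
      ?_).div analyticAt_const hnC))
    simp [hk0]
  have hκn : ∀ᶠ w in 𝓝 z, κ w ^ n = k w := by
    filter_upwards [hka.continuousAt.eventually_ne hk0] with w hw
    rw [hκ]
    simp only
    rw [mul_pow, ← Complex.exp_nat_mul, mul_div_cancel₀ _ hnC,
      Complex.exp_log (div_ne_zero hw hk0), hc, mul_div_cancel₀ _ hk0]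
  set φ : ℂ → ℂ := fun w => (w - z) * κ w with hφ
  have hφa : AnalyticAt ℂ φ z := (analyticAt_id.sub analyticAt_const).mul hκa
  have hφd : deriv φ z = c := by
    have := ((hasDerivAt_id z).sub_const z).mul hκa.differentiableAt.hasDerivAt
    have h2 : HasDerivAt φ (κ z) z := by simpa using! this
    rw [h2.deriv, hκz]
  have hmap : map φ (𝓝 z) = 𝓝 (φ z) :=
    hφa.hasStrictDerivAt.map_nhds_eq (by rw [hφd]; exact hc0)
  have hφz : φ z = 0 := by simp [hφ]
  rw [hφz] at hmap
  have hV : {w | w ∈ U ∧ f w - f z = φ w ^ n} ∈ 𝓝 z := by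
    filter_upwards [hUz, hk, hκn] with w h1 h2 h3
    refine ⟨h1, ?_⟩
    rw [h2, hφ]
    simp only
    rw [mul_pow, h3, smul_eq_mul]
  have himg : φ '' {w | w ∈ U ∧ f w - f z = φ w ^ n} ∈ 𝓝 (0 : ℂ) := by
    rw [← hmap]; exact image_mem_map hV
  have hζ := Complex.isPrimitiveRoot_exp n hn0
  set ζ := Complex.exp (2 * Real.pi * Complex.I / n) with hζd
  have hmul : Tendsto (fun e : ℂ => ζ * e) (𝓝 0) (𝓝 0) := by
    have : Continuous fun e : ℂ => ζ * e := by fun_prop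
    simpa using this.tendsto 0
  have hev : ∀ᶠ e in 𝓝[≠] (0 : ℂ), (e ∈ φ '' {w | w ∈ U ∧ f w - f z = φ w ^ n} ∧
      ζ * e ∈ φ '' {w | w ∈ U ∧ f w - f z = φ w ^ n}) ∧ e ≠ 0 :=
    (Filter.Eventually.filter_mono nhdsWithin_le_nhds
      (Filter.inter_mem himg (hmul himg))).and self_mem_nhdsWithin
  obtain ⟨e, ⟨⟨w1, ⟨hw1, hw1'⟩, he1⟩, ⟨w2, ⟨hw2, hw2'⟩, he2⟩⟩, he0⟩ := hev.exists
  have : w1 = w2 := by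
    apply hinj hw1 hw2
    have : f w1 - f z = f w2 - f z := by
      rw [hw1', hw2', he1, he2, mul_pow, hζ.pow_eq_one, one_mul]
    exact sub_left_inj.1 this
  rw [← this, he1] at he2
  have hζ1 : ζ = 1 := by
    have : (ζ - 1) * e = 0 := by linear_combination -he2
    rcases mul_eq_zero.1 this with h | h
    · exact sub_eq_zero.1 h
    · exact absurd h he0
  exact hζ.ne_one (by omega) hζ1

theorem isOpen_image_of_injOn {f : ℂ → ℂ} {U : Set ℂ} (hU : IsOpen U)
    (hf : DifferentiableOn ℂ f U) (hinj : InjOn f U) : IsOpen (f '' U) := by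
  rw [isOpen_iff_mem_nhds]
  rintro _ ⟨z, hz, rfl⟩
  rw [← (hf.analyticAt (hU.mem_nhds hz)).hasStrictDerivAt.map_nhds_eq
    (deriv_ne_zero_of_injOn hU hf hinj hz)]
  exact image_mem_map (hU.mem_nhds hz)

/-- The inverse of an injective holomorphic function is holomorphic. -/
theorem hasDerivAt_invFunOn {f : ℂ → ℂ} {U : Set ℂ} (hU : IsOpen U)
    (hf : DifferentiableOn ℂ f U) (hinj : InjOn f U) {z : ℂ} (hz : z ∈ U) :
    HasDerivAt (Function.invFunOn f U) (deriv f z)⁻¹ (f z) := by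
  have hne := deriv_ne_zero_of_injOn hU hf hinj hz
  have hs := (hf.analyticAt (hU.mem_nhds hz)).hasStrictDerivAt
  have h1 := (hs.to_localInverse hne).hasDerivAt
  refine h1.congr_of_eventuallyEq ?_
  have hcont := h1.continuousAt
  have hz' : HasStrictDerivAt.localInverse f (deriv f z) z hs hne (f z) = z := by
    exact HasStrictFDerivAt.localInverse_apply_image (hs.hasStrictFDerivAt_equiv hne)
  have hmem : ∀ᶠ w in 𝓝 (f z), HasStrictDerivAt.localInverse f (deriv f z) z hs hne w ∈ U := by
    apply hcont
    rw [hz']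
    exact hU.mem_nhds hz
  have hri : ∀ᶠ w in 𝓝 (f z), f (HasStrictDerivAt.localInverse f (deriv f z) z hs hne w) = w :=
    HasStrictFDerivAt.eventually_right_inverse (hs.hasStrictFDerivAt_equiv hne)
  filter_upwards [hmem, hri] with w h1 h2
  have hex : w ∈ f '' U := ⟨_, h1, h2⟩
  exact hinj (Function.invFunOn_mem hex) h1 ((Function.invFunOn_eq hex).trans h2.symm)

/-! ### Derivatives in a real parameter. -/

theorem hasDerivAt_re {f : ℝ → ℂ} {f' : ℂ} {x : ℝ} (h : HasDerivAt f f' x) :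
    HasDerivAt (fun t => (f t).re) f'.re x :=
  Complex.reCLM.hasFDerivAt.comp_hasDerivAt x h

theorem hasDerivAt_im {f : ℝ → ℂ} {f' : ℂ} {x : ℝ} (h : HasDerivAt f f' x) :
    HasDerivAt (fun t => (f t).im) f'.im x :=
  Complex.imCLM.hasFDerivAt.comp_hasDerivAt x h

theorem hasDerivAt_normSq {f : ℝ → ℂ} {f' : ℂ} {x : ℝ} (h : HasDerivAt f f' x) :
    HasDerivAt (fun t => Complex.normSq (f t)) (2 * ((f x).re * f'.re + (f x).im * f'.im)) x := by
  simp only [Complex.normSq_apply]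
  have h1 := hasDerivAt_re h
  have h2 := hasDerivAt_im h
  exact ((h1.mul h1).add (h2.mul h2)).congr_deriv (by ring)

/-- Serves to differentiate inequalities that hold for positive parameters and are equalities at the
initial one. -/
theorem derivative_nonneg_of_nonneg_right {f : ℝ → ℝ} {f' x : ℝ} (h : HasDerivAt f f' x)
    (h0 : f x = 0) (hf : ∀ t > x, 0 ≤ f t) : 0 ≤ f' := by
  have h1 := (hasDerivAt_iff_tendsto_slope.1 h).mono_left
    (nhdsWithin_mono x (show Ioi x ⊆ {x}ᶜ from fun t ht => ne_of_gt ht))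
  refine ge_of_tendsto h1 ?_
  filter_upwards [self_mem_nhdsWithin] with t ht
  have ht' : x < t := ht
  rw [slope_def_field, h0, sub_zero]
  exact div_nonneg (hf t ht) (by linarith)

/-! ### Functions with convex complement: the semigroup of dilations. -/

/-- An injective holomorphic function on the right half-plane that is infinite at infinity and
omits exactly a convex set. -/
structure IsConcaveOnHalfPlane (F : ℂ → ℂ) : Prop where
  differentiableOn : DifferentiableOn ℂ F rightHalfPlane
  injOn : InjOn F rightHalfPlane
  convex_compl : Convex ℝ (F '' rightHalfPlane)ᶜ
  tendsto_cobounded : Tendsto F (cobounded ℂ ⊓ 𝓟 rightHalfPlane) (cobounded ℂ)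

namespace IsConcaveOnHalfPlane

variable {F : ℂ → ℂ}

theorem differentiableAt (hF : IsConcaveOnHalfPlane F) {v : ℂ} (hv : v ∈ rightHalfPlane) :
    DifferentiableAt ℂ F v :=
  hF.differentiableOn.differentiableAt (isOpen_rightHalfPlane.mem_nhds hv)

theorem differentiableOn_deriv (hF : IsConcaveOnHalfPlane F) :
    DifferentiableOn ℂ (deriv F) rightHalfPlane :=
  hF.differentiableOn.deriv isOpen_rightHalfPlane

theorem deriv_ne_zero (hF : IsConcaveOnHalfPlane F) {v : ℂ} (hv : v ∈ rightHalfPlane) :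
    deriv F v ≠ 0 :=
  deriv_ne_zero_of_injOn isOpen_rightHalfPlane hF.differentiableOn hF.injOn hv

theorem isOpen_image (hF : IsConcaveOnHalfPlane F) : IsOpen (F '' rightHalfPlane) :=
  isOpen_image_of_injOn isOpen_rightHalfPlane hF.differentiableOn hF.injOn

theorem isClosed_compl (hF : IsConcaveOnHalfPlane F) : IsClosed (F '' rightHalfPlane)ᶜ :=
  hF.isOpen_image.isClosed_compl

theorem sub_ne_zero (_hF : IsConcaveOnHalfPlane F) {v k : ℂ} (hv : v ∈ rightHalfPlane)
    (hk : k ∈ (F '' rightHalfPlane)ᶜ) : F v - k ≠ 0 := by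
  intro h
  exact hk ⟨v, hv, _root_.sub_eq_zero.1 h⟩

/-- Otherwise F v would lie on the segment between this point and k, both of them omitted. -/
theorem dilation_mem (hF : IsConcaveOnHalfPlane F) {v k : ℂ} (hv : v ∈ rightHalfPlane)
    (hk : k ∈ (F '' rightHalfPlane)ᶜ) {s : ℝ} (hs : 0 ≤ s) :
    F v + s * (F v - k) ∈ F '' rightHalfPlane := by
  by_contra hmem
  have h1 : (0 : ℝ) < 1 + s := by linarith
  have h1C : ((1 : ℂ) + s) ≠ 0 := by exact_mod_cast h1.ne'
  have := hF.convex_compl hmem hk (a := 1 / (1 + s)) (b := s / (1 + s)) (by positivity)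
    (by positivity) (by field_simp)
  apply this
  refine ⟨v, hv, ?_⟩
  simp only [Complex.real_smul]
  push_cast
  field_simp
  ring

/-- Identifies the generator (F - k)/F' of the maps F⁻¹(F + s(F - k)). -/
theorem hasDerivAt_flow (hF : IsConcaveOnHalfPlane F) {v : ℂ} (hv : v ∈ rightHalfPlane) (k : ℂ) :
    HasDerivAt (fun s : ℝ => Function.invFunOn F rightHalfPlane (F v + s * (F v - k)))
      ((F v - k) / deriv F v) 0 := by
  have h1 := hasDerivAt_invFunOn isOpen_rightHalfPlane hF.differentiableOn hF.injOn hv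
  have h2 : HasDerivAt (fun s : ℂ => F v + s * (F v - k)) (F v - k) ((0 : ℝ) : ℂ) := by
    simpa using ((hasDerivAt_id ((0 : ℝ) : ℂ)).mul_const (F v - k)).const_add (F v)
  have h3 : HasDerivAt (Function.invFunOn F rightHalfPlane) (deriv F v)⁻¹
      (F v + ((0 : ℝ) : ℂ) * (F v - k)) := by simpa using h1
  have h4 := (h3.comp ((0 : ℝ) : ℂ) h2).comp_ofReal
  exact h4.congr_deriv (div_eq_inv_mul _ _).symm

theorem invFunOn_apply (hF : IsConcaveOnHalfPlane F) {v : ℂ} (hv : v ∈ rightHalfPlane) :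
    Function.invFunOn F rightHalfPlane (F v) = v :=
  hF.injOn (Function.invFunOn_mem ⟨v, hv, rfl⟩) hv (Function.invFunOn_eq ⟨v, hv, rfl⟩)

theorem differentiableOn_invFunOn (hF : IsConcaveOnHalfPlane F) :
    DifferentiableOn ℂ (Function.invFunOn F rightHalfPlane) (F '' rightHalfPlane) := by
  rintro _ ⟨v, hv, rfl⟩
  exact (hasDerivAt_invFunOn isOpen_rightHalfPlane hF.differentiableOn hF.injOn
    hv).differentiableAt.differentiableWithinAt

/-- The infinitesimal Schwarz–Pick inequality for the semigroup of dilations centered at an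
omitted point. -/
theorem schwarzPick_generator (hF : IsConcaveOnHalfPlane F) {u v k : ℂ} (hu : u ∈ rightHalfPlane)
    (hv : v ∈ rightHalfPlane) (hk : k ∈ (F '' rightHalfPlane)ᶜ) {G H : ℂ}
    (hG : G = (F u - k) / deriv F u) (hH : H = (F v - k) / deriv F v) :
    2 * ((u - v).re * (G - H).re + (u - v).im * (G - H).im) * (u.re * v.re) ≤
      Complex.normSq (u - v) * (G.re * v.re + u.re * H.re) := by
  have h1 := hF.hasDerivAt_flow hu k
  have h2 := hF.hasDerivAt_flow hv k
  rw [← hG] at h1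
  rw [← hH] at h2
  have hu0 : Function.invFunOn F rightHalfPlane (F u + ((0 : ℝ) : ℂ) * (F u - k)) = u := by
    simpa using hF.invFunOn_apply hu
  have hv0 : Function.invFunOn F rightHalfPlane (F v + ((0 : ℝ) : ℂ) * (F v - k)) = v := by
    simpa using hF.invFunOn_apply hv
  -- Schwarz–Pick for the map at time s is an equality at s = 0, where the map is the identity; so
  -- the right derivative of the difference of its two sides is nonnegative.
  have h3 := ((((hasDerivAt_re h1).mul (hasDerivAt_re h2)).const_mul
    (Complex.normSq (u - v))).sub ((hasDerivAt_normSq (h1.sub h2)).mul_const (u.re * v.re)))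
  have h4 := derivative_nonneg_of_nonneg_right h3
    (by simp only [Pi.sub_apply, Pi.mul_apply, hu0, hv0]; ring) (by
    intro s hs
    have hmaps : ∀ w ∈ rightHalfPlane, F w + s * (F w - k) ∈ F '' rightHalfPlane :=
      fun w hw => hF.dilation_mem hw hk hs.le
    have hd : DifferentiableOn ℂ
        (fun w => Function.invFunOn F rightHalfPlane (F w + s * (F w - k))) rightHalfPlane := by
      refine hF.differentiableOn_invFunOn.comp ?_ hmaps
      have := hF.differentiableOn
      fun_prop
    have hpos : ∀ w ∈ rightHalfPlane,
        0 ≤ (Function.invFunOn F rightHalfPlane (F w + s * (F w - k))).re := by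
      intro w hw
      have hm := Function.invFunOn_mem (hmaps w hw)
      exact (mem_rightHalfPlane.1 hm).le
    have := schwarzPick hd hpos hu hv
    simpa using! this)
  simp only [Pi.sub_apply, hu0, hv0] at h4
  linarith

/-- Otherwise log |F - k| + N/x would be decreasing on [X, ∞), although it tends to infinity. -/
theorem exists_re_logDeriv_ge (hF : IsConcaveOnHalfPlane F) {k : ℂ}
    (hk : k ∈ (F '' rightHalfPlane)ᶜ) (N : ℝ) {X : ℝ} (hX : 0 < X) :
    ∃ x : ℝ, X ≤ x ∧ N / x ^ 2 ≤ (deriv F x / (F x - k)).re := by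
  by_contra! hcon
  have hmem : ∀ x : ℝ, X ≤ x → (x : ℂ) ∈ rightHalfPlane := fun x hx => by
    rw [mem_rightHalfPlane, Complex.ofReal_re]; linarith
  have hder : ∀ x : ℝ, X ≤ x → HasDerivAt
      (fun t : ℝ => Real.log (Complex.normSq (F t - k)) / 2 + N * t⁻¹)
      ((deriv F x / (F x - k)).re - N / x ^ 2) x := by
    intro x hx
    have h1 := ((hF.differentiableAt (hmem x hx)).hasDerivAt.comp_ofReal).sub_const k
    have hne := hF.sub_ne_zero (hmem x hx) hk
    have hne' : Complex.normSq (F x - k) ≠ 0 := (Complex.normSq_pos.2 hne).ne'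
    have hx0 : x ≠ 0 := by linarith
    have h2 := (((hasDerivAt_normSq h1).log hne').div_const 2).add
      ((hasDerivAt_inv hx0).const_mul N)
    refine h2.congr_deriv ?_
    rw [Complex.div_re]
    field_simp
    ring
  have hanti : AntitoneOn (fun t : ℝ => Real.log (Complex.normSq (F t - k)) / 2 + N * t⁻¹)
      (Ici X) := by
    apply antitoneOn_of_deriv_nonpos (convex_Ici X)
    · exact fun x hx => (hder x hx).continuousAt.continuousWithinAt
    · intro x hx
      rw [interior_Ici] at hx
      exact (hder x (le_of_lt hx)).differentiableAt.differentiableWithinAt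
    · intro x hx
      rw [interior_Ici] at hx
      rw [(hder x (le_of_lt hx)).deriv]
      linarith [hcon x (le_of_lt hx)]
  have hlim : Tendsto (fun t : ℝ => Real.log (Complex.normSq (F t - k)) / 2 + N * t⁻¹) atTop
      atTop := by
    have h1 : Tendsto (fun t : ℝ => (t : ℂ)) atTop (cobounded ℂ ⊓ 𝓟 rightHalfPlane) := by
      rw [tendsto_inf]
      refine ⟨RCLike.tendsto_ofReal_atTop_cobounded ℂ, ?_⟩
      rw [tendsto_principal]
      filter_upwards [eventually_ge_atTop X] with x hx using hmem x hx
    have h2 : Tendsto (fun t : ℝ => ‖F t - k‖) atTop atTop := by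
      have := (tendsto_norm_cobounded_atTop (E := ℂ)).comp (hF.tendsto_cobounded.comp h1)
      refine tendsto_atTop_mono (fun t => ?_) (tendsto_atTop_add_const_right _ (-‖k‖) this)
      simp only [Function.comp_apply]
      linarith [norm_sub_norm_le (F t) k]
    have h3 : Tendsto (fun t : ℝ => Real.log ‖F t - k‖) atTop atTop :=
      Real.tendsto_log_atTop.comp h2
    have h4 : Tendsto (fun t : ℝ => N * t⁻¹) atTop (𝓝 (N * 0)) :=
      tendsto_inv_atTop_zero.const_mul N
    refine (h3.atTop_add h4).congr fun t => ?_
    rw [Complex.normSq_eq_norm_sq, Real.log_pow]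
    push_cast
    ring
  obtain ⟨x, hx1, hx2⟩ := ((hlim.eventually_gt_atTop
    (Real.log (Complex.normSq (F X - k)) / 2 + N * X⁻¹)).and (eventually_ge_atTop X)).exists
  have := hanti (mem_Ici.2 le_rfl) (mem_Ici.2 hx2) hx2
  simp only at this
  linarith

/-- The image is starlike at infinity with respect to every omitted point. -/
theorem re_logDeriv_nonneg (hF : IsConcaveOnHalfPlane F) {v k : ℂ} (hv : v ∈ rightHalfPlane)
    (hk : k ∈ (F '' rightHalfPlane)ᶜ) : 0 ≤ (deriv F v / (F v - k)).re := by
  have hne := hF.sub_ne_zero hv hk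
  have hd := hF.deriv_ne_zero hv
  set G := (F v - k) / deriv F v with hG
  suffices h : 0 ≤ G.re by
    have h1 : deriv F v / (F v - k) = G⁻¹ := by rw [hG, inv_div]
    rw [h1, Complex.inv_re]
    exact div_nonneg h (Complex.normSq_nonneg _)
  -- The second point in the generator inequality runs to ∞ along the real axis. There the generator
  -- H satisfies Re H ≥ 0 and |H| ≤ x²/(N + 1); after division by x³ the inequality becomes 0 ≤ Re G
  -- in the limit.
  have hx : ∀ N : ℕ, ∃ x : ℝ, (N + 1 + ‖v‖) ≤ x ∧ (N + 1) / x ^ 2 ≤ (deriv F x / (F x - k)).re :=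
    fun N => hF.exists_re_logDeriv_ge hk _ (by positivity)
  choose x hx1 hx2 using hx
  have ha : 0 < v.re := hv
  have hxpos : ∀ N, 0 < x N := fun N => by
    have := hx1 N
    have := norm_nonneg v
    have : (0 : ℝ) ≤ N := Nat.cast_nonneg N
    linarith
  have key : ∀ N : ℕ, 2 * v.re * ((v.re * (x N)⁻¹ ^ 2 - (x N)⁻¹) * G.re
      + v.im * G.im * (x N)⁻¹ ^ 2) - 2 * v.re * |v.im| * ((N : ℝ) + 1)⁻¹ ≤
      G.re * ((1 - v.re * (x N)⁻¹) ^ 2 + (v.im * (x N)⁻¹) ^ 2) := by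
    intro N
    have hp := hxpos N
    have hmem : (x N : ℂ) ∈ rightHalfPlane := by
      rw [mem_rightHalfPlane, Complex.ofReal_re]; exact hp
    have hne2 := hF.sub_ne_zero hmem hk
    set H := (F (x N) - k) / deriv F (x N) with hH
    have hH0 : H ≠ 0 := div_ne_zero hne2 (hF.deriv_ne_zero hmem)
    have h1 : deriv F (x N) / (F (x N) - k) = H⁻¹ := by rw [hH, inv_div]
    have h2 := hx2 N
    rw [h1] at h2
    have hN : (0 : ℝ) < N + 1 := by positivity
    have h3 : ‖H‖ ≤ x N ^ 2 * ((N : ℝ) + 1)⁻¹ := by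
      have h4 : (N + 1) / x N ^ 2 ≤ ‖H‖⁻¹ := by
        rw [← norm_inv]; exact h2.trans (Complex.re_le_norm _)
      have h5 := inv_anti₀ (by positivity) h4
      rw [inv_inv, inv_div] at h5
      rwa [← div_eq_mul_inv]
    have hHre : 0 ≤ H.re := by
      rw [Complex.inv_re] at h2
      have h6 : 0 < H.re / Complex.normSq H := lt_of_lt_of_le (by positivity) h2
      have := (div_pos_iff_of_pos_right (Complex.normSq_pos.2 hH0)).1 h6
      exact this.le
    have h7 := hF.schwarzPick_generator hv hmem hk hG hH
    simp only [Complex.sub_re, Complex.sub_im, Complex.ofReal_re, Complex.ofReal_im, sub_zero,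
      Complex.normSq_apply] at h7
    have h8 : v.im * H.im ≤ |v.im| * (x N ^ 2 * ((N : ℝ) + 1)⁻¹) := by
      calc v.im * H.im ≤ |v.im * H.im| := le_abs_self _
        _ = |v.im| * |H.im| := abs_mul _ _
        _ ≤ _ := mul_le_mul_of_nonneg_left ((Complex.abs_im_le_norm H).trans h3) (abs_nonneg _)
    have h9 : v.re ^ 2 + v.im ^ 2 ≤ x N ^ 2 := by
      have : v.re ^ 2 + v.im ^ 2 = ‖v‖ ^ 2 := by
        rw [← Complex.normSq_eq_norm_sq, Complex.normSq_apply]; ring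
      rw [this]
      have h10 := hx1 N
      exact pow_le_pow_left₀ (norm_nonneg v) (by linarith) 2
    -- The terms containing Re H add up to this quantity on the smaller side, so they can be dropped
    -- once x ≥ |v|.
    have h11 : 0 ≤ v.re * H.re * (x N ^ 2 - (v.re ^ 2 + v.im ^ 2)) := by
      have := mul_nonneg ha.le hHre
      exact mul_nonneg this (by linarith)
    have h12 : 2 * v.re * x N * (v.im * H.im) ≤
        2 * v.re * x N * (|v.im| * (x N ^ 2 * ((N : ℝ) + 1)⁻¹)) :=
      mul_le_mul_of_nonneg_left h8 (by positivity)
    have h13 : 2 * v.re * x N * ((v.re - x N) * G.re + v.im * G.im -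
        |v.im| * (x N ^ 2 * ((N : ℝ) + 1)⁻¹)) ≤
        G.re * x N * ((v.re - x N) ^ 2 + v.im ^ 2) := by
      linarith
    have h14 := div_le_div_of_nonneg_right h13 (pow_pos hp 3).le
    have h15 : 2 * v.re * x N * ((v.re - x N) * G.re + v.im * G.im -
        |v.im| * (x N ^ 2 * ((N : ℝ) + 1)⁻¹)) / x N ^ 3 = 2 * v.re * ((v.re * (x N)⁻¹ ^ 2 -
        (x N)⁻¹) * G.re + v.im * G.im * (x N)⁻¹ ^ 2) - 2 * v.re * |v.im| * ((N : ℝ) + 1)⁻¹ := by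
      field_simp
    have h16 : G.re * x N * ((v.re - x N) ^ 2 + v.im ^ 2) / x N ^ 3 =
        G.re * ((1 - v.re * (x N)⁻¹) ^ 2 + (v.im * (x N)⁻¹) ^ 2) := by
      field_simp
      ring
    rwa [h15, h16] at h14
  have hxt : Tendsto x atTop atTop := by
    refine tendsto_atTop_mono (fun N => ?_) tendsto_natCast_atTop_atTop
    have := hx1 N
    have := norm_nonneg v
    linarith
  have ht : Tendsto (fun N => (x N)⁻¹) atTop (𝓝 0) := tendsto_inv_atTop_zero.comp hxt
  have hN : Tendsto (fun N : ℕ => ((N : ℝ) + 1)⁻¹) atTop (𝓝 0) := by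
    simpa using tendsto_one_div_add_atTop_nhds_zero_nat (𝕜 := ℝ)
  have hL := (((((ht.pow 2).const_mul v.re).sub ht).mul_const G.re).add
    ((ht.pow 2).const_mul (v.im * G.im))).const_mul (2 * v.re) |>.sub
      (hN.const_mul (2 * v.re * |v.im|))
  have hR := ((((ht.const_mul v.re).const_sub 1).pow 2).add
    ((ht.const_mul v.im).pow 2)).const_mul G.re
  have := le_of_tendsto_of_tendsto' hL hR key
  simpa using this

end IsConcaveOnHalfPlane

/-! ### Unboundedness of the omitted set and nearest omitted points. -/

/-- Infinitesimal Schwarz–Pick inequality for maps of the right half-plane to its closure. -/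
theorem normSq_deriv_le {φ : ℂ → ℂ} (hφ : DifferentiableOn ℂ φ rightHalfPlane)
    (hre : ∀ v ∈ rightHalfPlane, 0 ≤ (φ v).re) {v : ℂ} (hv : v ∈ rightHalfPlane) :
    Complex.normSq (deriv φ v) * v.re ^ 2 ≤ (φ v).re ^ 2 := by
  have hd := (hφ.differentiableAt (isOpen_rightHalfPlane.mem_nhds hv))
  have h1 := hasDerivAt_iff_tendsto_slope.1 hd.hasDerivAt
  have h2 : Tendsto (fun u => Complex.normSq (slope φ v u) * (u.re * v.re)) (𝓝[≠] v)
      (𝓝 (Complex.normSq (deriv φ v) * (v.re * v.re))) :=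
    ((Complex.continuous_normSq.tendsto _).comp h1).mul
      (((Complex.continuous_re.tendsto v).mono_left nhdsWithin_le_nhds).mul_const _)
  have h3 : Tendsto (fun u => (φ u).re * (φ v).re) (𝓝[≠] v) (𝓝 ((φ v).re * (φ v).re)) :=
    (((Complex.continuous_re.tendsto _).comp
      (hd.continuousAt.tendsto.mono_left nhdsWithin_le_nhds))).mul_const _
  have h4 := le_of_tendsto_of_tendsto h2 h3 (by
    filter_upwards [self_mem_nhdsWithin,
      nhdsWithin_le_nhds (isOpen_rightHalfPlane.mem_nhds hv)] with u hu huH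
    have h5 := schwarzPick hφ hre huH hv
    have h6 : 0 < Complex.normSq (u - v) := Complex.normSq_pos.2 (sub_ne_zero.2 hu)
    rw [slope_def_field, Complex.normSq_div, div_mul_eq_mul_div, div_le_iff₀ h6]
    linarith)
  rw [sq, sq]
  exact h4

theorem tendsto_nhds_mul_I_of_re {y : ℝ} {u : ℕ → ℂ}
    (hu : Tendsto u atTop (𝓝 (y * Complex.I : ℂ))) : Tendsto (fun n => (u n).re) atTop (𝓝 0) := by
  have h := (Complex.continuous_re.tendsto _).comp hu
  have h0 : (y * Complex.I : ℂ).re = 0 := by simp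
  rwa [h0] at h

theorem one_sub_cayley {w : ℂ} (hw : w + 1 ≠ 0) : 1 - (w - 1) / (w + 1) = 2 / (w + 1) := by
  field_simp
  ring

theorem one_add_cayley_div {w : ℂ} (hw : w + 1 ≠ 0) :
    (1 + (w - 1) / (w + 1)) / (1 - (w - 1) / (w + 1)) = w := by
  rw [one_sub_cayley hw, div_eq_iff (div_ne_zero two_ne_zero hw)]
  field_simp
  ring

namespace IsConcaveOnHalfPlane

variable {F : ℂ → ℂ}

/-- The omitted set is unbounded. -/
theorem not_isBounded_compl (hF : IsConcaveOnHalfPlane F) :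
    ¬ IsBounded (F '' rightHalfPlane)ᶜ := by
  intro hb
  rw [isBounded_iff_forall_norm_le] at hb
  obtain ⟨R, hR⟩ := hb
  set δ : ℝ := (|R| + 1)⁻¹ with hδ
  have hδ0 : 0 < δ := by positivity
  have hmem : ∀ u ∈ Metric.ball (0 : ℂ) δ \ {0}, u⁻¹ ∈ F '' rightHalfPlane := by
    intro u hu
    by_contra h
    have h1 := hR _ h
    have h2 : ‖u‖ < δ := by simpa using hu.1
    have h3 : 0 < ‖u‖ := norm_pos_iff.2 hu.2
    rw [norm_inv] at h1
    have h4 := (inv_lt_inv₀ hδ0 h3).2 h2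
    rw [hδ, inv_inv] at h4
    linarith [le_abs_self R]
  -- The inverse of F near ∞, in the variable u = 1/w and with values in the disk, is bounded and so
  -- extends holomorphically to u = 0. Its value p there has modulus 1, against the maximum
  -- principle.
  set j : ℂ → ℂ := fun u => (Function.invFunOn F rightHalfPlane u⁻¹ - 1) /
    (Function.invFunOn F rightHalfPlane u⁻¹ + 1) with hj
  have hinv : ∀ u ∈ Metric.ball (0 : ℂ) δ \ {0},
      Function.invFunOn F rightHalfPlane u⁻¹ ∈ rightHalfPlane :=
    fun u hu => Function.invFunOn_mem (hmem u hu)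
  have hne : ∀ w ∈ rightHalfPlane, w + 1 ≠ 0 := by
    intro w hw h
    have h1 := congrArg Complex.re h
    have h2 : 0 < w.re := hw
    simp at h1
    linarith
  have hnorm : ∀ w ∈ rightHalfPlane, ‖(w - 1) / (w + 1)‖ < 1 := by
    intro w hw
    have h2 : 0 < w.re := hw
    rw [norm_div, div_lt_one (norm_pos_iff.2 (hne w hw)), ← sq_lt_sq₀ (norm_nonneg _)
      (norm_nonneg _), ← Complex.normSq_eq_norm_sq, ← Complex.normSq_eq_norm_sq,
      Complex.normSq_apply, Complex.normSq_apply]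
    simp
    nlinarith
  have hjd : DifferentiableOn ℂ j (Metric.ball 0 δ \ {0}) := by
    have h1 : DifferentiableOn ℂ (fun u : ℂ => Function.invFunOn F rightHalfPlane u⁻¹)
        (Metric.ball 0 δ \ {0}) :=
      hF.differentiableOn_invFunOn.comp (differentiableOn_inv.mono fun u hu => hu.2) hmem
    exact (h1.sub_const _).div (h1.add_const _) fun u hu => hne _ (hinv u hu)
  have hball : Metric.ball (0 : ℂ) δ ∈ 𝓝 0 := Metric.ball_mem_nhds _ hδ0
  have hbdd : BddAbove (norm ∘ j '' (Metric.ball 0 δ \ {0})) := by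
    refine ⟨1, ?_⟩
    rintro _ ⟨u, hu, rfl⟩
    exact (hnorm _ (hinv u hu)).le
  have hext := Complex.differentiableOn_update_limUnder_of_bddAbove hball hjd hbdd
  set p := limUnder (𝓝[≠] 0) j with hp
  have hlim : Tendsto j (𝓝[≠] 0) (𝓝 p) := by
    have h1 := (hext.differentiableAt hball).continuousAt.tendsto
    rw [Function.update_self] at h1
    refine (h1.mono_left nhdsWithin_le_nhds).congr' ?_
    filter_upwards [self_mem_nhdsWithin] with u hu
    exact Function.update_of_ne hu _ _
  have hev : ∀ᶠ u in 𝓝[≠] (0 : ℂ), u ∈ Metric.ball (0 : ℂ) δ \ {0} := by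
    filter_upwards [nhdsWithin_le_nhds hball, self_mem_nhdsWithin] with u h1 h2 using ⟨h1, h2⟩
  have hp1 : ‖p‖ = 1 := by
    refine le_antisymm (le_of_tendsto hlim.norm (hev.mono fun u hu => (hnorm _ (hinv u hu)).le)) ?_
    -- If |p| < 1, the inverse tends to a point w of the half-plane, and continuity of F at w
    -- contradicts F taking the values 1/u → ∞.
    by_contra! hlt
    have hp1 : (1 : ℂ) - p ≠ 0 := by
      intro h
      have : p = 1 := by linear_combination -h
      rw [this] at hlt; simp at hlt
    set w := (1 + p) / (1 - p) with hw
    have hwH : w ∈ rightHalfPlane := by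
      rw [mem_rightHalfPlane, hw, Complex.div_re, ← add_div]
      apply div_pos _ (Complex.normSq_pos.2 hp1)
      have : Complex.normSq p < 1 := by
        rw [Complex.normSq_eq_norm_sq]; nlinarith [norm_nonneg p]
      rw [Complex.normSq_apply] at this
      simp
      nlinarith
    have h1 : Tendsto (fun u => (1 + j u) / (1 - j u)) (𝓝[≠] 0) (𝓝 w) :=
      (hlim.const_add 1).div (hlim.const_sub 1) hp1
    have h2 := ((hF.differentiableAt hwH).continuousAt.tendsto.comp h1).norm
    have h3 : Tendsto (fun u : ℂ => ‖u⁻¹‖) (𝓝[≠] 0) atTop :=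
      tendsto_norm_cobounded_atTop.comp tendsto_inv₀_nhdsNE_zero
    refine not_tendsto_nhds_of_tendsto_atTop h3 _ (h2.congr' ?_)
    filter_upwards [hev] with u hu
    have h4 : (1 + j u) / (1 - j u) = Function.invFunOn F rightHalfPlane u⁻¹ :=
      one_add_cayley_div (hne _ (hinv u hu))
    simp only [Function.comp_apply, h4]
    rw [Function.invFunOn_eq (hmem u hu)]
  have hmax : IsMaxOn (norm ∘ Function.update j 0 p) (Metric.ball 0 δ) 0 := by
    intro u hu
    simp only [mem_ofPred_eq, Function.comp_apply, Function.update_self, hp1]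
    by_cases hu0 : u = 0
    · rw [hu0, Function.update_self, hp1]
    · rw [Function.update_of_ne hu0]
      exact (hnorm _ (hinv u ⟨hu, hu0⟩)).le
  have hconst := Complex.norm_eqOn_of_isPreconnected_of_isMaxOn
    (convex_ball (0 : ℂ) δ).isPreconnected Metric.isOpen_ball hext (Metric.mem_ball_self hδ0) hmax
  obtain ⟨u, hu⟩ := hev.exists
  have h1 := hconst hu.1
  simp only [Function.comp_apply, Function.const_apply, Function.update_self] at h1
  rw [Function.update_of_ne hu.2, hp1] at h1
  exact (hnorm _ (hinv u hu)).ne h1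

theorem nonempty_compl (hF : IsConcaveOnHalfPlane F) : (F '' rightHalfPlane)ᶜ.Nonempty := by
  rw [nonempty_iff_ne_empty]
  intro h
  apply hF.not_isBounded_compl
  rw [h]
  exact isBounded_empty

/-- Re F'/(F - k) is the logarithmic derivative of |F - k| in the real direction. The estimate keeps
F bounded near finite boundary points. -/
theorem norm_sub_le_norm_add_sub (hF : IsConcaveOnHalfPlane F) {v k : ℂ} (hv : v ∈ rightHalfPlane)
    (hk : k ∈ (F '' rightHalfPlane)ᶜ) {t : ℝ} (ht : 0 ≤ t) : ‖F v - k‖ ≤ ‖F (v + t) - k‖ := by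
  have hmem : ∀ s : ℝ, 0 ≤ s → v + s ∈ rightHalfPlane := by
    intro s hs
    have : 0 < v.re := hv
    rw [mem_rightHalfPlane]; simp; linarith
  have hder : ∀ s : ℝ, 0 ≤ s → HasDerivAt (fun s : ℝ => Complex.normSq (F (v + s) - k))
      (2 * (Complex.normSq (F (v + s) - k) * (deriv F (v + s) / (F (v + s) - k)).re)) s := by
    intro s hs
    have h1 : HasDerivAt (fun s : ℂ => F (v + s) - k) (deriv F (v + s)) (s : ℂ) :=
      ((hF.differentiableAt (hmem s hs)).hasDerivAt.comp_const_add v (s : ℂ)).sub_const k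
    refine (hasDerivAt_normSq h1.comp_ofReal).congr_deriv ?_
    have hne := (Complex.normSq_pos.2 (hF.sub_ne_zero (hmem s hs) hk)).ne'
    rw [Complex.div_re]
    field_simp
  have hmono : MonotoneOn (fun s : ℝ => Complex.normSq (F (v + s) - k)) (Ici 0) := by
    apply monotoneOn_of_deriv_nonneg (convex_Ici 0)
    · exact fun x hx => (hder x hx).continuousAt.continuousWithinAt
    · intro x hx
      rw [interior_Ici] at hx
      exact (hder x (le_of_lt hx)).differentiableAt.differentiableWithinAt
    · intro x hx
      rw [interior_Ici] at hx
      rw [(hder x (le_of_lt hx)).deriv]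
      have := hF.re_logDeriv_nonneg (hmem x (le_of_lt hx)) hk
      have := Complex.normSq_nonneg (F (v + x) - k)
      positivity
  have h := hmono (mem_Ici.2 le_rfl) (mem_Ici.2 ht) ht
  simp only [Complex.ofReal_zero, add_zero] at h
  rwa [Complex.normSq_eq_norm_sq, Complex.normSq_eq_norm_sq,
    sq_le_sq₀ (norm_nonneg _) (norm_nonneg _)] at h

/-- The omitted set lies beyond the line through k perpendicular to F ζ - k, so the image contains
the half-plane in front of it. Infinitesimal Schwarz–Pick for F⁻¹ on that half-plane bounds the
generator at ζ. -/
theorem exists_nearest (hF : IsConcaveOnHalfPlane F) {ζ : ℂ} (hζ : ζ ∈ rightHalfPlane) :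
    ∃ k ∈ (F '' rightHalfPlane)ᶜ, (∀ w ∈ (F '' rightHalfPlane)ᶜ, ‖F ζ - k‖ ≤ ‖F ζ - w‖) ∧
      ‖(F ζ - k) / deriv F ζ‖ ≤ ζ.re := by
  have hζ' : 0 < ζ.re := hζ
  obtain ⟨k, hk, hmin⟩ := exists_norm_eq_iInf_of_complete_convex hF.nonempty_compl
    hF.isClosed_compl.isComplete hF.convex_compl (F ζ)
  have hin := (norm_eq_iInf_iff_real_inner_le_zero hF.convex_compl hk).1 hmin
  refine ⟨k, hk, fun w hw => ?_, ?_⟩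
  · rw [hmin]
    exact ciInf_le (f := fun w : ↥(F '' rightHalfPlane)ᶜ => ‖F ζ - w‖)
      ⟨0, by rintro _ ⟨x, rfl⟩; exact norm_nonneg _⟩ ⟨w, hw⟩
  · have hne := hF.sub_ne_zero hζ hk
    -- The variational inequality characterizing the projection k onto a closed convex set.
    have hmaps : ∀ u ∈ rightHalfPlane, k + (F ζ - k) * u ∈ F '' rightHalfPlane := by
      intro u hu
      have hu' : 0 < u.re := hu
      by_contra h
      have h1 := hin _ h
      have h2 : inner ℝ (F ζ - k) (k + (F ζ - k) * u - k) = Complex.normSq (F ζ - k) * u.re := by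
        rw [add_sub_cancel_left, Complex.inner, Complex.normSq_apply]
        simp only [Complex.mul_re, Complex.mul_im, Complex.conj_re, Complex.conj_im]
        ring
      rw [h2] at h1
      have := mul_pos (Complex.normSq_pos.2 hne) hu'
      linarith
    set φ : ℂ → ℂ := fun u => Function.invFunOn F rightHalfPlane (k + (F ζ - k) * u) with hφ
    have hφd : DifferentiableOn ℂ φ rightHalfPlane :=
      hF.differentiableOn_invFunOn.comp (by fun_prop) hmaps
    have hpos : ∀ u ∈ rightHalfPlane, 0 ≤ (φ u).re := by
      intro u hu
      have hm := Function.invFunOn_mem (hmaps u hu)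
      exact (mem_rightHalfPlane.1 hm).le
    have h1 : (1 : ℂ) ∈ rightHalfPlane := by simp [mem_rightHalfPlane]
    have h2 := normSq_deriv_le hφd hpos h1
    have h3 : HasDerivAt φ ((deriv F ζ)⁻¹ * (F ζ - k)) 1 := by
      have h4 := hasDerivAt_invFunOn isOpen_rightHalfPlane hF.differentiableOn hF.injOn hζ
      have h5 : HasDerivAt (fun u : ℂ => k + (F ζ - k) * u) (F ζ - k) 1 := by
        simpa using ((hasDerivAt_id (1 : ℂ)).const_mul (F ζ - k)).const_add k
      have h6 : HasDerivAt (Function.invFunOn F rightHalfPlane) (deriv F ζ)⁻¹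
          (k + (F ζ - k) * 1) := by
        have : k + (F ζ - k) * 1 = F ζ := by ring
        rwa [this]
      exact h6.comp 1 h5
    have h7 : φ 1 = ζ := by
      have : k + (F ζ - k) * 1 = F ζ := by ring
      simp only [hφ, this]
      exact hF.invFunOn_apply hζ
    rw [h3.deriv, h7, Complex.normSq_eq_norm_sq] at h2
    rw [div_eq_inv_mul]
    simp only [Complex.one_re, one_pow, mul_one] at h2
    exact (sq_le_sq₀ (norm_nonneg _) hζ'.le).1 h2

end IsConcaveOnHalfPlane

/-! ### The two-point quotient and Re F''/F' ≥ 0. -/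

/-- Second-order difference quotient: the derivative of `dslope f c` at `c`. -/
theorem deriv_dslope_same {f : ℂ → ℂ} {U : Set ℂ} (hU : IsOpen U) (hf : DifferentiableOn ℂ f U)
    {c : ℂ} (hc : c ∈ U) : deriv (dslope f c) c = deriv (deriv f) c / 2 := by
  have hD : DifferentiableOn ℂ (dslope f c) U :=
    (Complex.differentiableOn_dslope (hU.mem_nhds hc)).2 hf
  have hD' : DifferentiableOn ℂ (deriv (dslope f c)) U := hD.deriv hU
  have h1 : ∀ z ∈ U, deriv f z = dslope f c z + (z - c) * deriv (dslope f c) z := by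
    intro z hz
    have h2 : f = fun w => f c + (w - c) * dslope f c w := by
      funext w
      have := sub_smul_dslope f c w
      rw [smul_eq_mul] at this
      rw [this]; ring
    have h3 := (((hasDerivAt_id z).sub_const c).mul
      (hD.differentiableAt (hU.mem_nhds hz)).hasDerivAt).const_add (f c)
    have h4 : HasDerivAt f (1 * dslope f c z + (z - c) * deriv (dslope f c) z) z := by
      nth_rw 1 [h2]
      exact h3
    rw [h4.deriv, one_mul]
  have h5 : deriv f =ᶠ[𝓝 c] fun z => dslope f c z + (z - c) * deriv (dslope f c) z := by
    filter_upwards [hU.mem_nhds hc] with z hz using h1 z hz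
  have h6 := (hD.differentiableAt (hU.mem_nhds hc)).hasDerivAt.add
    (((hasDerivAt_id c).sub_const c).mul (hD'.differentiableAt (hU.mem_nhds hc)).hasDerivAt)
  have h7 := (h6.congr_of_eventuallyEq h5).deriv
  simp at h7
  rw [h7]; ring

/-- For holomorphic injective F the left side extends the right side holomorphically across ζ = v,
with value F''(v)/(2F'(v)) there. -/
theorem dslope_dslope_div_eq {F : ℂ → ℂ} {v ζ : ℂ} (h : F v ≠ F ζ) :
    dslope (dslope F v) v ζ / dslope F v ζ = deriv F v / (F v - F ζ) - 1 / (v - ζ) := by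
  have hne : ζ ≠ v := by rintro rfl; exact h rfl
  have h1 : v - ζ ≠ 0 := sub_ne_zero.2 hne.symm
  have h2 : F v - F ζ ≠ 0 := sub_ne_zero.2 h
  have h3 : ζ - v ≠ 0 := sub_ne_zero.2 hne
  have h4 : F ζ - F v ≠ 0 := sub_ne_zero.2 h.symm
  rw [dslope_of_ne _ hne, slope_def_field, dslope_same, dslope_of_ne _ hne, slope_def_field]
  have h5 : ζ - v = -(v - ζ) := by ring
  have h6 : F ζ - F v = -(F v - F ζ) := by ring
  rw [h5, h6]
  field_simp
  ring

theorem tendsto_div_sub_sub_atInfinity {F : ℂ → ℂ}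
    (hF : Tendsto F (cobounded ℂ ⊓ 𝓟 rightHalfPlane) (cobounded ℂ)) (a b v : ℂ) :
    Tendsto (fun ζ => a / (b - F ζ) - 1 / (v - ζ)) (cobounded ℂ ⊓ 𝓟 rightHalfPlane) (𝓝 0) := by
  have h1 : ∀ c : ℂ, Tendsto (fun w : ℂ => (c - w)⁻¹) (cobounded ℂ) (𝓝 0) := fun c => by
    have := tendsto_inv₀_cobounded.comp ((tendsto_const_add_cobounded c).comp
      (tendsto_neg_cobounded (E := ℂ)))
    simpa [sub_eq_add_neg, Function.comp_def] using this
  have h2 := (((h1 b).comp hF).const_mul a).sub ((h1 v).mono_left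
    (inf_le_left : cobounded ℂ ⊓ 𝓟 rightHalfPlane ≤ cobounded ℂ))
  simpa [div_eq_mul_inv, Function.comp_def] using h2

namespace IsConcaveOnHalfPlane

variable {F : ℂ → ℂ}

theorem dslope_ne_zero (hF : IsConcaveOnHalfPlane F) {v ζ : ℂ} (hv : v ∈ rightHalfPlane)
    (hζ : ζ ∈ rightHalfPlane) : dslope F v ζ ≠ 0 := by
  by_cases h : ζ = v
  · rw [h, dslope_same]; exact hF.deriv_ne_zero hv
  · rw [dslope_of_ne _ h, slope_def_field]
    exact div_ne_zero (_root_.sub_ne_zero.2 fun h2 => h (hF.injOn hζ hv h2)) (_root_.sub_ne_zero.2 h)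

theorem differentiableOn_quotient (hF : IsConcaveOnHalfPlane F) {v : ℂ} (hv : v ∈ rightHalfPlane) :
    DifferentiableOn ℂ (fun ζ => dslope (dslope F v) v ζ / dslope F v ζ) rightHalfPlane := by
  have hn := isOpen_rightHalfPlane.mem_nhds hv
  have h1 := (Complex.differentiableOn_dslope hn).2 hF.differentiableOn
  exact ((Complex.differentiableOn_dslope hn).2 h1).div h1 fun ζ hζ => hF.dslope_ne_zero hv hζ

/-- The point mass at a boundary point can be removed. -/
theorem re_boundary_limit (hF : IsConcaveOnHalfPlane F) {v : ℂ} (hv : v ∈ rightHalfPlane)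
    {y : ℝ} {ζ : ℕ → ℂ} (hζ : ∀ n, ζ n ∈ rightHalfPlane)
    (hlim : Tendsto ζ atTop (𝓝 (y * Complex.I : ℂ))) {w : ℂ}
    (hw : Tendsto (fun n => F (ζ n)) atTop (𝓝 w)) :
    w ∈ (F '' rightHalfPlane)ᶜ ∧
      (1 / (v - y * Complex.I)).re ≤ (deriv F v / (F v - w)).re := by
  have hv' : 0 < v.re := hv
  have hwK : w ∈ (F '' rightHalfPlane)ᶜ := by
    rintro ⟨u, hu, rfl⟩
    have h1 := (hasDerivAt_invFunOn isOpen_rightHalfPlane hF.differentiableOn hF.injOn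
      hu).continuousAt.tendsto.comp hw
    rw [hF.invFunOn_apply hu] at h1
    have h2 : Tendsto ζ atTop (𝓝 u) := h1.congr fun n => hF.invFunOn_apply (hζ n)
    have h3 := tendsto_nhds_unique hlim h2
    have h4 : 0 < u.re := hu
    rw [← h3] at h4
    simp at h4
  refine ⟨hwK, ?_⟩
  -- A Julia-type argument: Schwarz–Pick is applied to the generator (F - k n)/F', where k n is the
  -- omitted point nearest to F (ζ n). The generator is at most Re (ζ n) in modulus at ζ n, and this
  -- factor cancels with the one on the other side.
  choose k hkK hkmin hk using fun n => hF.exists_nearest (hζ n)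
  have hd0 := hF.deriv_ne_zero hv
  have hkw : Tendsto k atTop (𝓝 w) := by
    have h1 : Tendsto (fun n => F (ζ n) - k n) atTop (𝓝 0) := by
      have h2 : Tendsto (fun n => ‖F (ζ n) - w‖) atTop (𝓝 0) := by
        have := (hw.sub_const w).norm
        simpa using this
      exact squeeze_zero_norm (fun n => hkmin n w hwK) h2
    have := hw.sub h1
    simpa using this
  have hμ : Tendsto (fun n => (F (ζ n) - k n) / deriv F (ζ n)) atTop (𝓝 0) :=
    squeeze_zero_norm hk (tendsto_nhds_mul_I_of_re hlim)
  have key : ∀ n, Complex.normSq ((F v - k n) / deriv F v - (F (ζ n) - k n) / deriv F (ζ n)) *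
      v.re ≤ Complex.normSq (v - ζ n) * ((F v - k n) / deriv F v).re := by
    intro n
    have hd : DifferentiableOn ℂ (fun u => (F u - k n) / deriv F u) rightHalfPlane :=
      (hF.differentiableOn.sub_const _).div hF.differentiableOn_deriv
        fun u hu => hF.deriv_ne_zero hu
    have hpos : ∀ u ∈ rightHalfPlane, 0 ≤ ((F u - k n) / deriv F u).re := by
      intro u hu
      have h1 := hF.re_logDeriv_nonneg hu (hkK n)
      rw [← inv_div, Complex.inv_re]
      exact div_nonneg h1 (Complex.normSq_nonneg _)
    have h1 := schwarzPick hd hpos hv (hζ n)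
    have h2 : 0 < (ζ n).re := hζ n
    have h3 : ((F (ζ n) - k n) / deriv F (ζ n)).re ≤ (ζ n).re :=
      (Complex.re_le_norm _).trans (hk n)
    have h4 : ((F v - k n) / deriv F v).re * ((F (ζ n) - k n) / deriv F (ζ n)).re ≤
        ((F v - k n) / deriv F v).re * (ζ n).re := mul_le_mul_of_nonneg_left h3 (hpos v hv)
    have h5 := h1.trans (mul_le_mul_of_nonneg_left h4 (Complex.normSq_nonneg _))
    rw [← mul_assoc, ← mul_assoc] at h5
    exact le_of_mul_le_mul_right h5 h2
  have hm : Tendsto (fun n => (F v - k n) / deriv F v) atTop (𝓝 ((F v - w) / deriv F v)) :=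
    (hkw.const_sub _).div_const _
  have h1 := ((Complex.continuous_normSq.tendsto _).comp (hm.sub hμ)).mul_const v.re
  have h2 := ((Complex.continuous_normSq.tendsto _).comp (hlim.const_sub v)).mul
    ((Complex.continuous_re.tendsto _).comp hm)
  have h3 := le_of_tendsto_of_tendsto' h1 h2 key
  rw [sub_zero] at h3
  have hm0 : (F v - w) / deriv F v ≠ 0 := div_ne_zero (hF.sub_ne_zero hv hwK) hd0
  have hvy : v - y * Complex.I ≠ 0 := by
    intro h
    have := congrArg Complex.re h
    simp at this
    linarith
  rw [one_div, Complex.inv_re, ← inv_div (F v - w), Complex.inv_re,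
    div_le_div_iff₀ (Complex.normSq_pos.2 hvy) (Complex.normSq_pos.2 hm0)]
  have h4 : (v - y * Complex.I).re = v.re := by simp
  rw [h4]
  linarith

/-- Minimum principle in ζ with v fixed. At a finite boundary point, a violating sequence has
bounded values of F, and a limit of these is excluded by `re_boundary_limit`; at ∞ the quotient
tends to 0. -/
theorem re_quotient_nonneg (hF : IsConcaveOnHalfPlane F) {v : ℂ} (hv : v ∈ rightHalfPlane)
    {ζ : ℂ} (hζ : ζ ∈ rightHalfPlane) :
    0 ≤ (dslope (dslope F v) v ζ / dslope F v ζ).re := by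
  have hv' : 0 < v.re := hv
  have hq : ∀ u ∈ rightHalfPlane, u ≠ v → dslope (dslope F v) v u / dslope F v u =
      deriv F v / (F v - F u) - 1 / (v - u) := fun u hu hne =>
    dslope_dslope_div_eq fun h => hne (hF.injOn hu hv h.symm)
  refine re_nonneg_of_forall_boundary (g := fun ζ => dslope (dslope F v) v ζ / dslope F v ζ)
    (hF.differentiableOn_quotient hv) ?_ ?_ hζ
  · intro y η hη
    by_contra hcon
    obtain ⟨ζ, hlim, hζ⟩ := exists_seq_forall_of_frequently
      ((not_eventually.1 hcon).and_eventually eventually_mem_nhdsWithin)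
    rw [tendsto_nhdsWithin_iff] at hlim
    obtain ⟨k, hk⟩ := hF.nonempty_compl
    -- Shifting by 1 moves the points to where F is continuous and does not decrease |F - k|.
    have h1 : Tendsto (fun n => ‖F (ζ n + ((1 : ℝ) : ℂ)) - k‖) atTop
        (𝓝 ‖F (y * Complex.I + ((1 : ℝ) : ℂ)) - k‖) := by
      have hmem : y * Complex.I + ((1 : ℝ) : ℂ) ∈ rightHalfPlane := by simp [mem_rightHalfPlane]
      have := ((hF.differentiableAt hmem).continuousAt.tendsto.comp
        (hlim.1.add_const ((1 : ℝ) : ℂ))).sub_const k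
      exact this.norm
    obtain ⟨C, hC⟩ := h1.bddAbove_range
    have h2 : ∀ n, F (ζ n) ∈ Metric.closedBall k C := fun n => by
      rw [mem_closedBall_iff_norm]
      exact (hF.norm_sub_le_norm_add_sub (hζ n).2 hk zero_le_one).trans (hC ⟨n, rfl⟩)
    obtain ⟨w, -, φ, hφ, hw⟩ := (isCompact_closedBall k C).tendsto_subseq h2
    have hlimφ := hlim.1.comp hφ.tendsto_atTop
    obtain ⟨hwK, hle⟩ := hF.re_boundary_limit hv (ζ := ζ ∘ φ) (fun n => (hζ _).2) hlimφ hw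
    have h3 : Tendsto (fun n => deriv F v / (F v - F (ζ (φ n))) - 1 / (v - ζ (φ n))) atTop
        (𝓝 (deriv F v / (F v - w) - 1 / (v - y * Complex.I))) := by
      have hvy : v - y * Complex.I ≠ 0 := by
        intro h
        have := congrArg Complex.re h
        simp at this
        linarith
      exact (tendsto_const_nhds.div (hw.const_sub _) (hF.sub_ne_zero hv hwK)).sub
        (tendsto_const_nhds.div (hlimφ.const_sub _) hvy)
    have h4 := (Complex.continuous_re.tendsto _).comp h3
    have h5 : ∀ᶠ n in atTop, ζ (φ n) ≠ v := by
      apply hlimφ.eventually_ne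
      intro h
      rw [← h] at hv'
      simp at hv'
    have h6 := le_of_tendsto h4 (h5.mono fun n hn => (by
      have := (hζ (φ n)).1
      rw [hq _ (hζ (φ n)).2 hn] at this
      exact (not_le.1 this).le : _ ≤ -η))
    rw [Complex.sub_re] at h6
    linarith
  · intro η hη
    have h1 := tendsto_div_sub_sub_atInfinity hF.tendsto_cobounded (deriv F v) (F v) v
    have h2 := (Complex.continuous_re.tendsto _).comp h1
    have h3 := h2.eventually (lt_mem_nhds (show -η < (0 : ℂ).re by simpa using hη))
    have h4 : ∀ᶠ u in cobounded ℂ ⊓ 𝓟 rightHalfPlane, u ∈ rightHalfPlane :=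
      mem_inf_of_right (mem_principal_self _)
    have h5 : ∀ᶠ u in cobounded ℂ ⊓ 𝓟 rightHalfPlane, u ≠ v :=
      (eventually_ne_cobounded v).filter_mono inf_le_left
    filter_upwards [h3, h4, h5] with u hu1 hu2 hu3
    rw [hq u hu2 hu3]
    exact hu1.le

/-- Convexity of the complement in terms of the second derivative. -/
theorem re_deriv_deriv_div_nonneg (hF : IsConcaveOnHalfPlane F) {v : ℂ} (hv : v ∈ rightHalfPlane) :
    0 ≤ (deriv (deriv F) v / deriv F v).re := by
  have h := hF.re_quotient_nonneg hv hv
  rw [dslope_same, dslope_same, deriv_dslope_same isOpen_rightHalfPlane hF.differentiableOn hv] at h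
  have h2 : deriv (deriv F) v / 2 / deriv F v = ((2⁻¹ : ℝ) : ℂ) * (deriv (deriv F) v / deriv F v) := by
    push_cast
    ring
  rw [h2, Complex.re_ofReal_mul] at h
  linarith

end IsConcaveOnHalfPlane

/-! ### The argument of F' and the opening angle. -/

/-- A nonvanishing holomorphic function on the right half-plane has a holomorphic logarithm. -/
theorem exists_log_rightHalfPlane {g : ℂ → ℂ} (hg : DifferentiableOn ℂ g rightHalfPlane)
    (h0 : ∀ v ∈ rightHalfPlane, g v ≠ 0) :
    ∃ h : ℂ → ℂ, DifferentiableOn ℂ h rightHalfPlane ∧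
      ∀ v ∈ rightHalfPlane, Complex.exp (h v) = g v := by
  have hsc : IsSimplyConnected rightHalfPlane := by
    have h1 : (1 : ℂ) ∈ rightHalfPlane := by simp [mem_rightHalfPlane]
    have := convex_rightHalfPlane.contractibleSpace ⟨1, h1⟩
    exact SimplyConnectedSpace.ofContractible _
  obtain ⟨h, hc, he⟩ := Complex.exists_continuousOn_eqOn_exp_comp hsc isOpen_rightHalfPlane
    hg.continuousOn (by rintro ⟨v, hv, hv2⟩; exact h0 v hv hv2)
  refine ⟨h, fun v hv => ?_, he⟩
  have hn := isOpen_rightHalfPlane.mem_nhds hv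
  have hgv := h0 v hv
  -- Near v the continuous logarithm agrees with this holomorphic branch, since Im (h u - h v) stays
  -- in (-π, π).
  have h1 : DifferentiableAt ℂ (fun u => h v + Complex.log (g u / g v)) v := by
    have := (((hg.differentiableAt hn).div_const (g v)).clog (by simp [hgv])).const_add (h v)
    exact this
  refine DifferentiableAt.differentiableWithinAt (h1.congr_of_eventuallyEq ?_)
  have h2 : Tendsto (fun u => (h u - h v).im) (𝓝 v) (𝓝 0) := by
    have := (Complex.continuous_im.tendsto _).comp ((hc.continuousAt hn).tendsto.sub_const (h v))
    simpa using! this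
  filter_upwards [hn, h2 (Ioo_mem_nhds (neg_lt_zero.2 Real.pi_pos) Real.pi_pos)] with u hu hu2
  have h3 : g u / g v = Complex.exp (h u - h v) := by
    rw [Complex.exp_sub, ← he hu, ← he hv]; rfl
  rw [h3, Complex.log_exp hu2.1 hu2.2.le]
  ring

/-- Limits of directions of a closed convex set are directions of recession. -/
theorem add_mul_mem_of_tendsto {K : Set ℂ} (hK : Convex ℝ K) (hc : IsClosed K) {x : ℕ → ℂ}
    (hx : ∀ n, x n ∈ K) {r : ℕ → ℝ} (hr : Tendsto r atTop atTop) {e : ℂ}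
    (he : Tendsto (fun n => x n / r n) atTop (𝓝 e)) {k : ℂ} (hk : k ∈ K) {t : ℝ} (ht : 0 ≤ t) :
    k + t * e ∈ K := by
  have hinv : Tendsto (fun n => (r n)⁻¹) atTop (𝓝 0) := tendsto_inv_atTop_zero.comp hr
  have hinvC : Tendsto (fun n => (((r n)⁻¹ : ℝ) : ℂ)) atTop (𝓝 0) := by
    simpa [Function.comp_def] using (Complex.continuous_ofReal.tendsto 0).comp hinv
  -- These are the points of the segments from k to x n at the fraction t / r n.
  have h1 : Tendsto (fun n => (1 - t * (((r n)⁻¹ : ℝ) : ℂ)) * k + t * (x n / r n)) atTop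
      (𝓝 ((1 - t * 0) * k + t * e)) :=
    (((hinvC.const_mul _).const_sub 1).mul_const k).add (he.const_mul _)
  simp only [mul_zero, sub_zero, one_mul] at h1
  refine hc.mem_of_tendsto h1 ?_
  filter_upwards [hr.eventually_ge_atTop t, hr.eventually_gt_atTop 0] with n hn hn0
  have h2 := hK hk (hx n) (a := 1 - t * (r n)⁻¹) (b := t * (r n)⁻¹)
    (by rw [sub_nonneg, ← div_eq_mul_inv]; exact div_le_one_of_le₀ hn hn0.le) (by positivity)
    (by ring)
  convert h2 using 1
  simp only [Complex.real_smul]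
  push_cast
  rw [div_eq_mul_inv]
  ring

/-- A limit of the unit vectors x/|x|, for points x of K going to infinity, is a direction of
recession. -/
theorem exists_recession_direction {K : Set ℂ} (hK : Convex ℝ K) (hc : IsClosed K)
    (hb : ¬ IsBounded K) :
    ∃ θ ∈ Ioc (-Real.pi) Real.pi, ∀ k ∈ K, ∀ t : ℝ, 0 ≤ t →
      k + t * Complex.exp (θ * Complex.I) ∈ K := by
  have h1 : ∀ n : ℕ, ∃ x ∈ K, (n : ℝ) + 1 < ‖x‖ := by
    intro n
    by_contra! h
    exact hb (isBounded_iff_forall_norm_le.2 ⟨_, h⟩)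
  choose x hxK hx using h1
  have hx0 : ∀ n, 0 < ‖x n‖ := fun n => lt_trans (by positivity) (hx n)
  have hxt : Tendsto (fun n => ‖x n‖) atTop atTop := by
    refine tendsto_atTop_mono (fun n => ?_) tendsto_natCast_atTop_atTop
    linarith [hx n]
  have hs : ∀ n, x n / ‖x n‖ ∈ Metric.sphere (0 : ℂ) 1 := fun n => by
    rw [mem_sphere_zero_iff_norm, norm_div, Complex.norm_real, norm_norm, div_self (hx0 n).ne']
  obtain ⟨e, he, φ, hφ, hlim⟩ := (isCompact_sphere (0 : ℂ) 1).tendsto_subseq hs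
  have he1 : ‖e‖ = 1 := by simpa using he
  refine ⟨e.arg, Complex.arg_mem_Ioc e, fun k hk t ht => ?_⟩
  have h2 : Complex.exp (e.arg * Complex.I) = e := by
    have := Complex.norm_mul_exp_arg_mul_I e
    rwa [he1, Complex.ofReal_one, one_mul] at this
  rw [h2]
  exact add_mul_mem_of_tendsto hK hc (fun n => hxK (φ n)) (hxt.comp hφ.tendsto_atTop) hlim hk ht

/-- The translates of (-π, π] by multiples of 2π tile the line, so folding [p, q] into one period
does not increase its length. -/
theorem volume_angles_le (p q : ℝ) :
    volume {θ : ℝ | θ ∈ Ioc (-Real.pi) Real.pi ∧ ∃ m : ℤ, θ + 2 * Real.pi * m ∈ Icc p q} ≤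
      ENNReal.ofReal (q - p) := by
  set T : ℝ := 2 * Real.pi with hT
  have hsub : {θ : ℝ | θ ∈ Ioc (-Real.pi) Real.pi ∧ ∃ m : ℤ, θ + T * m ∈ Icc p q} ⊆
      ⋃ m : ℤ, (fun θ => θ + T * m) ⁻¹'
        (Ioc (-Real.pi + m • T) (-Real.pi + (m + 1) • T) ∩ Icc p q) := by
    rintro θ ⟨h1, m, h2⟩
    refine mem_iUnion.2 ⟨m, ?_, h2⟩
    simp only [zsmul_eq_mul]
    push_cast
    constructor
    · linarith [h1.1]
    · rw [hT]; linarith [h1.2]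
  calc _ ≤ volume (⋃ m : ℤ, (fun θ => θ + T * m) ⁻¹'
        (Ioc (-Real.pi + m • T) (-Real.pi + (m + 1) • T) ∩ Icc p q)) := measure_mono hsub
    _ ≤ ∑' m : ℤ, volume ((fun θ => θ + T * m) ⁻¹'
        (Ioc (-Real.pi + m • T) (-Real.pi + (m + 1) • T) ∩ Icc p q)) := measure_iUnion_le _
    _ = ∑' m : ℤ, volume (Ioc (-Real.pi + m • T) (-Real.pi + (m + 1) • T) ∩ Icc p q) := by
        congr 1; funext m; exact measure_preimage_add_right _ _ _
    _ = volume (⋃ m : ℤ, (Ioc (-Real.pi + m • T) (-Real.pi + (m + 1) • T) ∩ Icc p q)) := by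
        rw [measure_iUnion]
        · intro i j hij
          exact (pairwise_disjoint_Ioc_add_zsmul (-Real.pi) T hij).mono inter_subset_left
            inter_subset_left
        · exact fun m => measurableSet_Ioc.inter measurableSet_Icc
    _ ≤ volume (Icc p q) := measure_mono (iUnion_subset fun m => inter_subset_right)
    _ = ENNReal.ofReal (q - p) := Real.volume_Icc

/-- Modulo 2π, the interval [p, q] - θ must fit into the single arc [π/2, 3π/2] where cos is
nonpositive. -/
theorem exists_add_mem_Icc_of_cos_nonpos {p q θ : ℝ} (hpq : p ≤ q)
    (h : ∀ x ∈ Icc p q, Real.cos (x - θ) ≤ 0) :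
    ∃ m : ℤ, θ + 2 * Real.pi * m ∈ Icc (q - 3 * Real.pi / 2) (p - Real.pi / 2) := by
  have hpi := Real.pi_pos
  obtain ⟨m, hm, -⟩ := existsUnique_add_zsmul_mem_Ioc Real.two_pi_pos (p - θ) (-(Real.pi / 2))
  rw [zsmul_eq_mul] at hm
  have hcos : ∀ x : ℝ, Real.cos (x - θ + m * (2 * Real.pi)) = Real.cos (x - θ) :=
    fun x => Real.cos_add_int_mul_two_pi _ _
  have h1 : Real.pi / 2 ≤ p - θ + m * (2 * Real.pi) := by
    by_contra! hlt
    have := Real.cos_pos_of_mem_Ioo ⟨hm.1, hlt⟩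
    rw [hcos] at this
    linarith [h p ⟨le_rfl, hpq⟩]
  have h2 : q - θ + m * (2 * Real.pi) ≤ 3 * Real.pi / 2 := by
    by_contra! hlt
    -- A point of the shifted interval lying in (3π/2, 2π], where cos is positive; the minimum keeps
    -- it below the end of that arc.
    set y := min (q - θ + m * (2 * Real.pi)) (2 * Real.pi) with hy
    have hy1 : 3 * Real.pi / 2 < y := lt_min hlt (by linarith)
    have hy2 : y ≤ 2 * Real.pi := min_le_right _ _
    have hy3 : y ≤ q - θ + m * (2 * Real.pi) := min_le_left _ _
    have h3 := Real.cos_pos_of_mem_Ioo (x := y - 2 * Real.pi) ⟨by linarith, by linarith⟩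
    rw [Real.cos_sub_two_pi] at h3
    have h4 := hcos (y + θ - m * (2 * Real.pi))
    have h5 : y + θ - m * (2 * Real.pi) - θ + m * (2 * Real.pi) = y := by ring
    rw [h5] at h4
    have h6 := h (y + θ - m * (2 * Real.pi)) ⟨by linarith [hm.2], by linarith⟩
    linarith
  refine ⟨-m, ?_⟩
  push_cast
  constructor <;> linarith

namespace IsConcaveOnHalfPlane

variable {F : ℂ → ℂ}

/-- Re F'/(F - k) ≥ 0 also holds with k + t e in place of k; for large t the term linear in t
decides the sign. -/
theorem re_deriv_mul_conj_nonpos (hF : IsConcaveOnHalfPlane F) {e : ℂ}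
    (he : ∀ k ∈ (F '' rightHalfPlane)ᶜ, ∀ t : ℝ, 0 ≤ t → k + t * e ∈ (F '' rightHalfPlane)ᶜ)
    {v : ℂ} (hv : v ∈ rightHalfPlane) : (deriv F v * (starRingEnd ℂ) e).re ≤ 0 := by
  obtain ⟨k, hk⟩ := hF.nonempty_compl
  have h1 : ∀ t : ℝ, 0 ≤ t → t * (deriv F v * (starRingEnd ℂ) e).re ≤
      (deriv F v * (starRingEnd ℂ) (F v - k)).re := by
    intro t ht
    have h2 := hF.re_logDeriv_nonneg hv (he k hk t ht)
    have h3 := Complex.normSq_pos.2 (hF.sub_ne_zero hv (he k hk t ht))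
    rw [Complex.div_re, ← add_div] at h2
    replace h2 := mul_nonneg h2 h3.le
    rw [div_mul_cancel₀ _ h3.ne'] at h2
    simp only [Complex.sub_re, Complex.sub_im, Complex.add_re, Complex.add_im, Complex.mul_re,
      Complex.mul_im, Complex.ofReal_re, Complex.ofReal_im, Complex.conj_re, Complex.conj_im] at h2 ⊢
    linarith
  by_contra! h
  have h2 := h1 ((|(deriv F v * (starRingEnd ℂ) (F v - k)).re| + 1) /
    (deriv F v * (starRingEnd ℂ) e).re) (by positivity)
  rw [div_mul_cancel₀ _ h.ne'] at h2
  linarith [le_abs_self (deriv F v * (starRingEnd ℂ) (F v - k)).re]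

/-- The argument of the derivative oscillates by at most `π (α - 1)`. -/
theorem im_sub_im_le (hF : IsConcaveOnHalfPlane F) {α : ℝ} (hα : 1 < α)
    (hop : openingAngleAtInfinity (F '' rightHalfPlane) ≤ Real.pi * α) {h : ℂ → ℂ}
    (hd : DifferentiableOn ℂ h rightHalfPlane)
    (he : ∀ v ∈ rightHalfPlane, Complex.exp (h v) = deriv F v) {u v : ℂ}
    (hu : u ∈ rightHalfPlane) (hv : v ∈ rightHalfPlane) :
    (h u).im - (h v).im ≤ Real.pi * (α - 1) := by
  have hpi := Real.pi_pos
  set p := (h v).im with hp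
  set q := (h u).im with hq
  rcases le_total q p with hqp | hpq
  · have : 0 < Real.pi * (α - 1) := mul_pos hpi (by linarith)
    linarith
  -- By connectedness arg F' takes every value in [p, q], so a direction of recession θ is confined
  -- modulo 2π to an interval of length π - (q - p).
  have hcos : ∀ θ : ℝ, (∀ k ∈ (F '' rightHalfPlane)ᶜ, ∀ t : ℝ, 0 ≤ t →
      k + t * Complex.exp (θ * Complex.I) ∈ (F '' rightHalfPlane)ᶜ) →
      ∃ m : ℤ, θ + 2 * Real.pi * m ∈ Icc (q - 3 * Real.pi / 2) (p - Real.pi / 2) := by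
    intro θ hθ
    refine exists_add_mem_Icc_of_cos_nonpos hpq fun x hx => ?_
    have hpre : IsPreconnected ((fun w => (h w).im) '' rightHalfPlane) :=
      isPreconnected_rightHalfPlane.image _ (Complex.continuous_im.comp_continuousOn hd.continuousOn)
    obtain ⟨w, hw, hwx⟩ := hpre.Icc_subset ⟨v, hv, rfl⟩ ⟨u, hu, rfl⟩ hx
    have h1 := hF.re_deriv_mul_conj_nonpos hθ hw
    rw [← he w hw, ← Complex.exp_conj, ← Complex.exp_add, Complex.exp_re] at h1
    have h2 : (h w + (starRingEnd ℂ) (θ * Complex.I)).im = x - θ := by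
      simp only at hwx
      simp [hwx]
      ring
    rw [h2] at h1
    exact nonpos_of_mul_nonpos_right h1 (Real.exp_pos _)
  obtain ⟨θ₀, hθ₀, hrec⟩ := exists_recession_direction hF.convex_compl hF.isClosed_compl
    hF.not_isBounded_compl
  obtain ⟨m₀, hm₀⟩ := hcos θ₀ hrec
  -- One direction of recession exists, so that interval is nonempty and `ENNReal.ofReal` does not
  -- truncate its length.
  have hqpi : q - p ≤ Real.pi := by linarith [hm₀.1.trans hm₀.2]
  set Θ : Set ℝ := {θ : ℝ | θ ∈ Ioc (-Real.pi) Real.pi ∧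
    ∀ᶠ r : ℝ in atTop, (r : ℂ) * Complex.exp ((θ : ℂ) * Complex.I) ∈ F '' rightHalfPlane} with hΘ
  set S : Set ℝ := {θ : ℝ | θ ∈ Ioc (-Real.pi) Real.pi ∧ ∃ m : ℤ,
    θ + 2 * Real.pi * m ∈ Icc (q - 3 * Real.pi / 2) (p - Real.pi / 2)} with hS
  -- A direction whose ray is not eventually in the image is a direction of recession. Measuring the
  -- cover gives 2π ≤ πα + π - (q - p).
  have hcover : Ioc (-Real.pi) Real.pi ⊆ Θ ∪ S := by
    intro θ hθ
    by_cases h1 : ∀ᶠ r : ℝ in atTop, (r : ℂ) * Complex.exp ((θ : ℂ) * Complex.I) ∈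
        F '' rightHalfPlane
    · exact Or.inl ⟨hθ, h1⟩
    · right
      refine ⟨hθ, hcos θ fun k hk t ht => ?_⟩
      obtain ⟨r, hr, hrK⟩ := exists_seq_forall_of_frequently
        ((not_eventually.1 h1).and_eventually (eventually_gt_atTop 0))
      refine add_mul_mem_of_tendsto hF.convex_compl hF.isClosed_compl (fun n => (hrK n).1) hr ?_
        hk ht
      refine tendsto_const_nhds.congr fun n => ?_
      have : (r n : ℂ) ≠ 0 := by exact_mod_cast (hrK n).2.ne'
      field_simp
  have hΘfin : volume Θ ≠ ⊤ :=
    ((measure_mono fun θ hθ => hθ.1).trans_lt (measure_Ioc_lt_top (a := -Real.pi)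
      (b := Real.pi))).ne
  have hΘle : volume Θ ≤ ENNReal.ofReal (Real.pi * α) := by
    rw [← ENNReal.ofReal_toReal hΘfin]
    exact ENNReal.ofReal_le_ofReal hop
  have hSle := volume_angles_le (q - 3 * Real.pi / 2) (p - Real.pi / 2)
  have h1 : ENNReal.ofReal (Real.pi - -Real.pi) ≤ ENNReal.ofReal (Real.pi * α) +
      ENNReal.ofReal (p - Real.pi / 2 - (q - 3 * Real.pi / 2)) := by
    rw [← Real.volume_Ioc]
    exact (measure_mono hcover).trans ((measure_union_le _ _).trans (add_le_add hΘle hSle))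
  rw [← ENNReal.ofReal_add (by positivity) (by linarith), ENNReal.ofReal_le_ofReal_iff] at h1
  · linarith
  · have : 0 < Real.pi * α := by positivity
    linarith

end IsConcaveOnHalfPlane

/-! ### Comparison with rotations of the half-plane. -/

/-- The derivative of Im h in the direction of i is Re h'. -/
theorem im_le_im_add_mul_I {h : ℂ → ℂ} (hd : DifferentiableOn ℂ h rightHalfPlane)
    (hre : ∀ v ∈ rightHalfPlane, 0 ≤ (deriv h v).re) {v : ℂ} (hv : v ∈ rightHalfPlane) {s : ℝ}
    (hs : 0 ≤ s) : (h v).im ≤ (h (v + s * Complex.I)).im := by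
  have hmem : ∀ t : ℝ, v + t * Complex.I ∈ rightHalfPlane := by
    intro t
    have : 0 < v.re := hv
    rw [mem_rightHalfPlane]; simpa
  have hder : ∀ t : ℝ, HasDerivAt (fun t : ℝ => (h (v + t * Complex.I)).im)
      (deriv h (v + t * Complex.I)).re t := by
    intro t
    have h1 := (hd.differentiableAt (isOpen_rightHalfPlane.mem_nhds (hmem t))).hasDerivAt
    have h2 : HasDerivAt (fun t : ℂ => v + t * Complex.I) Complex.I (t : ℂ) := by
      simpa using ((hasDerivAt_id (t : ℂ)).mul_const Complex.I).const_add v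
    refine (hasDerivAt_im (h1.comp (t : ℂ) h2).comp_ofReal).congr_deriv ?_
    simp
  have hmono : Monotone (fun t : ℝ => (h (v + t * Complex.I)).im) :=
    monotone_of_deriv_nonneg (fun t => (hder t).differentiableAt)
      fun t => by rw [(hder t).deriv]; exact hre _ (hmem t)
  simpa using hmono hs

theorem one_add_I_mul_ne_zero (κ : ℝ) {v : ℂ} (hv : v ∈ rightHalfPlane) :
    1 + Complex.I * κ * v ≠ 0 := by
  intro h
  have h1 := congrArg Complex.re h
  have h2 := congrArg Complex.im h
  have h3 : 0 < v.re := hv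
  simp at h1 h2
  rcases h2 with h2 | h2
  · rw [h2] at h1; simp at h1
  · linarith

/-- These maps are automorphisms of the half-plane fixing 1; under the Cayley transform they are
rotations of the disk. -/
theorem rotation_mem (κ : ℝ) {v : ℂ} (hv : v ∈ rightHalfPlane) :
    (v + Complex.I * κ) / (1 + Complex.I * κ * v) ∈ rightHalfPlane := by
  have h3 : 0 < v.re := hv
  rw [mem_rightHalfPlane, Complex.div_re, ← add_div]
  refine div_pos ?_ (Complex.normSq_pos.2 (one_add_I_mul_ne_zero κ hv))
  simp
  nlinarith [mul_nonneg (sq_nonneg κ) h3.le]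

/-- Comparison of a function of bounded argument, increasing along vertical lines, with its
rotation by a small elliptic automorphism of the half-plane. -/
theorem im_rotation_nonneg {h : ℂ → ℂ} (hd : DifferentiableOn ℂ h rightHalfPlane)
    (hre : ∀ v ∈ rightHalfPlane, 0 ≤ (deriv h v).re) {L : ℝ} (hL : 0 ≤ L)
    (hosc : ∀ u ∈ rightHalfPlane, ∀ v ∈ rightHalfPlane, (h u).im - (h v).im ≤ L)
    {ε κ : ℝ} (hε : 0 < ε) (hκ : 0 < κ) {v : ℂ} (hv : v ∈ rightHalfPlane) :
    0 ≤ (h ((v + Complex.I * κ) / (1 + Complex.I * κ * v) + ε) - h (v + ε) +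
      (L / Real.pi : ℝ) * (Complex.log (κ * v - Complex.I) + Real.pi / 2 * Complex.I)).im := by
  have hpi := Real.pi_pos
  have hadd : ∀ u : ℂ, 0 ≤ u.re → u + ε ∈ rightHalfPlane := by
    intro u hu
    rw [mem_rightHalfPlane, Complex.add_re, Complex.ofReal_re]; linarith
  have hLpi : 0 ≤ L / Real.pi := div_nonneg hL hpi.le
  -- On the imaginary axis the rotation moves iy up if κy < 1, so that Im h grows; if κy > 1 it
  -- moves iy down, and Im h drops by at most L. The bracket with the logarithm has imaginary part 0
  -- in the first case and π in the second, which compensates this drop. The shift by ε makes h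
  -- continuous up to the axis.
  set B : ℂ → ℂ := fun v => h ((v + Complex.I * κ) / (1 + Complex.I * κ * v) + ε) - h (v + ε) +
      (L / Real.pi : ℝ) * (Complex.log (κ * v - Complex.I) + Real.pi / 2 * Complex.I) with hB
  -- `q` vanishes at the boundary point i/κ and at ∞, where only Im B ≥ -L is available. As in
  -- Phragmén–Lindelöf, |exp (iB)|^n |q| ≤ κ + 1 for all n forces |exp (iB)| ≤ 1.
  set q : ℂ → ℂ := fun v => (κ * v - Complex.I) / (1 + v) ^ 2 with hq
  have him : ∀ u : ℂ, (B u).im = (h ((u + Complex.I * κ) / (1 + Complex.I * κ * u) + ε)).im -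
      (h (u + ε)).im + L / Real.pi * (Complex.arg (κ * u - Complex.I) + Real.pi / 2) := by
    intro u
    simp only [hB, Complex.add_im, Complex.sub_im, Complex.im_ofReal_mul,
      Complex.log_im]
    congr 3
    have : (Real.pi : ℂ) / 2 = ((Real.pi / 2 : ℝ) : ℂ) := by push_cast; ring
    rw [this, Complex.im_ofReal_mul, Complex.I_im, mul_one]
  have hRe : ∀ u ∈ rightHalfPlane, 0 < (κ * u - Complex.I).re := by
    intro u hu
    have h3 : 0 < u.re := hu
    simpa using mul_pos hκ h3
  have hlow : ∀ u ∈ rightHalfPlane, -L ≤ (B u).im := by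
    intro u hu
    have h3 : 0 < u.re := hu
    rw [him]
    have h1 := hosc _ (hadd u h3.le) _ (hadd _ (le_of_lt (rotation_mem κ hu)))
    have h2 := (Complex.abs_arg_lt_pi_div_two_iff.2 (Or.inl (hRe u hu)))
    have h4 := (abs_lt.1 h2).1
    have := mul_nonneg hLpi (show 0 ≤ Complex.arg (κ * u - Complex.I) + Real.pi / 2 by linarith)
    linarith
  have hg : ∀ u : ℂ, ‖Complex.exp (Complex.I * B u)‖ = Real.exp (-(B u).im) := by
    intro u
    rw [Complex.norm_exp]; simp
  have h1v : ∀ u ∈ rightHalfPlane, 1 ≤ ‖1 + u‖ := by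
    intro u hu
    have h3 : 0 < u.re := hu
    refine le_trans ?_ (Complex.re_le_norm _)
    simp; linarith
  have hvv : ∀ u ∈ rightHalfPlane, ‖u‖ ≤ ‖1 + u‖ := by
    intro u hu
    have h3 : 0 < u.re := hu
    rw [← sq_le_sq₀ (norm_nonneg _) (norm_nonneg _), ← Complex.normSq_eq_norm_sq,
      ← Complex.normSq_eq_norm_sq, Complex.normSq_apply, Complex.normSq_apply]
    simp
    nlinarith
  have hqle : ∀ u ∈ rightHalfPlane, ‖q u‖ ≤ (κ + 1) / ‖1 + u‖ := by
    intro u hu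
    have h2 := h1v u hu
    have h3 : ‖(κ : ℂ) * u - Complex.I‖ ≤ (κ + 1) * ‖1 + u‖ := by
      calc ‖(κ : ℂ) * u - Complex.I‖ ≤ ‖(κ : ℂ) * u‖ + ‖Complex.I‖ := norm_sub_le _ _
        _ = κ * ‖u‖ + 1 := by
          rw [norm_mul, Complex.norm_real, Complex.norm_I, Real.norm_of_nonneg hκ.le]
        _ ≤ _ := by nlinarith [hvv u hu]
    rw [hq]
    simp only
    rw [norm_div, norm_pow, div_le_div_iff₀ (by positivity) (by positivity)]
    nlinarith
  have hqM : ∀ u ∈ rightHalfPlane, ‖q u‖ ≤ κ + 1 := fun u hu =>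
    (hqle u hu).trans (div_le_self (by positivity) (h1v u hu))
  have h1ne : ∀ u ∈ rightHalfPlane, 1 + u ≠ 0 := fun u hu => by
    have := h1v u hu
    exact norm_pos_iff.1 (by linarith)
  have hRd : DifferentiableOn ℂ (fun u : ℂ => (u + Complex.I * κ) / (1 + Complex.I * κ * u) + ε)
      rightHalfPlane := by
    refine DifferentiableOn.add_const _ (DifferentiableOn.div (by fun_prop) (by fun_prop) ?_)
    exact fun u hu => one_add_I_mul_ne_zero κ hu
  have hBd : DifferentiableOn ℂ B rightHalfPlane := by
    refine ((hd.comp hRd fun u hu => hadd _ (le_of_lt (rotation_mem κ hu))).sub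
      (hd.comp (by fun_prop) fun u hu => hadd _ (le_of_lt hu))).add ?_
    refine ((DifferentiableOn.clog (by fun_prop) fun u hu => ?_).add_const _).const_mul _
    exact Or.inl (hRe u hu)
  have hqd : DifferentiableOn ℂ q rightHalfPlane := by
    refine DifferentiableOn.div (by fun_prop) (by fun_prop) fun u hu => ?_
    exact pow_ne_zero _ (h1ne u hu)
  have key : ∀ n : ℕ, ∀ u ∈ rightHalfPlane, ‖Complex.exp (Complex.I * B u) ^ n * q u‖ ≤ κ + 1 := by
    intro n u hu
    have hcrude : ∀ w ∈ rightHalfPlane, ‖Complex.exp (Complex.I * B w) ^ n * q w‖ ≤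
        Real.exp L ^ n * ‖q w‖ := by
      intro w hw
      rw [norm_mul, norm_pow, hg]
      gcongr
      linarith [hlow w hw]
    refine norm_le_of_forall_boundary (g := fun u => Complex.exp (Complex.I * B u) ^ n * q u)
      (((hBd.const_mul _).cexp.pow n).mul hqd) ?_ ?_ hu
    · intro y η hη
      have hy : (y * Complex.I : ℂ) + 1 ≠ 0 := by
        intro h
        have := congrArg Complex.re h
        simp at this
      have hqc : ContinuousAt q (y * Complex.I) := by
        refine ContinuousAt.div (by fun_prop) (by fun_prop) ?_
        rw [add_comm]
        exact pow_ne_zero _ hy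
      by_cases hκy : κ * y = 1
      · have h1 : Tendsto (fun w => Real.exp L ^ n * ‖q w‖) (𝓝[rightHalfPlane] (y * Complex.I))
            (𝓝 0) := by
          have h2 := (hqc.norm.tendsto.const_mul (Real.exp L ^ n)).mono_left
            (nhdsWithin_le_nhds (s := rightHalfPlane))
          have h3 : q (y * Complex.I) = 0 := by
            have : (κ : ℂ) * (y * Complex.I) - Complex.I = ((κ * y - 1 : ℝ) : ℂ) * Complex.I := by
              push_cast; ring
            simp [hq, this, hκy]
          rwa [h3, norm_zero, mul_zero] at h2
        filter_upwards [h1.eventually (gt_mem_nhds (show (0 : ℝ) < κ + 1 + η by linarith)),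
          self_mem_nhdsWithin] with w hw hwH
        exact (hcrude w hwH).trans hw.le
      · have hden : (1 + Complex.I * κ * (y * Complex.I) : ℂ) = ((1 - κ * y : ℝ) : ℂ) := by
          push_cast
          linear_combination (κ * y : ℂ) * Complex.I_sq
        have hden0 : (1 - κ * y : ℝ) ≠ 0 := fun h => hκy (by linarith)
        have hdenC : (1 + Complex.I * κ * (y * Complex.I) : ℂ) ≠ 0 := by
          rw [hden]; exact_mod_cast hden0
        have hnum : (y * Complex.I + Complex.I * κ : ℂ) / (1 + Complex.I * κ * (y * Complex.I)) =
            (((y + κ) / (1 - κ * y) : ℝ) : ℂ) * Complex.I := by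
          rw [hden]; push_cast; ring
        have hκI : (κ : ℂ) * (y * Complex.I) - Complex.I = ((κ * y - 1 : ℝ) : ℂ) * Complex.I := by
          push_cast; ring
        have hIm : ∀ t : ℝ, ((t : ℂ) * Complex.I).re = 0 := fun t => by simp
        have hBc : ContinuousAt B (y * Complex.I) := by
          have hc : ∀ w ∈ rightHalfPlane, ContinuousAt h w := fun w hw =>
            (hd.differentiableAt (isOpen_rightHalfPlane.mem_nhds hw)).continuousAt
          have c1 : ContinuousAt (fun u : ℂ => (u + Complex.I * κ) / (1 + Complex.I * κ * u) + ε)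
              (y * Complex.I) := by
            refine ContinuousAt.add (ContinuousAt.div (by fun_prop) (by fun_prop) hdenC) (by fun_prop)
          have c2 : ContinuousAt (fun u : ℂ => u + (ε : ℂ)) (y * Complex.I) := by fun_prop
          have c3 : ContinuousAt (fun u : ℂ => Complex.log (κ * u - Complex.I))
              (y * Complex.I) := by
            refine ContinuousAt.clog (by fun_prop) ?_
            rw [hκI]
            right
            simpa using fun h : κ * y - 1 = 0 => hκy (by linarith)
          refine ContinuousAt.add (ContinuousAt.sub ?_ ?_) ?_
          · refine ContinuousAt.comp' (f := fun u : ℂ => (u + Complex.I * κ) /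
              (1 + Complex.I * κ * u) + ε) (g := h) ?_ c1
            refine hc _ (hadd _ ?_)
            rw [hnum, hIm]
          · refine ContinuousAt.comp' (f := fun u : ℂ => u + (ε : ℂ)) (g := h) ?_ c2
            exact hc _ (hadd _ (by rw [hIm]))
          · exact continuousAt_const.mul (c3.add continuousAt_const)
        have hBpos : 0 ≤ (B (y * Complex.I)).im := by
          rw [him, hnum, hκI]
          rcases lt_or_gt_of_ne hκy with hlt | hgt
          · have harg : Complex.arg (((κ * y - 1 : ℝ) : ℂ) * Complex.I) = -(Real.pi / 2) := by
              have : ((κ * y - 1 : ℝ) : ℂ) * Complex.I =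
                  ((1 - κ * y : ℝ) : ℂ) * -Complex.I := by push_cast; ring
              rw [this, Complex.arg_real_mul _ (by linarith), Complex.arg_neg_I]
            have hs : 0 ≤ (y + κ) / (1 - κ * y) - y := by
              have : (y + κ) / (1 - κ * y) - y = κ * (1 + y ^ 2) / (1 - κ * y) := by
                rw [eq_div_iff hden0, sub_mul, div_mul_cancel₀ _ hden0]
                ring
              rw [this]
              exact div_nonneg (by positivity) (by linarith)
            have := im_le_im_add_mul_I hd hre (hadd (y * Complex.I) (by rw [hIm])) hs
            have h5 : (y * Complex.I : ℂ) + ε + ((y + κ) / (1 - κ * y) - y : ℝ) * Complex.I =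
                (((y + κ) / (1 - κ * y) : ℝ) : ℂ) * Complex.I + ε := by push_cast; ring
            rw [h5] at this
            rw [harg]
            linarith
          · have harg : Complex.arg (((κ * y - 1 : ℝ) : ℂ) * Complex.I) = Real.pi / 2 := by
              rw [Complex.arg_real_mul _ (by linarith), Complex.arg_I]
            have h5 := hosc _ (hadd (y * Complex.I) (by rw [hIm])) _
              (hadd ((((y + κ) / (1 - κ * y) : ℝ) : ℂ) * Complex.I) (by rw [hIm]))
            rw [harg, add_halves, div_mul_cancel₀ _ hpi.ne']
            linarith
        have hqy : ‖q (y * Complex.I)‖ ≤ κ + 1 := by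
          have h6 : Tendsto (fun w => ‖q w‖) (𝓝[rightHalfPlane] (y * Complex.I))
              (𝓝 ‖q (y * Complex.I)‖) := hqc.norm.tendsto.mono_left nhdsWithin_le_nhds
          have : (𝓝[rightHalfPlane] (y * Complex.I : ℂ)).NeBot := by
            rw [← mem_closure_iff_nhdsWithin_neBot]
            refine mem_closure_of_tendsto (f := fun t : ℝ => y * Complex.I + (t : ℂ))
              (b := 𝓝[>] (0 : ℝ)) ?_ ?_
            · have : Continuous fun t : ℝ => (y * Complex.I + (t : ℂ)) := by fun_prop
              have := this.tendsto 0
              rw [Complex.ofReal_zero, add_zero] at this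
              exact this.mono_left nhdsWithin_le_nhds
            · filter_upwards [self_mem_nhdsWithin] with t ht
              have ht' : (0 : ℝ) < t := ht
              rw [mem_rightHalfPlane]; simpa
          exact le_of_tendsto h6 (eventually_mem_nhdsWithin.mono fun w hw => hqM w hw)
        have hlim : Tendsto (fun w => ‖Complex.exp (Complex.I * B w) ^ n * q w‖)
            (𝓝[rightHalfPlane] (y * Complex.I))
            (𝓝 ‖Complex.exp (Complex.I * B (y * Complex.I)) ^ n * q (y * Complex.I)‖) := by
          have : ContinuousAt (fun w => Complex.exp (Complex.I * B w) ^ n * q w)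
              (y * Complex.I) :=
            (((continuousAt_const.mul hBc).cexp).pow n).mul hqc
          exact this.norm.tendsto.mono_left nhdsWithin_le_nhds
        have hle : ‖Complex.exp (Complex.I * B (y * Complex.I)) ^ n * q (y * Complex.I)‖ ≤ κ + 1 := by
          rw [norm_mul, norm_pow, hg]
          have : Real.exp (-(B (y * Complex.I)).im) ^ n ≤ 1 :=
            pow_le_one₀ (Real.exp_nonneg _) (Real.exp_le_one_iff.2 (by linarith))
          calc _ ≤ 1 * ‖q (y * Complex.I)‖ := by gcongr
            _ ≤ κ + 1 := by rw [one_mul]; exact hqy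
        exact (hlim.eventually (gt_mem_nhds (by linarith : _ < κ + 1 + η))).mono fun w hw => hw.le
    · intro η hη
      have h1 : Tendsto (fun w : ℂ => Real.exp L ^ n * ((κ + 1) / ‖1 + w‖)) (cobounded ℂ) (𝓝 0) := by
        have h2 := (tendsto_norm_cobounded_atTop (E := ℂ)).comp (tendsto_const_add_cobounded (1 : ℂ))
        have h3 := (tendsto_const_nhds (x := κ + 1) (f := cobounded ℂ)).div_atTop h2
        have h4 := h3.const_mul (Real.exp L ^ n)
        rwa [mul_zero] at h4
      rw [eventually_inf_principal]
      filter_upwards [h1.eventually (gt_mem_nhds (show (0 : ℝ) < κ + 1 + η by linarith))]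
        with w hw hwH
      refine (hcrude w hwH).trans (le_trans ?_ hw.le)
      exact mul_le_mul_of_nonneg_left (hqle w hwH) (by positivity)
  by_contra! hneg
  have h1 : 1 < Real.exp (-(B v).im) := Real.one_lt_exp_iff.2 (by linarith)
  have hq0 : 0 < ‖q v‖ := by
    refine norm_pos_iff.2 (div_ne_zero ?_ (pow_ne_zero _ (h1ne v hv)))
    intro h
    have := hRe v hv
    rw [h] at this
    simp at this
  obtain ⟨n, hn⟩ := pow_unbounded_of_one_lt ((κ + 1) / ‖q v‖) h1
  have h2 := key n v hv
  rw [norm_mul, norm_pow, hg, ← le_div_iff₀ hq0] at h2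
  linarith

/-- If `Re h' ≥ 0` and the oscillation of `Im h` is at most `L` on the right half-plane, then
`Re ((L / π) v + (1 - v²) h' v) ≥ 0`. -/
theorem re_add_one_sub_sq_mul_deriv_nonneg {h : ℂ → ℂ} (hd : DifferentiableOn ℂ h rightHalfPlane)
    (hre : ∀ v ∈ rightHalfPlane, 0 ≤ (deriv h v).re) {L : ℝ} (hL : 0 ≤ L)
    (hosc : ∀ u ∈ rightHalfPlane, ∀ v ∈ rightHalfPlane, (h u).im - (h v).im ≤ L)
    {v : ℂ} (hv : v ∈ rightHalfPlane) :
    0 ≤ ((L / Real.pi : ℝ) * v + (1 - v ^ 2) * deriv h v).re := by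
  have hadd : ∀ ε : ℝ, 0 < ε → v + ε ∈ rightHalfPlane := by
    intro ε hε
    have : 0 < v.re := hv
    rw [mem_rightHalfPlane, Complex.add_re, Complex.ofReal_re]; linarith
  have hε : ∀ ε : ℝ, 0 < ε → 0 ≤ ((L / Real.pi : ℝ) * v + (1 - v ^ 2) * deriv h (v + ε)).re := by
    intro ε hε
    have hR : HasDerivAt (fun κ : ℂ => (v + Complex.I * κ) / (1 + Complex.I * κ * v) + ε)
        (Complex.I * (1 - v ^ 2)) ((0 : ℝ) : ℂ) := by
      have h1 : HasDerivAt (fun κ : ℂ => v + Complex.I * κ) Complex.I ((0 : ℝ) : ℂ) := by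
        simpa using ((hasDerivAt_id ((0 : ℝ) : ℂ)).const_mul Complex.I).const_add v
      have h2 : HasDerivAt (fun κ : ℂ => 1 + Complex.I * κ * v) (Complex.I * v) ((0 : ℝ) : ℂ) := by
        simpa using (((hasDerivAt_id ((0 : ℝ) : ℂ)).const_mul Complex.I).mul_const v).const_add 1
      refine ((h1.div h2 (by simp)).add_const (ε : ℂ)).congr_deriv ?_
      simp
      ring
    have hh : HasDerivAt h (deriv h (v + ε))
        ((v + Complex.I * ((0 : ℝ) : ℂ)) / (1 + Complex.I * ((0 : ℝ) : ℂ) * v) + ε) := by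
      have : (v + Complex.I * ((0 : ℝ) : ℂ)) / (1 + Complex.I * ((0 : ℝ) : ℂ) * v) + ε = v + ε := by
        simp
      rw [this]
      exact (hd.differentiableAt (isOpen_rightHalfPlane.mem_nhds (hadd ε hε))).hasDerivAt
    have hhR := HasDerivAt.comp (h₂ := h)
      (h := fun κ : ℂ => (v + Complex.I * κ) / (1 + Complex.I * κ * v) + ε) ((0 : ℝ) : ℂ) hh hR
    have hlog : HasDerivAt (fun κ : ℂ => Complex.log (κ * v - Complex.I)) (Complex.I * v)
        ((0 : ℝ) : ℂ) := by
      have h1 : HasDerivAt (fun κ : ℂ => κ * v - Complex.I) v ((0 : ℝ) : ℂ) := by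
        simpa using ((hasDerivAt_id ((0 : ℝ) : ℂ)).mul_const v).sub_const Complex.I
      refine (h1.clog (by right; simp)).congr_deriv ?_
      simp
      field_simp
      simp
    have hder := hasDerivAt_im ((((hhR.sub_const (h (v + ε))).add
      ((hlog.add_const (Real.pi / 2 * Complex.I)).const_mul
        ((L / Real.pi : ℝ) : ℂ)))).comp_ofReal)
    -- At κ = 0 the rotation is the identity and Log (-i) + iπ/2 = 0, so the comparison is an
    -- equality; its κ-derivative there is Im (i((L/π) v + (1 - v²) h'(v + ε))).
    have h0 := derivative_nonneg_of_nonneg_right hder ?_ ?_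
    · refine h0.trans_eq ?_
      have : deriv h (v + ε) * (Complex.I * (1 - v ^ 2)) + ((L / Real.pi : ℝ) : ℂ) *
          (Complex.I * v) = Complex.I * (((L / Real.pi : ℝ) : ℂ) * v +
            (1 - v ^ 2) * deriv h (v + ε)) := by ring
      rw [this, Complex.I_mul_im]
    · simp only [Pi.add_apply, Function.comp_apply]
      simp [Complex.log_neg_I]
    · intro κ hκ
      exact im_rotation_nonneg hd hre hL hosc hε hκ hv
  have hc : ContinuousAt (fun ε : ℝ => ((L / Real.pi : ℝ) * v +
      (1 - v ^ 2) * deriv h (v + ε)).re) 0 := by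
    have h1 : ContinuousAt (deriv h) (v + ((0 : ℝ) : ℂ)) := by
      rw [Complex.ofReal_zero, add_zero]
      exact ((hd.deriv isOpen_rightHalfPlane).differentiableAt
        (isOpen_rightHalfPlane.mem_nhds hv)).continuousAt
    have h2 : ContinuousAt (fun ε : ℝ => v + (ε : ℂ)) 0 := by fun_prop
    exact Complex.continuous_re.continuousAt.comp
      (continuousAt_const.add (continuousAt_const.mul
        (ContinuousAt.comp (f := fun ε : ℝ => v + (ε : ℂ)) h1 h2)))
  have h3 := hc.tendsto.mono_left (nhdsWithin_le_nhds (s := Ioi (0 : ℝ)))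
  rw [Complex.ofReal_zero, add_zero] at h3
  exact ge_of_tendsto h3 (eventually_mem_nhdsWithin.mono fun ε he => hε ε he)

/-! ### The Cayley transform and the inequality for s on the disk. -/

/-- The Cayley transform from the right half-plane to the unit disk. -/
noncomputable def cayley (v : ℂ) : ℂ := (v - 1) / (v + 1)

/-- The inverse Cayley transform from the unit disk to the right half-plane. -/
noncomputable def invCayley (z : ℂ) : ℂ := (1 + z) / (1 - z)

theorem add_one_ne_zero {v : ℂ} (hv : v ∈ rightHalfPlane) : v + 1 ≠ 0 := by
  intro h
  have h1 := congrArg Complex.re h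
  have h2 : 0 < v.re := hv
  simp at h1
  linarith

theorem normSq_lt_one {z : ℂ} (hz : z ∈ Metric.ball (0 : ℂ) 1) : Complex.normSq z < 1 := by
  have h1 : ‖z‖ < 1 := by simpa using hz
  rw [Complex.normSq_eq_norm_sq]
  nlinarith [norm_nonneg z]

theorem one_sub_re_pos {z : ℂ} (hz : z ∈ Metric.ball (0 : ℂ) 1) : 0 < (1 - z).re := by
  have h1 : ‖z‖ < 1 := by simpa using hz
  have := Complex.re_le_norm z
  simp
  linarith

theorem one_sub_ne_zero_of_mem_ball {z : ℂ} (hz : z ∈ Metric.ball (0 : ℂ) 1) : 1 - z ≠ 0 := by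
  intro h
  have := one_sub_re_pos hz
  rw [h] at this
  simp at this

theorem cayley_mem {v : ℂ} (hv : v ∈ rightHalfPlane) : cayley v ∈ Metric.ball (0 : ℂ) 1 := by
  have h2 : 0 < v.re := hv
  rw [mem_ball_zero_iff, cayley, norm_div, div_lt_one (norm_pos_iff.2 (add_one_ne_zero hv)),
    ← sq_lt_sq₀ (norm_nonneg _) (norm_nonneg _), ← Complex.normSq_eq_norm_sq,
    ← Complex.normSq_eq_norm_sq, Complex.normSq_apply, Complex.normSq_apply]
  simp
  nlinarith

theorem invCayley_mem {z : ℂ} (hz : z ∈ Metric.ball (0 : ℂ) 1) : invCayley z ∈ rightHalfPlane := by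
  have h1 := normSq_lt_one hz
  rw [mem_rightHalfPlane, invCayley, Complex.div_re, ← add_div]
  refine div_pos ?_ (Complex.normSq_pos.2 (one_sub_ne_zero_of_mem_ball hz))
  rw [Complex.normSq_apply] at h1
  simp
  nlinarith

theorem invCayley_cayley {v : ℂ} (hv : v ∈ rightHalfPlane) : invCayley (cayley v) = v :=
  one_add_cayley_div (add_one_ne_zero hv)

theorem cayley_invCayley {z : ℂ} (hz : z ∈ Metric.ball (0 : ℂ) 1) : cayley (invCayley z) = z := by
  have h1 := one_sub_ne_zero_of_mem_ball hz
  have h2 := add_one_ne_zero (invCayley_mem hz)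
  rw [invCayley] at h2
  rw [cayley, invCayley, div_eq_iff h2]
  field_simp
  ring

theorem image_comp_cayley (f : ℂ → ℂ) :
    (f ∘ cayley) '' rightHalfPlane = f '' Metric.ball (0 : ℂ) 1 := by
  ext w
  constructor
  · rintro ⟨v, hv, rfl⟩
    exact ⟨cayley v, cayley_mem hv, rfl⟩
  · rintro ⟨z, hz, rfl⟩
    exact ⟨invCayley z, invCayley_mem hz, by rw [Function.comp_apply, cayley_invCayley hz]⟩

theorem hasDerivAt_cayley {v : ℂ} (hv : v ∈ rightHalfPlane) :
    HasDerivAt cayley (2 / (v + 1) ^ 2) v := by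
  have h1 := ((hasDerivAt_id v).sub_const 1).div ((hasDerivAt_id v).add_const 1) (add_one_ne_zero hv)
  refine h1.congr_deriv ?_
  simp
  ring

theorem tendsto_cayley :
    Tendsto cayley (cobounded ℂ ⊓ 𝓟 rightHalfPlane) (𝓝[Metric.ball (0 : ℂ) 1] 1) := by
  rw [tendsto_nhdsWithin_iff]
  have hH : ∀ᶠ v in cobounded ℂ ⊓ 𝓟 rightHalfPlane, v ∈ rightHalfPlane :=
    mem_inf_of_right (mem_principal_self _)
  refine ⟨?_, hH.mono fun v hv => cayley_mem hv⟩
  have h1 := tendsto_inv₀_cobounded.comp (tendsto_add_const_cobounded (1 : ℂ))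
  have h2 := ((h1.const_mul (2 : ℂ)).const_sub 1).mono_left
    (inf_le_left : cobounded ℂ ⊓ 𝓟 rightHalfPlane ≤ cobounded ℂ)
  rw [mul_zero, sub_zero] at h2
  refine h2.congr' (hH.mono fun v hv => ?_)
  have := one_sub_cayley (add_one_ne_zero hv)
  simp only [Function.comp_apply]
  rw [← div_eq_mul_inv, ← this, cayley]
  ring

theorem differentiableOn_cayley : DifferentiableOn ℂ cayley rightHalfPlane :=
  fun _ hv => (hasDerivAt_cayley hv).differentiableAt.differentiableWithinAt

theorem injOn_cayley : InjOn cayley rightHalfPlane := fun u hu v hv h => by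
  rw [← invCayley_cayley hu, ← invCayley_cayley hv, h]

theorem hasDerivAt_comp_cayley {f : ℂ → ℂ} (hf : DifferentiableOn ℂ f (Metric.ball 0 1)) {v : ℂ}
    (hv : v ∈ rightHalfPlane) :
    HasDerivAt (f ∘ cayley) (deriv f (cayley v) * (2 / (v + 1) ^ 2)) v :=
  (hf.differentiableAt (Metric.isOpen_ball.mem_nhds (cayley_mem hv))).hasDerivAt.comp v
    (hasDerivAt_cayley hv)

namespace IsConcaveUnivalent

variable {α : ℝ} {f : ℂ → ℂ}

theorem differentiableOn (hf : IsConcaveUnivalent α f) :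
    DifferentiableOn ℂ f (Metric.ball 0 1) := hf.analytic.differentiableOn

theorem isConcaveOnHalfPlane (hf : IsConcaveUnivalent α f) :
    IsConcaveOnHalfPlane (f ∘ cayley) where
  differentiableOn := hf.differentiableOn.comp differentiableOn_cayley fun _ hv => cayley_mem hv
  injOn := hf.injective.comp injOn_cayley fun _ hv => cayley_mem hv
  convex_compl := by rw [image_comp_cayley]; exact hf.convex_compl
  tendsto_cobounded := hf.tendsto_infinity.comp tendsto_cayley

theorem deriv_ne_zero (hf : IsConcaveUnivalent α f) {z : ℂ} (hz : z ∈ Metric.ball (0 : ℂ) 1) :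
    deriv f z ≠ 0 :=
  deriv_ne_zero_of_injOn Metric.isOpen_ball hf.differentiableOn hf.injective hz

/-- Apply the rotation inequality to a logarithm of (f ∘ `cayley`)', with oscillation bound L = π(α
- 1). -/
theorem re_halfPlane_nonneg (hf : IsConcaveUnivalent α f) (hα : 1 < α) {v : ℂ}
    (hv : v ∈ rightHalfPlane) :
    0 ≤ (((α - 1 : ℝ) : ℂ) * v + (1 - v ^ 2) * (deriv (deriv (f ∘ cayley)) v /
      deriv (f ∘ cayley) v)).re := by
  have hF := hf.isConcaveOnHalfPlane
  obtain ⟨h, hd, he⟩ := exists_log_rightHalfPlane hF.differentiableOn_deriv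
    fun v hv => hF.deriv_ne_zero hv
  have hder : ∀ v ∈ rightHalfPlane,
      deriv h v = deriv (deriv (f ∘ cayley)) v / deriv (f ∘ cayley) v := by
    intro v hv
    have hn := isOpen_rightHalfPlane.mem_nhds hv
    have h1 := (hd.differentiableAt hn).hasDerivAt.cexp
    have h2 : deriv (f ∘ cayley) =ᶠ[𝓝 v] fun v => Complex.exp (h v) := by
      filter_upwards [hn] with u hu using (he u hu).symm
    rw [(h1.congr_of_eventuallyEq h2).deriv, he v hv, mul_div_cancel_left₀ _ (hF.deriv_ne_zero hv)]
  have hop : openingAngleAtInfinity ((f ∘ cayley) '' rightHalfPlane) ≤ Real.pi * α := by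
    rw [image_comp_cayley]; exact hf.opening_angle
  have h1 := re_add_one_sub_sq_mul_deriv_nonneg hd
    (fun v hv => by rw [hder v hv]; exact hF.re_deriv_deriv_div_nonneg hv)
    (L := Real.pi * (α - 1)) (mul_nonneg Real.pi_pos.le (by linarith))
    (fun u hu v hv => hF.im_sub_im_le hα hop hd he hu hv) hv
  rwa [mul_div_cancel_left₀ _ Real.pi_pos.ne', hder v hv] at h1

end IsConcaveUnivalent

theorem hasDerivAt_concaveFactor {α : ℝ} {f : ℂ → ℂ}
    (hf : DifferentiableOn ℂ f (Metric.ball 0 1)) {z : ℂ} (hz : z ∈ Metric.ball (0 : ℂ) 1) :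
    HasDerivAt (concaveFactor α f) ((1 - z) ^ ((α : ℂ) + 1) *
      (deriv (deriv f) z - ((α : ℂ) + 1) / (1 - z) * deriv f z)) z := by
  have h1 : HasDerivAt (fun z : ℂ => 1 - z) (-1) z := by
    simpa using (hasDerivAt_id z).const_sub 1
  have h2 := h1.cpow_const (c := (α : ℂ) + 1) (Or.inl (one_sub_re_pos hz))
  have h3 := ((hf.deriv Metric.isOpen_ball).differentiableAt
    (Metric.isOpen_ball.mem_nhds hz)).hasDerivAt
  refine (h2.mul h3).congr_deriv ?_
  have hne := one_sub_ne_zero_of_mem_ball hz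
  rw [Complex.cpow_sub _ _ hne, Complex.cpow_one]
  field_simp
  ring

namespace IsConcaveUnivalent

variable {α : ℝ} {f : ℂ → ℂ}

theorem concaveFactor_ne_zero (hf : IsConcaveUnivalent α f) {z : ℂ}
    (hz : z ∈ Metric.ball (0 : ℂ) 1) : concaveFactor α f z ≠ 0 := by
  refine mul_ne_zero (fun h => ?_) (hf.deriv_ne_zero hz)
  exact one_sub_ne_zero_of_mem_ball hz ((Complex.cpow_eq_zero_iff _ _).1 h).1

/-- The analytic characterization: `s = (1 - z) ^ (α + 1) f'` satisfies
`Re (z s' / s) ≤ (α - 1) / 2`. -/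
theorem re_mul_deriv_div_le (hf : IsConcaveUnivalent α f) (hα : 1 < α) {z : ℂ}
    (hz : z ∈ Metric.ball (0 : ℂ) 1) :
    (z * deriv (concaveFactor α f) z / concaveFactor α f z).re ≤ (α - 1) / 2 := by
  set v := invCayley z with hv
  have hvH : v ∈ rightHalfPlane := invCayley_mem hz
  have h1 := hf.re_halfPlane_nonneg hα hvH
  have hcv : cayley v = z := cayley_invCayley hz
  have hv1 := add_one_ne_zero hvH
  have hne := one_sub_ne_zero_of_mem_ball hz
  have hd0 := hf.deriv_ne_zero hz
  have hF' : ∀ u ∈ rightHalfPlane, deriv (f ∘ cayley) u =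
      deriv f (cayley u) * (2 / (u + 1) ^ 2) :=
    fun u hu => (hasDerivAt_comp_cayley hf.differentiableOn hu).deriv
  have hF'' : deriv (deriv (f ∘ cayley)) v =
      deriv (deriv f) z * (2 / (v + 1) ^ 2) * (2 / (v + 1) ^ 2) -
        deriv f z * (4 / (v + 1) ^ 3) := by
    have h2 : deriv (f ∘ cayley) =ᶠ[𝓝 v] fun u => (deriv f ∘ cayley) u * (2 / (u + 1) ^ 2) := by
      filter_upwards [isOpen_rightHalfPlane.mem_nhds hvH] with u hu using hF' u hu
    have h3 := hasDerivAt_comp_cayley (hf.differentiableOn.deriv Metric.isOpen_ball) hvH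
    have h4 : HasDerivAt (fun u : ℂ => 2 / (u + 1) ^ 2) (-(4 / (v + 1) ^ 3)) v := by
      have := (hasDerivAt_const v (2 : ℂ)).div (((hasDerivAt_id v).add_const 1).pow 2)
        (pow_ne_zero 2 hv1)
      refine this.congr_deriv ?_
      simp
      field_simp
      ring
    rw [((h3.mul h4).congr_of_eventuallyEq h2).deriv, hcv, Function.comp_apply, hcv]
    ring
  have hv2 : v + 1 = 2 / (1 - z) := by
    rw [hv, invCayley]
    field_simp
    ring
  rw [hF'', hF' v hvH, hcv] at h1
  have hs := hasDerivAt_concaveFactor (α := α) hf.differentiableOn hz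
  have hs0 := hf.concaveFactor_ne_zero hz
  have hpow : (1 - z) ^ ((α : ℂ) + 1) ≠ 0 := (mul_ne_zero_iff.1 hs0).1
  -- The exponent α + 1 in s is the one for which this combination becomes a constant minus twice z
  -- s'/s.
  have h5 : ((α - 1 : ℝ) : ℂ) * v + (1 - v ^ 2) * ((deriv (deriv f) z * (2 / (v + 1) ^ 2) *
      (2 / (v + 1) ^ 2) - deriv f z * (4 / (v + 1) ^ 3)) / (deriv f z * (2 / (v + 1) ^ 2))) =
      ((α - 1 : ℝ) : ℂ) - 2 * (z * deriv (concaveFactor α f) z / concaveFactor α f z) := by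
    rw [hs.deriv]
    have h6 : v = 2 / (1 - z) - 1 := by rw [← hv2]; ring
    rw [hv2, h6, concaveFactor]
    push_cast
    field_simp
    ring
  rw [h5] at h1
  simp only [Complex.sub_re, Complex.ofReal_re, Complex.mul_re, Complex.re_ofNat,
    Complex.im_ofNat, zero_mul, sub_zero] at h1
  linarith

end IsConcaveUnivalent

/-! ### Taylor coefficients and mean squares on circles. -/

theorem taylorCoeff_congr {f g : ℂ → ℂ} (h : f =ᶠ[𝓝 0] g) (n : ℕ) :
    taylorCoeff f n = taylorCoeff g n := by
  rw [taylorCoeff, taylorCoeff, h.iteratedDeriv_eq n]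

theorem taylorCoeff_congr_ball {f g : ℂ → ℂ} (h : EqOn f g (Metric.ball 0 1)) (n : ℕ) :
    taylorCoeff f n = taylorCoeff g n :=
  taylorCoeff_congr (h.eventuallyEq_of_mem (Metric.ball_mem_nhds 0 one_pos)) n

theorem taylorCoeff_zero (f : ℂ → ℂ) : taylorCoeff f 0 = f 0 := by simp [taylorCoeff]

theorem taylorCoeff_deriv (f : ℂ → ℂ) (n : ℕ) :
    taylorCoeff (deriv f) n = (n + 1) * taylorCoeff f (n + 1) := by
  rw [taylorCoeff, taylorCoeff, iteratedDeriv_succ', Nat.factorial_succ]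
  have h1 : ((n.factorial : ℕ) : ℂ) ≠ 0 := by exact_mod_cast n.factorial_ne_zero
  have h2 : (n : ℂ) + 1 ≠ 0 := by exact_mod_cast n.succ_ne_zero
  push_cast
  field_simp

theorem taylorCoeff_mul {f g : ℂ → ℂ} (hf : AnalyticAt ℂ f 0) (hg : AnalyticAt ℂ g 0) (n : ℕ) :
    taylorCoeff (fun z => f z * g z) n =
      ∑ k ∈ Finset.range (n + 1), taylorCoeff f k * taylorCoeff g (n - k) := by
  rw [taylorCoeff, iteratedDeriv_fun_mul hf.contDiffAt hg.contDiffAt, Finset.sum_div]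
  refine Finset.sum_congr rfl fun k hk => ?_
  have hk' : k ≤ n := Nat.lt_succ_iff.1 (Finset.mem_range.1 hk)
  have h1 : ((k.factorial : ℕ) : ℂ) ≠ 0 := by exact_mod_cast k.factorial_ne_zero
  have h2 : (((n - k).factorial : ℕ) : ℂ) ≠ 0 := by exact_mod_cast (n - k).factorial_ne_zero
  have h3 : ((n.factorial : ℕ) : ℂ) ≠ 0 := by exact_mod_cast n.factorial_ne_zero
  rw [taylorCoeff, taylorCoeff, Nat.cast_choose ℂ hk']
  field_simp

theorem taylorCoeff_add {f g : ℂ → ℂ} (hf : AnalyticAt ℂ f 0) (hg : AnalyticAt ℂ g 0) (n : ℕ) :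
    taylorCoeff (fun z => f z + g z) n = taylorCoeff f n + taylorCoeff g n := by
  rw [taylorCoeff, iteratedDeriv_fun_add hf.contDiffAt hg.contDiffAt, add_div]; rfl

theorem taylorCoeff_const_mul (c : ℂ) (f : ℂ → ℂ) (n : ℕ) :
    taylorCoeff (fun z => c * f z) n = c * taylorCoeff f n := by
  rw [taylorCoeff, iteratedDeriv_const_mul_field, taylorCoeff, mul_div_assoc]

theorem taylorCoeff_pow (m n : ℕ) :
    taylorCoeff (fun z => z ^ m) n = if n = m then 1 else 0 := by
  rw [taylorCoeff, iteratedDeriv_fun_pow_zero]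
  split_ifs with h
  · subst h; exact div_self (by exact_mod_cast n.factorial_ne_zero)
  · simp

theorem taylorCoeff_sum_pow (a : ℕ → ℂ) (m n : ℕ) :
    taylorCoeff (fun z => ∑ k ∈ Finset.range m, a k * z ^ k) n = if n < m then a n else 0 := by
  have h : taylorCoeff (fun z => ∑ k ∈ Finset.range m, a k * z ^ k) n =
      ∑ k ∈ Finset.range m, taylorCoeff (fun z => a k * z ^ k) n := by
    rw [taylorCoeff, iteratedDeriv_fun_sum, Finset.sum_div]
    · rfl
    · exact fun k _ => by fun_prop
  simp [h, taylorCoeff_const_mul, taylorCoeff_pow]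

theorem taylorCoeff_pow_mul {f : ℂ → ℂ} (hf : AnalyticAt ℂ f 0) (m n : ℕ) :
    taylorCoeff (fun z => z ^ m * f z) n = if m ≤ n then taylorCoeff f (n - m) else 0 := by
  rw [taylorCoeff_mul (by fun_prop) hf]
  simp only [taylorCoeff_pow, ite_mul, one_mul, zero_mul, Finset.sum_ite_eq', Finset.mem_range,
    Nat.lt_succ_iff]

theorem taylorCoeff_one_sub_cpow (a : ℝ) (n : ℕ) :
    taylorCoeff (fun z => (1 - z) ^ (a : ℂ)) n = (-1) ^ n * ((Ring.choose a n : ℝ) : ℂ) := by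
  have h := Complex.one_add_cpow_hasFPowerSeriesAt_zero (a := (a : ℂ))
  have h2 := HasFPowerSeriesAt.eq_formalMultilinearSeries h.analyticAt.hasFPowerSeriesAt h
  have h3 := congrArg (fun p => FormalMultilinearSeries.coeff p n) h2
  simp only [binomialSeries, FormalMultilinearSeries.coeff_ofScalars] at h3
  have h4 : iteratedDeriv n (fun z : ℂ => (1 - z) ^ (a : ℂ)) 0 =
      (-1 : ℂ) ^ n * iteratedDeriv n (fun z : ℂ => (1 + z) ^ (a : ℂ)) 0 := by
    have := iteratedDeriv_comp_neg n (fun z : ℂ => (1 + z) ^ (a : ℂ)) 0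
    simpa [sub_eq_add_neg] using this
  rw [taylorCoeff, h4, mul_div_assoc, h3]
  congr 1
  exact (Ring.map_choose (Complex.ofRealHom) a n).symm

-- On |z| = r one has conj z = r²/z, so the average is Cauchy's integral for the k-th coefficient.
open Complex ComplexConjugate in
theorem circleAverage_mul_conj_pow {g : ℂ → ℂ} {r : ℝ} (hr : 0 < r)
    (hg : DifferentiableOn ℂ g (Metric.closedBall 0 r)) (k : ℕ) :
    Real.circleAverage (fun z => g z * conj (z ^ k)) 0 r = taylorCoeff g k * (r : ℂ) ^ (2 * k) := by
  have h1 : ∀ z ∈ Metric.sphere (0 : ℂ) |r|,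
      g z * conj (z ^ k) = ((r : ℂ) ^ (2 * k)) * ((z ^ k)⁻¹ * g z) := fun z hz => by
    have hz' : ‖z‖ = r := by simpa [abs_of_pos hr] using hz
    have hz0 : z ≠ 0 := norm_pos_iff.1 (hz' ▸ hr)
    have h2 : conj z = (r : ℂ) ^ 2 / z := by
      rw [eq_div_iff hz0, mul_comm, mul_conj, normSq_eq_norm_sq, hz']; push_cast; rfl
    rw [map_pow, h2, div_pow, ← pow_mul]
    field_simp
  rw [Real.circleAverage_congr_sphere h1, Real.circleAverage_eq_circleIntegral hr.ne']
  have h3 := hg.circleIntegral_one_div_sub_center_pow_smul hr k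
  have h4 : (∮ z in C(0, r), (z - 0)⁻¹ • ((r : ℂ) ^ (2 * k) * ((z ^ k)⁻¹ * g z))) =
      (r : ℂ) ^ (2 * k) * ∮ z in C(0, r), (1 / (z - 0) ^ (k + 1)) • g z := by
    rw [← smul_eq_mul ((r : ℂ) ^ (2 * k)), ← circleIntegral.integral_smul]
    refine circleIntegral.integral_congr hr.le fun z hz => ?_
    have hz0 : z ≠ 0 := norm_pos_iff.1 ((by simpa using hz : ‖z‖ = r) ▸ hr)
    simp only [smul_eq_mul, sub_zero, pow_succ]
    field_simp
  rw [h4, h3, taylorCoeff]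
  have := two_pi_I_ne_zero
  have h1 : ((k.factorial : ℕ) : ℂ) ≠ 0 := by exact_mod_cast k.factorial_ne_zero
  simp only [smul_eq_mul]
  field_simp

open Complex ComplexConjugate in
/-- The circle average of `Re (g * conj p)` for a polynomial `p`. -/
theorem circleAverage_re_mul_conj_sum {g : ℂ → ℂ} {r : ℝ} (hr : 0 < r)
    (hg : DifferentiableOn ℂ g (Metric.closedBall 0 r)) (a : ℕ → ℂ) (N : ℕ) :
    Real.circleAverage (fun z => (g z * conj (∑ k ∈ Finset.range N, a k * z ^ k)).re) 0 r =
      ∑ k ∈ Finset.range N, (taylorCoeff g k * conj (a k)).re * r ^ (2 * k) := by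
  have hgc : ContinuousOn g (Metric.sphere 0 |r|) := by
    rw [abs_of_pos hr]; exact hg.continuousOn.mono Metric.sphere_subset_closedBall
  have h1 : ∀ k, CircleIntegrable (fun z => conj (a k) * (g z * conj (z ^ k))) 0 r := fun k =>
    ContinuousOn.circleIntegrable' (continuousOn_const.mul (hgc.mul (by fun_prop)))
  have h2 : CircleIntegrable
      (fun z => ∑ k ∈ Finset.range N, conj (a k) * (g z * conj (z ^ k))) 0 r :=
    ContinuousOn.circleIntegrable' (continuousOn_finsetSum _ fun k _ =>
      continuousOn_const.mul (hgc.mul (by fun_prop)))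
  have h3 : (fun z => (g z * conj (∑ k ∈ Finset.range N, a k * z ^ k)).re) =
      reCLM ∘ fun z => ∑ k ∈ Finset.range N, conj (a k) * (g z * conj (z ^ k)) := by
    funext z
    simp only [Function.comp, reCLM_apply, map_sum, map_mul, Finset.mul_sum, re_sum]
    exact Finset.sum_congr rfl fun k _ => by rw [mul_left_comm]
  rw [h3, ContinuousLinearMap.circleAverage_comp_comm _ h2,
    Real.circleAverage_fun_sum fun k _ => h1 k, map_sum]
  refine Finset.sum_congr rfl fun k _ => ?_
  have h4 : Real.circleAverage (fun z => conj (a k) * (g z * conj (z ^ k))) 0 r =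
      conj (a k) * Real.circleAverage (fun z => (g z * conj (z ^ k))) 0 r := by
    simpa only [smul_eq_mul] using
      Real.circleAverage_fun_smul (a := conj (a k)) (f := fun z => g z * conj (z ^ k))
  rw [h4, circleAverage_mul_conj_pow hr hg, reCLM_apply,
    show conj (a k) * (taylorCoeff g k * (r : ℂ) ^ (2 * k)) =
      ((r ^ (2 * k) : ℝ) : ℂ) * (taylorCoeff g k * conj (a k)) by push_cast; ring, re_ofReal_mul]
  ring

open Complex ComplexConjugate in
theorem circleAverage_normSq_sum {r : ℝ} (hr : 0 < r) (a : ℕ → ℂ) (N : ℕ) :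
    Real.circleAverage (fun z => ‖∑ k ∈ Finset.range N, a k * z ^ k‖ ^ 2) 0 r =
      ∑ k ∈ Finset.range N, ‖a k‖ ^ 2 * r ^ (2 * k) := by
  have h := circleAverage_re_mul_conj_sum hr
    (g := fun z => ∑ k ∈ Finset.range N, a k * z ^ k) (by fun_prop) a N
  have h2 : ∀ w : ℂ, (w * conj w).re = ‖w‖ ^ 2 := fun w => by
    rw [mul_conj, ofReal_re, normSq_eq_norm_sq]
  simp only [h2] at h
  rw [h]
  refine Finset.sum_congr rfl fun k hk => ?_
  rw [taylorCoeff_sum_pow, if_pos (Finset.mem_range.1 hk), h2]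

open Complex ComplexConjugate in
/-- Bessel's inequality on a circle. -/
theorem sum_norm_taylorCoeff_sq_le_circleAverage {g : ℂ → ℂ} {r : ℝ} (hr : 0 < r)
    (hg : DifferentiableOn ℂ g (Metric.closedBall 0 r)) (N : ℕ) :
    ∑ k ∈ Finset.range N, ‖taylorCoeff g k‖ ^ 2 * r ^ (2 * k) ≤
      Real.circleAverage (fun z => ‖g z‖ ^ 2) 0 r := by
  set S : ℂ → ℂ := fun z => ∑ k ∈ Finset.range N, taylorCoeff g k * z ^ k with hS
  have hgc : ContinuousOn g (Metric.sphere 0 |r|) := by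
    rw [abs_of_pos hr]; exact hg.continuousOn.mono Metric.sphere_subset_closedBall
  have hSc : Continuous S := by fun_prop
  -- Expanding |g - S|², with S a Taylor polynomial of g, turns this into the inequality.
  have h1 : 0 ≤ Real.circleAverage (fun z => ‖g z - S z‖ ^ 2) 0 r :=
    Real.circleAverage_nonneg_of_nonneg fun z _ => by positivity
  have h2 : (fun z => ‖g z - S z‖ ^ 2) =
      fun z => ‖g z‖ ^ 2 + ‖S z‖ ^ 2 - ((g z * conj (S z)).re + (g z * conj (S z)).re) := by
    funext z
    rw [← normSq_eq_norm_sq, ← normSq_eq_norm_sq, ← normSq_eq_norm_sq, normSq_sub]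
    ring
  have i1 : CircleIntegrable (fun z => ‖g z‖ ^ 2) 0 r :=
    ContinuousOn.circleIntegrable' (hgc.norm.pow 2)
  have i2 : CircleIntegrable (fun z => ‖S z‖ ^ 2) 0 r :=
    ContinuousOn.circleIntegrable' (hSc.continuousOn.norm.pow 2)
  have i3 : CircleIntegrable (fun z => (g z * conj (S z)).re) 0 r :=
    ContinuousOn.circleIntegrable' (continuous_re.comp_continuousOn
      (hgc.mul (continuous_conj.comp_continuousOn hSc.continuousOn)))
  have h3 := circleAverage_re_mul_conj_sum hr hg (taylorCoeff g) N
  have h4 := circleAverage_normSq_sum hr (taylorCoeff g) N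
  have i4 : CircleIntegrable (fun z => ‖g z‖ ^ 2 + ‖S z‖ ^ 2) 0 r := i1.add i2
  have i5 : CircleIntegrable (fun z => (g z * conj (S z)).re + (g z * conj (S z)).re) 0 r :=
    i3.add i3
  rw [h2, Real.circleAverage_fun_sub i4 i5, Real.circleAverage_fun_add i1 i2,
    Real.circleAverage_fun_add i3 i3, h3, h4] at h1
  have h5 : ∀ w : ℂ, (w * conj w).re = ‖w‖ ^ 2 := fun w => by
    rw [mul_conj, ofReal_re, normSq_eq_norm_sq]
  simp only [h5] at h1
  linarith

/-- If `g` is dominated by a polynomial on the unit disk, then the sums of the squares of the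
coefficients compare. -/
theorem sum_norm_taylorCoeff_sq_le {g : ℂ → ℂ} (hg : DifferentiableOn ℂ g (Metric.ball 0 1))
    (a : ℕ → ℂ) (n N : ℕ)
    (h : ∀ z ∈ Metric.ball (0 : ℂ) 1, ‖g z‖ ≤ ‖∑ k ∈ Finset.range n, a k * z ^ k‖) :
    ∑ k ∈ Finset.range N, ‖taylorCoeff g k‖ ^ 2 ≤ ∑ k ∈ Finset.range n, ‖a k‖ ^ 2 := by
  have key : ∀ r ∈ Ioo (0 : ℝ) 1, ∑ k ∈ Finset.range N, ‖taylorCoeff g k‖ ^ 2 * r ^ (2 * k) ≤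
      ∑ k ∈ Finset.range n, ‖a k‖ ^ 2 * r ^ (2 * k) := fun r hr => by
    have hsub : Metric.closedBall (0 : ℂ) r ⊆ Metric.ball 0 1 :=
      Metric.closedBall_subset_ball hr.2
    have hg' := hg.mono hsub
    rw [← circleAverage_normSq_sum hr.1 a n]
    refine (sum_norm_taylorCoeff_sq_le_circleAverage hr.1 hg' N).trans
      (Real.circleAverage_mono ?_ ?_ fun z hz => ?_)
    · refine ContinuousOn.circleIntegrable' (ContinuousOn.pow (ContinuousOn.norm ?_) 2)
      rw [abs_of_pos hr.1]
      exact hg'.continuousOn.mono Metric.sphere_subset_closedBall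
    · exact ContinuousOn.circleIntegrable' (Continuous.continuousOn (by fun_prop))
    · rw [abs_of_pos hr.1] at hz
      exact pow_le_pow_left₀ (norm_nonneg _)
        (h z (hsub (Metric.sphere_subset_closedBall hz))) 2
  have t : ∀ (b : ℕ → ℝ) (m : ℕ), Tendsto (fun r : ℝ => ∑ k ∈ Finset.range m, b k * r ^ (2 * k))
      (𝓝[<] 1) (𝓝 (∑ k ∈ Finset.range m, b k)) := fun b m => by
    have : Continuous fun r : ℝ => ∑ k ∈ Finset.range m, b k * r ^ (2 * k) := by fun_prop
    simpa using (this.tendsto 1).mono_left nhdsWithin_le_nhds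
  exact le_of_tendsto_of_tendsto (t _ N) (t _ n)
    (eventually_of_mem (Ioo_mem_nhdsLT one_pos) key)

theorem analyticAt_zero_of_differentiableOn {g : ℂ → ℂ}
    (hg : DifferentiableOn ℂ g (Metric.ball 0 1)) : AnalyticAt ℂ g 0 :=
  hg.analyticAt (Metric.ball_mem_nhds 0 one_pos)

theorem eqOn_ball_of_taylorCoeff_eq {g h : ℂ → ℂ} (hg : DifferentiableOn ℂ g (Metric.ball 0 1))
    (hh : DifferentiableOn ℂ h (Metric.ball 0 1)) (H : ∀ k, taylorCoeff g k = taylorCoeff h k) :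
    EqOn g h (Metric.ball 0 1) := fun z hz => by
  have h1 := Complex.hasSum_taylorSeries_on_ball hg hz
  have h2 := Complex.hasSum_taylorSeries_on_ball hh hz
  refine h1.unique ?_
  convert h2 using 2 with k
  have := H k
  have hk : ((k.factorial : ℕ) : ℂ) ≠ 0 := by exact_mod_cast k.factorial_ne_zero
  rw [taylorCoeff, taylorCoeff, div_left_inj' hk] at this
  rw [this]

theorem differentiableOn_deriv_ball {g : ℂ → ℂ} (hg : DifferentiableOn ℂ g (Metric.ball 0 1)) :
    DifferentiableOn ℂ (deriv g) (Metric.ball 0 1) := hg.deriv Metric.isOpen_ball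

/-- The coefficients of `z g'`. -/
theorem taylorCoeff_mul_deriv {g : ℂ → ℂ} (hg : DifferentiableOn ℂ g (Metric.ball 0 1)) (k : ℕ) :
    taylorCoeff (fun z => z * deriv g z) k = k * taylorCoeff g k := by
  have h := taylorCoeff_pow_mul
    (analyticAt_zero_of_differentiableOn (differentiableOn_deriv_ball hg)) 1 k
  simp only [pow_one] at h
  rw [h]
  cases k with
  | zero => simp
  | succ k => rw [if_pos (by omega), Nat.add_sub_cancel, taylorCoeff_deriv]; push_cast; rfl

/-- The coefficients of `z g' - β g`. -/
theorem taylorCoeff_mul_deriv_sub {g : ℂ → ℂ} (hg : DifferentiableOn ℂ g (Metric.ball 0 1))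
    (β : ℂ) (k : ℕ) :
    taylorCoeff (fun z => z * deriv g z - β * g z) k = (k - β) * taylorCoeff g k := by
  have h := taylorCoeff_add
    (analyticAt_zero_of_differentiableOn (differentiableOn_id.mul (differentiableOn_deriv_ball hg)))
    (analyticAt_zero_of_differentiableOn (hg.const_mul (-β))) k
  have h2 : (fun z => z * deriv g z - β * g z) = fun z => z * deriv g z + -β * g z := by
    funext z; ring
  rw [h2]
  refine h.trans ?_
  rw [taylorCoeff_const_mul, show taylorCoeff (id * deriv g) k = _ from taylorCoeff_mul_deriv hg k]
  ring

/-! ### Clunie's method: the coefficient bound. -/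

/-- Re A ≤ β/2 says that A is at least as close to 0 as to β; it is used with A = z s'/s. -/
theorem norm_mul_deriv_le {β : ℝ} (hβ : 0 < β) {w s A : ℂ} (hs : s ≠ 0) (hA : w = A * s)
    (hre : A.re ≤ β / 2) : ‖w‖ ≤ ‖w - β * s‖ ∧ w - β * s ≠ 0 := by
  have h1 : w - β * s = (A - β) * s := by rw [hA]; ring
  have h2 : A - β ≠ 0 := fun h => by
    have := congrArg Complex.re h
    simp at this
    linarith
  refine ⟨?_, h1 ▸ mul_ne_zero h2 hs⟩
  rw [h1, hA, norm_mul, norm_mul]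
  refine mul_le_mul_of_nonneg_right ?_ (norm_nonneg _)
  rw [← sq_le_sq₀ (norm_nonneg _) (norm_nonneg _), ← Complex.normSq_eq_norm_sq,
    ← Complex.normSq_eq_norm_sq, Complex.normSq_apply, Complex.normSq_apply]
  simp
  nlinarith

/-- A zero-free function `s` on the disk with `s 0 = 1` and `Re (z s' / s) ≤ β / 2`. -/
structure HasLogDerivBound (β : ℝ) (s : ℂ → ℂ) : Prop where
  differentiableOn : DifferentiableOn ℂ s (Metric.ball 0 1)
  map_zero : s 0 = 1
  ne_zero : ∀ z ∈ Metric.ball (0 : ℂ) 1, s z ≠ 0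
  re_le : ∀ z ∈ Metric.ball (0 : ℂ) 1, (z * deriv s z / s z).re ≤ β / 2

/-- The function `ω` with `z s' = ω (z s' - β s)`. -/
noncomputable def schwarzQuotient (β : ℝ) (s : ℂ → ℂ) (z : ℂ) : ℂ :=
  z * deriv s z / (z * deriv s z - β * s z)

namespace HasLogDerivBound

variable {β : ℝ} {s : ℂ → ℂ}

theorem norm_le_and_ne (h : HasLogDerivBound β s) (hβ : 0 < β) {z : ℂ}
    (hz : z ∈ Metric.ball (0 : ℂ) 1) :
    ‖z * deriv s z‖ ≤ ‖z * deriv s z - β * s z‖ ∧ z * deriv s z - β * s z ≠ 0 :=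
  norm_mul_deriv_le hβ (h.ne_zero z hz) (div_mul_cancel₀ _ (h.ne_zero z hz)).symm (h.re_le z hz)

theorem norm_schwarzQuotient_le (h : HasLogDerivBound β s) (hβ : 0 < β) {z : ℂ}
    (hz : z ∈ Metric.ball (0 : ℂ) 1) : ‖schwarzQuotient β s z‖ ≤ 1 := by
  rw [schwarzQuotient, norm_div]
  exact div_le_one_of_le₀ (h.norm_le_and_ne hβ hz).1 (norm_nonneg _)

theorem differentiableOn_schwarzQuotient (h : HasLogDerivBound β s) (hβ : 0 < β) :
    DifferentiableOn ℂ (schwarzQuotient β s) (Metric.ball 0 1) := by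
  have h1 := differentiableOn_id.mul (differentiableOn_deriv_ball h.differentiableOn)
  exact h1.div (h1.sub (h.differentiableOn.const_mul _)) fun z hz => (h.norm_le_and_ne hβ hz).2

theorem schwarzQuotient_mul (h : HasLogDerivBound β s) (hβ : 0 < β) :
    EqOn (fun z => schwarzQuotient β s z * (z * deriv s z - β * s z)) (fun z => z * deriv s z)
      (Metric.ball 0 1) := fun _ hz => div_mul_cancel₀ _ (h.norm_le_and_ne hβ hz).2

theorem taylorCoeff_recurrence (h : HasLogDerivBound β s) (hβ : 0 < β) (k : ℕ) :
    ∑ i ∈ Finset.range (k + 1), taylorCoeff (schwarzQuotient β s) i *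
      ((((k - i : ℕ) : ℂ) - β) * taylorCoeff s (k - i)) = k * taylorCoeff s k := by
  have h1 := taylorCoeff_mul
      (f := schwarzQuotient β s) (g := fun z => z * deriv s z - β * s z)
      (analyticAt_zero_of_differentiableOn (h.differentiableOn_schwarzQuotient hβ))
      (analyticAt_zero_of_differentiableOn ((differentiableOn_id.mul
        (differentiableOn_deriv_ball h.differentiableOn)).sub (h.differentiableOn.const_mul _))) k
  rw [← taylorCoeff_mul_deriv h.differentiableOn k,
    ← taylorCoeff_congr_ball (h.schwarzQuotient_mul hβ) k, h1]
  exact Finset.sum_congr rfl fun i _ => by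
    rw [← taylorCoeff_mul_deriv_sub h.differentiableOn]

theorem schwarzQuotient_zero : taylorCoeff (schwarzQuotient β s) 0 = 0 := by
  simp [taylorCoeff_zero, schwarzQuotient]

/-- Since ω(0) = 0, the coefficients of ω (z s' - β s) up to order n involve only those of z s' - β
s of order below n. The latter may be replaced by its truncation p, and |ω p| ≤ |p| compares the
mean squares. -/
theorem sum_sq_le (h : HasLogDerivBound β s) (hβ : 0 < β) (n : ℕ) :
    ∑ k ∈ Finset.range (n + 1), ‖(k : ℂ) * taylorCoeff s k‖ ^ 2 ≤
      ∑ k ∈ Finset.range n, ‖((k : ℂ) - β) * taylorCoeff s k‖ ^ 2 := by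
  set a : ℕ → ℂ := fun k => ((k : ℂ) - β) * taylorCoeff s k
  set p : ℂ → ℂ := fun z => ∑ k ∈ Finset.range n, a k * z ^ k
  have hp : Differentiable ℂ p := by fun_prop
  have h1 := sum_norm_taylorCoeff_sq_le
    ((h.differentiableOn_schwarzQuotient hβ).mul hp.differentiableOn) a n (n + 1) fun z hz => by
      rw [Pi.mul_apply, norm_mul]
      exact mul_le_of_le_one_left (norm_nonneg _) (h.norm_schwarzQuotient_le hβ hz)
  refine le_trans (le_of_eq (Finset.sum_congr rfl fun k hk => ?_)) h1
  have hk' : k ≤ n := Nat.lt_succ_iff.1 (Finset.mem_range.1 hk)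
  congr 2
  have h2 := taylorCoeff_mul
      (analyticAt_zero_of_differentiableOn (h.differentiableOn_schwarzQuotient hβ))
      (analyticAt_zero_of_differentiableOn hp.differentiableOn) k
  rw [← h.taylorCoeff_recurrence hβ k]
  refine Eq.trans (Finset.sum_congr rfl fun i hi => ?_) h2.symm
  rcases Nat.eq_zero_or_pos i with rfl | hi0
  · simp [schwarzQuotient_zero]
  · have := Finset.mem_range.1 hi
    rw [taylorCoeff_sum_pow, if_pos (by omega)]

/-- The term k = 0 gives β² because s(0) = 1. For k ≥ 1, k² - (k - β)² = β(2k - β) ≥ β as β ≤ 1;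
retaining this gain is what settles the equality case. -/
theorem sq_add_sum_le (h : HasLogDerivBound β s) (hβ : 0 < β) (hβ' : β ≤ 1) (m : ℕ) :
    (((m : ℝ) + 1) * ‖taylorCoeff s (m + 1)‖) ^ 2 +
      β * ∑ k ∈ Finset.range m, ‖taylorCoeff s (k + 1)‖ ^ 2 ≤ β ^ 2 := by
  have h1 := h.sum_sq_le hβ (m + 1)
  have e1 : ∀ k : ℕ, ‖(k : ℂ) * taylorCoeff s k‖ ^ 2 = (k : ℝ) ^ 2 * ‖taylorCoeff s k‖ ^ 2 :=
    fun k => by rw [norm_mul, mul_pow, Complex.norm_natCast]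
  have e2 : ∀ k : ℕ, ‖((k : ℂ) - β) * taylorCoeff s k‖ ^ 2 =
      ((k : ℝ) - β) ^ 2 * ‖taylorCoeff s k‖ ^ 2 := fun k => by
    rw [norm_mul, mul_pow, ← Complex.ofReal_natCast, ← Complex.ofReal_sub, Complex.norm_real,
      Real.norm_eq_abs, sq_abs]
  simp only [e1, e2] at h1
  rw [Finset.sum_range_succ _ (m + 1), Finset.sum_range_succ' _ m, Finset.sum_range_succ' _ m,
    taylorCoeff_zero, h.map_zero] at h1
  have h2 : β * ∑ k ∈ Finset.range m, ‖taylorCoeff s (k + 1)‖ ^ 2 ≤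
      ∑ k ∈ Finset.range m, (((k + 1 : ℕ) : ℝ) ^ 2 * ‖taylorCoeff s (k + 1)‖ ^ 2 -
        (((k + 1 : ℕ) : ℝ) - β) ^ 2 * ‖taylorCoeff s (k + 1)‖ ^ 2) := by
    rw [Finset.mul_sum]
    refine Finset.sum_le_sum fun k _ => ?_
    rw [← sub_mul]
    refine mul_le_mul_of_nonneg_right ?_ (by positivity)
    push_cast
    nlinarith [mul_nonneg hβ.le (Nat.cast_nonneg (α := ℝ) k)]
  rw [Finset.sum_sub_distrib] at h2
  push_cast at h1 h2
  simp at h1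
  nlinarith

theorem norm_taylorCoeff_le (h : HasLogDerivBound β s) (hβ : 0 < β) (hβ' : β ≤ 1) {n : ℕ}
    (hn : 1 ≤ n) : ‖taylorCoeff s n‖ ≤ β / n := by
  obtain ⟨m, rfl⟩ : ∃ m, n = m + 1 := ⟨n - 1, by omega⟩
  have h1 := h.sq_add_sum_le hβ hβ' m
  have h2 : 0 ≤ β * ∑ k ∈ Finset.range m, ‖taylorCoeff s (k + 1)‖ ^ 2 := by positivity
  have h3 : ((m : ℝ) + 1) * ‖taylorCoeff s (m + 1)‖ ≤ β :=
    (sq_le_sq₀ (by positivity) hβ.le).1 (by linarith)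
  rw [le_div_iff₀ (by positivity)]
  push_cast
  linarith

theorem taylorCoeff_eq_zero_of_norm_eq (h : HasLogDerivBound β s) (hβ : 0 < β) (hβ' : β ≤ 1)
    {n : ℕ} (hn : 1 ≤ n) (heq : ‖taylorCoeff s n‖ = β / n) {k : ℕ} (hk : 1 ≤ k) (hkn : k < n) :
    taylorCoeff s k = 0 := by
  obtain ⟨m, rfl⟩ : ∃ m, n = m + 1 := ⟨n - 1, by omega⟩
  obtain ⟨j, rfl⟩ : ∃ m, k = m + 1 := ⟨k - 1, by omega⟩
  have h1 := h.sq_add_sum_le hβ hβ' m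
  rw [heq] at h1
  have h2 : ((m : ℝ) + 1) * (β / ((m + 1 : ℕ) : ℝ)) = β := by push_cast; field_simp
  rw [h2] at h1
  have h3 : ∑ k ∈ Finset.range m, ‖taylorCoeff s (k + 1)‖ ^ 2 ≤ 0 := by
    by_contra! hc
    have := mul_pos hβ hc
    linarith
  have h4 := Finset.single_le_sum (f := fun k => ‖taylorCoeff s (k + 1)‖ ^ 2)
    (fun k _ => by positivity) (Finset.mem_range.2 (by omega : j < m))
  have h5 : ‖taylorCoeff s (j + 1)‖ ^ 2 = 0 := le_antisymm (h4.trans h3) (by positivity)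
  simpa using h5

/-- With the coefficients of orders 1 to n - 1 equal to zero, only s(0) = 1 survives in the
recurrence, with factor -β. -/
theorem taylorCoeff_schwarzQuotient (h : HasLogDerivBound β s) (hβ : 0 < β) {n : ℕ}
    (hz : ∀ k, 1 ≤ k → k < n → taylorCoeff s k = 0) {k : ℕ} (hk : k ≤ n) :
    -(β : ℂ) * taylorCoeff (schwarzQuotient β s) k = k * taylorCoeff s k := by
  rw [← h.taylorCoeff_recurrence hβ k, Finset.sum_range_succ, Finset.sum_eq_zero]
  · simp [taylorCoeff_zero s, h.map_zero, mul_comm]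
  · intro i hi
    have hi' := Finset.mem_range.1 hi
    rcases Nat.eq_zero_or_pos i with rfl | hi0
    · rw [schwarzQuotient_zero, zero_mul]
    · rw [hz (k - i) (by omega) (by omega), mul_zero, mul_zero]

/-- Equality makes the n-th coefficient of ω unimodular; as |ω| ≤ 1, the squared moduli of the
coefficients sum to at most 1 and all others vanish. -/
theorem schwarzQuotient_eq_of_norm_eq (h : HasLogDerivBound β s) (hβ : 0 < β) (hβ' : β ≤ 1)
    {n : ℕ} (hn : 1 ≤ n) (heq : ‖taylorCoeff s n‖ = β / n) :
    ∃ c : ℂ, ‖c‖ = 1 ∧ EqOn (schwarzQuotient β s) (fun z => c * z ^ n) (Metric.ball 0 1) := by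
  have hz := fun k hk hkn => h.taylorCoeff_eq_zero_of_norm_eq hβ hβ' hn heq (k := k) hk hkn
  have hβ0 : (-(β : ℂ)) ≠ 0 := neg_ne_zero.2 (by exact_mod_cast hβ.ne')
  have hn0 : (0 : ℝ) < n := by exact_mod_cast hn
  have hc : ‖taylorCoeff (schwarzQuotient β s) n‖ = 1 := by
    have h1 := congrArg norm (h.taylorCoeff_schwarzQuotient hβ hz le_rfl)
    rw [norm_mul, norm_mul, norm_neg, Complex.norm_real, Complex.norm_natCast, heq,
      Real.norm_of_nonneg hβ.le, mul_div_cancel₀ _ hn0.ne'] at h1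
    exact mul_left_cancel₀ hβ.ne' (h1.trans (mul_one β).symm)
  refine ⟨_, hc, eqOn_ball_of_taylorCoeff_eq (h.differentiableOn_schwarzQuotient hβ)
    (by fun_prop) fun k => ?_⟩
  rw [taylorCoeff_const_mul, taylorCoeff_pow]
  split_ifs with hk
  · rw [hk, mul_one]
  rw [mul_zero]
  have hB := sum_norm_taylorCoeff_sq_le (h.differentiableOn_schwarzQuotient hβ) (fun _ => 1) 1
    (max k n + 1) fun z hz' => by simpa using h.norm_schwarzQuotient_le hβ hz'
  have h2 := Finset.sum_le_sum_of_subset_of_nonneg (s := {k, n})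
    (t := Finset.range (max k n + 1))
    (f := fun k => ‖taylorCoeff (schwarzQuotient β s) k‖ ^ 2) (fun i hi => by
      simp only [Finset.mem_insert, Finset.mem_singleton] at hi
      rw [Finset.mem_range]; omega) fun i _ _ => by positivity
  rw [Finset.sum_pair hk, hc] at h2
  simp at hB
  have h5 : ‖taylorCoeff (schwarzQuotient β s) k‖ ^ 2 = 0 := le_antisymm (by linarith) (by positivity)
  simpa using h5

end HasLogDerivBound

/-! ### The equality case: the differential equation. -/

/-- Solutions of `z s' = c z ^ n (z s' - β s)` are determined by their value at the origin. -/
theorem taylorCoeff_of_mul_deriv_eq {s : ℂ → ℂ} (hs : DifferentiableOn ℂ s (Metric.ball 0 1))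
    {β c : ℂ} {n : ℕ} (h : EqOn (fun z => z * deriv s z)
      (fun z => c * (z ^ n * (z * deriv s z - β * s z))) (Metric.ball 0 1)) (k : ℕ) :
    k * taylorCoeff s k =
      if n ≤ k then c * ((((k - n : ℕ) : ℂ) - β) * taylorCoeff s (k - n)) else 0 := by
  rw [← taylorCoeff_mul_deriv hs k, taylorCoeff_congr_ball h k, taylorCoeff_const_mul,
    taylorCoeff_pow_mul (f := fun z => z * deriv s z - β * s z)
      (analyticAt_zero_of_differentiableOn ((differentiableOn_id.mul
        (differentiableOn_deriv_ball hs)).sub (hs.const_mul _))),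
    taylorCoeff_mul_deriv_sub hs, mul_ite, mul_zero]

/-- The coefficient of order k ≥ 1 is either 0 or determined by the one of order k - n. -/
theorem eqOn_of_mul_deriv_eq {s t : ℂ → ℂ} (hs : DifferentiableOn ℂ s (Metric.ball 0 1))
    (ht : DifferentiableOn ℂ t (Metric.ball 0 1)) {β c : ℂ} {n : ℕ} (hn : 1 ≤ n)
    (h : EqOn (fun z => z * deriv s z)
      (fun z => c * (z ^ n * (z * deriv s z - β * s z))) (Metric.ball 0 1))
    (h' : EqOn (fun z => z * deriv t z)
      (fun z => c * (z ^ n * (z * deriv t z - β * t z))) (Metric.ball 0 1))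
    (h0 : s 0 = t 0) : EqOn s t (Metric.ball 0 1) := by
  refine eqOn_ball_of_taylorCoeff_eq hs ht fun k => ?_
  induction k using Nat.strong_induction_on with
  | _ k ih =>
    rcases Nat.eq_zero_or_pos k with rfl | hk
    · rw [taylorCoeff_zero, taylorCoeff_zero, h0]
    · have hk0 : (k : ℂ) ≠ 0 := by exact_mod_cast hk.ne'
      refine mul_left_cancel₀ hk0 ?_
      rw [taylorCoeff_of_mul_deriv_eq hs h, taylorCoeff_of_mul_deriv_eq ht h']
      split_ifs with hnk
      · rw [ih (k - n) (by omega)]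
      · rfl

theorem mem_ball_mul_pow {c : ℂ} (hc : ‖c‖ = 1) {n : ℕ} (hn : 1 ≤ n) {z : ℂ}
    (hz : z ∈ Metric.ball (0 : ℂ) 1) : c * z ^ n ∈ Metric.ball (0 : ℂ) 1 := by
  rw [mem_ball_zero_iff] at hz ⊢
  rw [norm_mul, hc, one_mul, norm_pow]
  exact pow_lt_one₀ (norm_nonneg _) hz (by omega)

theorem hasDerivAt_one_sub_mul_pow_cpow {c : ℂ} (hc : ‖c‖ = 1) {n : ℕ} (hn : 1 ≤ n) (γ : ℂ) {z : ℂ}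
    (hz : z ∈ Metric.ball (0 : ℂ) 1) :
    HasDerivAt (fun z => (1 - c * z ^ n) ^ γ)
      (γ * (1 - c * z ^ n) ^ (γ - 1) * -(c * (n * z ^ (n - 1)))) z := by
  have h1 : HasDerivAt (fun z : ℂ => 1 - c * z ^ n) (-(c * (n * z ^ (n - 1)))) z := by
    simpa using ((hasDerivAt_pow n z).const_mul c).const_sub 1
  exact h1.cpow_const (Or.inl (one_sub_re_pos (mem_ball_mul_pow hc hn hz)))

/-- With w = c z^n and s = (1 - w)^(β/n) one has (1 - w) z s' = -β w s. -/
theorem mul_deriv_one_sub_mul_pow_cpow {c : ℂ} (hc : ‖c‖ = 1) {n : ℕ} (hn : 1 ≤ n) (β : ℂ) :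
    EqOn (fun z => z * deriv (fun z => (1 - c * z ^ n) ^ (β / n)) z)
      (fun z => c * (z ^ n * (z * deriv (fun z => (1 - c * z ^ n) ^ (β / n)) z -
        β * (1 - c * z ^ n) ^ (β / n)))) (Metric.ball 0 1) := fun z hz => by
  have h0 := one_sub_ne_zero_of_mem_ball (mem_ball_mul_pow hc hn hz)
  have hn0 : (n : ℂ) ≠ 0 := by exact_mod_cast (by omega : n ≠ 0)
  simp only [(hasDerivAt_one_sub_mul_pow_cpow hc hn (β / n) hz).deriv]
  rw [Complex.cpow_sub _ _ h0, Complex.cpow_one]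
  obtain ⟨m, rfl⟩ : ∃ m, n = m + 1 := ⟨n - 1, by omega⟩
  rw [Nat.add_sub_cancel]
  field_simp
  ring

theorem differentiableOn_one_sub_mul_pow_cpow {c : ℂ} (hc : ‖c‖ = 1) {n : ℕ} (hn : 1 ≤ n) (γ : ℂ) :
    DifferentiableOn ℂ (fun z => (1 - c * z ^ n) ^ γ) (Metric.ball 0 1) := fun _ hz =>
  (hasDerivAt_one_sub_mul_pow_cpow hc hn γ hz).differentiableAt.differentiableWithinAt

theorem norm_taylorCoeff_one_sub_mul_pow_cpow {c : ℂ} (hc : ‖c‖ = 1) {n : ℕ} (hn : 1 ≤ n) {β : ℝ}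
    (hβ : 0 < β) : ‖taylorCoeff (fun z => (1 - c * z ^ n) ^ ((β : ℂ) / n)) n‖ = β / n := by
  have h := congrArg norm (taylorCoeff_of_mul_deriv_eq
    (differentiableOn_one_sub_mul_pow_cpow hc hn _) (mul_deriv_one_sub_mul_pow_cpow hc hn β) n)
  have hn0 : (0 : ℝ) < n := by exact_mod_cast hn
  rw [eq_div_iff hn0.ne', mul_comm]
  simpa [taylorCoeff_zero, hc, abs_of_pos hβ, zero_pow (by omega : n ≠ 0)] using h

namespace HasLogDerivBound

theorem norm_taylorCoeff_eq_iff {β : ℝ} {s : ℂ → ℂ} (h : HasLogDerivBound β s) (hβ : 0 < β)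
    (hβ' : β ≤ 1) {n : ℕ} (hn : 1 ≤ n) :
    ‖taylorCoeff s n‖ = β / n ↔
      ∃ c : ℂ, ‖c‖ = 1 ∧ EqOn s (fun z => (1 - c * z ^ n) ^ ((β : ℂ) / n)) (Metric.ball 0 1) := by
  refine ⟨fun heq => ?_, fun ⟨c, hc, hs⟩ => ?_⟩
  · obtain ⟨c, hc, hω⟩ := h.schwarzQuotient_eq_of_norm_eq hβ hβ' hn heq
    refine ⟨c, hc, eqOn_of_mul_deriv_eq h.differentiableOn
      (differentiableOn_one_sub_mul_pow_cpow hc hn _) hn (c := c) (β := β) (fun z hz => ?_)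
      (mul_deriv_one_sub_mul_pow_cpow hc hn β) ?_⟩
    · have h1 := h.schwarzQuotient_mul hβ hz
      simp only [hω hz] at h1
      simp only [← mul_assoc] at h1 ⊢
      exact h1.symm
    · simp [h.map_zero, zero_pow (by omega : n ≠ 0)]
  · rw [taylorCoeff_congr_ball hs, norm_taylorCoeff_one_sub_mul_pow_cpow hc hn hβ]

end HasLogDerivBound

/-! ### Coefficient formulas and bounds for concave functions. -/

/-- Cauchy product of the binomial series of (1 - z)^(α+1) with f', reflected so that k indexes the
coefficient of f'. -/
theorem taylorCoeff_concaveFactor {α : ℝ} {f : ℂ → ℂ} (hf : DifferentiableOn ℂ f (Metric.ball 0 1))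
    (n : ℕ) : taylorCoeff (concaveFactor α f) n = (-1) ^ n * concaveCoeffSum α f n := by
  have h1 : AnalyticAt ℂ (fun z : ℂ => (1 - z) ^ (((α + 1 : ℝ) : ℂ))) 0 := by
    refine analyticAt_zero_of_differentiableOn fun z hz => ?_
    have := hasDerivAt_one_sub_mul_pow_cpow (c := 1) (by simp) (le_refl 1) ((α + 1 : ℝ) : ℂ) hz
    simp only [one_mul, pow_one] at this
    exact this.differentiableAt.differentiableWithinAt
  have h2 := taylorCoeff_mul h1
    (analyticAt_zero_of_differentiableOn (differentiableOn_deriv_ball hf)) n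
  have h3 : (fun z => (1 - z) ^ (((α + 1 : ℝ) : ℂ)) * deriv f z) = concaveFactor α f := by
    funext z; rw [concaveFactor]; push_cast; rfl
  rw [← h3, h2, ← Finset.sum_range_reflect, concaveCoeffSum, Finset.mul_sum]
  refine Finset.sum_congr rfl fun k hk => ?_
  have hk' : k ≤ n := Nat.lt_succ_iff.1 (Finset.mem_range.1 hk)
  rw [show n + 1 - 1 - k = n - k by omega, show n - (n - k) = k by omega,
    taylorCoeff_one_sub_cpow, taylorCoeff_deriv]
  have h4 : (-1 : ℂ) ^ n * (-1) ^ k = (-1) ^ (n - k) := by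
    conv_lhs => rw [show n = (n - k) + k by omega, pow_add, mul_assoc, ← mul_pow]
    simp
  rw [← h4]
  ring

theorem Ring.choose_two_real (x : ℝ) : Ring.choose x 2 = x * (x - 1) / 2 := by
  have h := Ring.descPochhammer_eq_factorial_smul_choose x 2
  simp [descPochhammer_succ_right, Polynomial.smeval_sub, Polynomial.smeval_mul] at h
  linarith

theorem exists_exp_mul_I_eq {c : ℂ} (hc : ‖c‖ = 1) :
    ∃ θ : ℝ, Complex.exp ((θ : ℂ) * Complex.I) = c :=
  ⟨c.arg, by simpa [hc] using Complex.norm_mul_exp_arg_mul_I c⟩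

theorem one_sub_cpow_ne_zero {z : ℂ} (hz : z ∈ Metric.ball (0 : ℂ) 1) (a : ℂ) :
    (1 - z) ^ a ≠ 0 := fun h =>
  one_sub_ne_zero_of_mem_ball hz ((Complex.cpow_eq_zero_iff _ _).1 h).1

namespace IsConcaveUnivalent

variable {α : ℝ} {f : ℂ → ℂ}

theorem hasLogDerivBound (hf : IsConcaveUnivalent α f) (hα : 1 < α) :
    HasLogDerivBound (α - 1) (concaveFactor α f) where
  differentiableOn := fun _ hz =>
    (hasDerivAt_concaveFactor hf.differentiableOn hz).differentiableAt.differentiableWithinAt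
  map_zero := by simp [concaveFactor, hf.deriv_zero]
  ne_zero := fun _ hz => hf.concaveFactor_ne_zero hz
  re_le := fun _ hz => hf.re_mul_deriv_div_le hα hz

theorem norm_concaveCoeffSum (hf : IsConcaveUnivalent α f) (n : ℕ) :
    ‖concaveCoeffSum α f n‖ = ‖taylorCoeff (concaveFactor α f) n‖ := by
  rw [taylorCoeff_concaveFactor hf.differentiableOn, norm_mul, norm_pow, norm_neg, norm_one,
    one_pow, one_mul]

theorem norm_concaveCoeffSum_le (hf : IsConcaveUnivalent α f) (hα : 1 < α) (hα' : α ≤ 2) {n : ℕ}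
    (hn : 1 ≤ n) : ‖concaveCoeffSum α f n‖ ≤ (α - 1) / n :=
  (hf.norm_concaveCoeffSum n).trans_le
    ((hf.hasLogDerivBound hα).norm_taylorCoeff_le (by linarith) (by linarith) hn)

theorem norm_concaveCoeffSum_eq_iff (hf : IsConcaveUnivalent α f) (hα : 1 < α) (hα' : α ≤ 2)
    {n : ℕ} (hn : 1 ≤ n) : ‖concaveCoeffSum α f n‖ = (α - 1) / n ↔
      ∃ θ : ℝ, ∀ z ∈ Metric.ball (0 : ℂ) 1, deriv f z = extremalDeriv α n θ z := by
  rw [hf.norm_concaveCoeffSum, (hf.hasLogDerivBound hα).norm_taylorCoeff_eq_iff (by linarith)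
    (by linarith) hn]
  have key : ∀ θ : ℝ, EqOn (concaveFactor α f) (fun z =>
      (1 - Complex.exp ((θ : ℂ) * Complex.I) * z ^ n) ^ (((α - 1 : ℝ) : ℂ) / n)) (Metric.ball 0 1) ↔
      ∀ z ∈ Metric.ball (0 : ℂ) 1, deriv f z = extremalDeriv α n θ z := fun θ => by
    refine forall₂_congr fun z hz => ?_
    rw [concaveFactor, extremalDeriv, eq_div_iff (one_sub_cpow_ne_zero hz _), mul_comm]
    push_cast
    rfl
  refine ⟨fun ⟨c, hc, h⟩ => ?_, fun ⟨θ, h⟩ => ⟨_, Complex.norm_exp_ofReal_mul_I θ, (key θ).2 h⟩⟩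
  obtain ⟨θ, rfl⟩ := exists_exp_mul_I_eq hc
  exact ⟨θ, (key θ).1 h⟩

theorem taylorCoeff_one (hf : IsConcaveUnivalent α f) : taylorCoeff f 1 = 1 := by
  simp [taylorCoeff, hf.deriv_zero]

theorem norm_taylorCoeff_two_sub_le (hf : IsConcaveUnivalent α f) (hα : 1 < α) (hα' : α ≤ 2) :
    ‖taylorCoeff f 2 - ((α : ℂ) + 1) / 2‖ ≤ (α - 1) / 2 := by
  have h := hf.norm_concaveCoeffSum_le hα hα' (le_refl 1)
  -- As a_1 = 1, the sum is α + 1 - 2a_2; the factor 2 halves the bound (α - 1)/1.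
  have h1 : concaveCoeffSum α f 1 = -2 * (taylorCoeff f 2 - ((α : ℂ) + 1) / 2) := by
    simp [concaveCoeffSum, Finset.sum_range_succ, hf.taylorCoeff_one]
    ring
  rw [h1, norm_mul] at h
  norm_num at h
  linarith

theorem norm_taylorCoeff_three_sub_le (hf : IsConcaveUnivalent α f) (hα : 1 < α) (hα' : α ≤ 2) :
    ‖3 * taylorCoeff f 3 - 2 * ((α : ℂ) + 1) * taylorCoeff f 2
        + (α : ℂ) * ((α : ℂ) + 1) / 2‖ ≤ (α - 1) / 2 := by
  have h := hf.norm_concaveCoeffSum_le hα hα' one_le_two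
  have h1 : concaveCoeffSum α f 2 = 3 * taylorCoeff f 3 - 2 * ((α : ℂ) + 1) * taylorCoeff f 2
        + (α : ℂ) * ((α : ℂ) + 1) / 2 := by
    simp [concaveCoeffSum, Finset.sum_range_succ, hf.taylorCoeff_one,
      Ring.choose_two_real]
    ring
  rw [h1] at h
  exact_mod_cast h

end IsConcaveUnivalent

/-! ### Sharpness: injectivity and growth of primitives. -/

/-- A primitive `F` of `exp h` on the right half-plane, where `Re h' ≥ 0` and `h` is asymptotic to
`b Log v + κ` at infinity. -/
structure IsConcavePrimitive (F h : ℂ → ℂ) (b : ℝ) (κ : ℂ) : Prop where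
  hasDerivAt : ∀ v ∈ rightHalfPlane, HasDerivAt F (Complex.exp (h v)) v
  differentiableOn : DifferentiableOn ℂ h rightHalfPlane
  re_deriv_nonneg : ∀ v ∈ rightHalfPlane, 0 ≤ (deriv h v).re
  tendsto : Tendsto (fun v => h v - b * Complex.log v) (cobounded ℂ ⊓ 𝓟 rightHalfPlane) (𝓝 κ)
  nonneg : 0 ≤ b
  le_one : b ≤ 1

theorem ne_zero_of_mem_rightHalfPlane {v : ℂ} (hv : v ∈ rightHalfPlane) : v ≠ 0 := by
  rintro rfl
  exact lt_irrefl _ (mem_rightHalfPlane.1 hv)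

theorem abs_arg_le_of_mem_rightHalfPlane {v : ℂ} (hv : v ∈ rightHalfPlane) :
    |v.arg| ≤ Real.pi / 2 :=
  Complex.abs_arg_le_pi_div_two_iff.2 (le_of_lt hv)

theorem tendsto_add_ofReal_mul_I {v : ℂ} (hv : v ∈ rightHalfPlane) {c : ℝ} (hc : c ≠ 0) :
    Tendsto (fun y : ℝ => v + ((c * y : ℝ) : ℂ) * Complex.I) atTop
      (cobounded ℂ ⊓ 𝓟 rightHalfPlane) := by
  refine tendsto_inf.2 ⟨?_, tendsto_principal.2 (Eventually.of_forall fun y => ?_)⟩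
  · have h1 := (tendsto_mul_left_cobounded (a := (c : ℂ) * Complex.I)
      (mul_ne_zero (by exact_mod_cast hc) Complex.I_ne_zero)).comp
      (RCLike.tendsto_ofReal_atTop_cobounded ℂ)
    refine ((tendsto_const_add_cobounded v).comp h1).congr fun y => ?_
    simp [mul_comm, mul_left_comm]
  · have : 0 < v.re := hv
    rw [mem_rightHalfPlane]
    simpa using this

namespace IsConcavePrimitive

variable {F h : ℂ → ℂ} {b : ℝ} {κ : ℂ}

/-- Im h grows along the upward vertical line through v, and far up it is close to Im κ + b arg,
with arg at most π/2. -/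
theorem im_le (H : IsConcavePrimitive F h b κ) {v : ℂ} (hv : v ∈ rightHalfPlane) :
    (h v).im ≤ κ.im + b * (Real.pi / 2) := by
  have h1 := H.tendsto.comp (tendsto_add_ofReal_mul_I hv one_ne_zero)
  have h2 := ((Complex.continuous_im.tendsto κ).comp h1).add_const (b * (Real.pi / 2))
  refine ge_of_tendsto h2 ((eventually_ge_atTop 0).mono fun y hy => ?_)
  have h3 := im_le_im_add_mul_I H.differentiableOn H.re_deriv_nonneg hv hy
  have hw : v + y * Complex.I ∈ rightHalfPlane := by
    have : 0 < v.re := hv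
    rw [mem_rightHalfPlane]; simpa using this
  have h4 := mul_le_mul_of_nonneg_left (abs_le.1 (abs_arg_le_of_mem_rightHalfPlane hw)).2 H.nonneg
  simp [Complex.log_im] at h4 ⊢
  linarith

theorem le_im (H : IsConcavePrimitive F h b κ) {v : ℂ} (hv : v ∈ rightHalfPlane) :
    κ.im - b * (Real.pi / 2) ≤ (h v).im := by
  have h1 := H.tendsto.comp (tendsto_add_ofReal_mul_I hv (neg_ne_zero.2 one_ne_zero))
  have h2 := ((Complex.continuous_im.tendsto κ).comp h1).sub_const (b * (Real.pi / 2))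
  refine le_of_tendsto h2 ((eventually_ge_atTop 0).mono fun y hy => ?_)
  have hw : v + ((-1 * y : ℝ) : ℂ) * Complex.I ∈ rightHalfPlane := by
    have : 0 < v.re := hv
    rw [mem_rightHalfPlane]; simpa using this
  have h3 := im_le_im_add_mul_I H.differentiableOn H.re_deriv_nonneg hw hy
  rw [show v + ((-1 * y : ℝ) : ℂ) * Complex.I + y * Complex.I = v by push_cast; ring] at h3
  have h4 := mul_le_mul_of_nonneg_left (abs_le.1 (abs_arg_le_of_mem_rightHalfPlane hw)).1 H.nonneg
  simp [Complex.log_im] at h3 h4 ⊢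
  linarith

theorem abs_im_sub_le (H : IsConcavePrimitive F h b κ) {v : ℂ} (hv : v ∈ rightHalfPlane) :
    |(h v).im - κ.im| ≤ b * (Real.pi / 2) :=
  abs_le.2 ⟨by linarith [H.le_im hv], by linarith [H.im_le hv]⟩

/-- For b < 1 this is clear. In general, equality would be an interior extremum of Im h, which the
open mapping theorem excludes unless h is constant; a constant h cannot behave like b Log v with b ≠
0. -/
theorem abs_im_sub_lt (H : IsConcavePrimitive F h b κ) {v : ℂ} (hv : v ∈ rightHalfPlane) :
    |(h v).im - κ.im| < Real.pi / 2 := by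
  have hb : b * (Real.pi / 2) ≤ Real.pi / 2 :=
    mul_le_of_le_one_left (by positivity) H.le_one
  refine lt_of_le_of_ne ((H.abs_im_sub_le hv).trans hb) fun heq => ?_
  have hb1 : b ≠ 0 := fun h0 => by
    have := H.abs_im_sub_le hv
    rw [heq, h0] at this
    linarith [Real.pi_pos]
  have hbound : ∀ w ∈ rightHalfPlane, |(h w).im - κ.im| ≤ Real.pi / 2 := fun w hw =>
    (H.abs_im_sub_le hw).trans hb
  rcases (H.differentiableOn.analyticOnNhd isOpen_rightHalfPlane).is_constant_or_isOpen
    isPreconnected_rightHalfPlane with ⟨w, hw⟩ | hopen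
  · refine (hb1 ?_).elim
    have h1 : κ.im - b * (Real.pi / 2) ≤ w.im ∧ w.im ≤ κ.im + b * (Real.pi / 2) := by
      rw [← hw v hv]; exact ⟨H.le_im hv, H.im_le hv⟩
    have t1 := (Complex.continuous_im.tendsto κ).comp
      (H.tendsto.comp (tendsto_add_ofReal_mul_I hv one_ne_zero))
    have t2 := (Complex.continuous_re.tendsto κ).comp
      (H.tendsto.comp (tendsto_add_ofReal_mul_I hv one_ne_zero))
    have t3 : Tendsto (fun y : ℝ => b * Real.log ‖v + ((1 * y : ℝ) : ℂ) * Complex.I‖) atTop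
        (𝓝 (w.re - κ.re)) := by
      refine (t2.const_sub w.re).congr fun y => ?_
      have hm : v + ((1 * y : ℝ) : ℂ) * Complex.I ∈ rightHalfPlane := by
        have : 0 < v.re := hv
        rw [mem_rightHalfPlane]; simpa using this
      simp only [Function.comp_apply, hw _ hm, Complex.sub_re, Complex.re_ofReal_mul,
        Complex.log_re]
      ring
    by_contra hb0
    have hbpos : 0 < b := lt_of_le_of_ne H.nonneg (Ne.symm hb0)
    have t4 : Tendsto (fun y : ℝ => b * Real.log ‖v + ((1 * y : ℝ) : ℂ) * Complex.I‖) atTop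
        atTop := Tendsto.const_mul_atTop hbpos (Real.tendsto_log_atTop.comp
          (tendsto_norm_cobounded_atTop.comp
            (tendsto_inf.1 (tendsto_add_ofReal_mul_I hv one_ne_zero)).1))
    exact not_tendsto_nhds_of_tendsto_atTop t4 _ t3
  · have ho := hopen rightHalfPlane Subset.rfl isOpen_rightHalfPlane
    obtain ⟨ε, hε, hsub⟩ := Metric.isOpen_iff.1 ho (h v) (mem_image_of_mem h hv)
    have key : ∀ c : ℝ, |c| < ε → |(h v).im + c - κ.im| ≤ Real.pi / 2 := fun c hc => by
      obtain ⟨w, hw, hwe⟩ := hsub (show h v + c * Complex.I ∈ Metric.ball (h v) ε by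
        rw [Metric.mem_ball, dist_eq_norm]; simpa using hc)
      have := hbound w hw
      rwa [hwe, show (h v + c * Complex.I).im = (h v).im + c by simp] at this
    have k1 := abs_le.1 (key (ε / 2) (by rw [abs_of_pos] <;> linarith))
    have k2 := abs_le.1 (key (-(ε / 2)) (by rw [abs_neg, abs_of_pos] <;> linarith))
    rcases abs_eq (by positivity : 0 ≤ Real.pi / 2) |>.1 heq with h1 | h1 <;> linarith [k1.1, k1.2, k2.1, k2.2]

theorem re_exp_mul_pos (H : IsConcavePrimitive F h b κ) {v : ℂ} (hv : v ∈ rightHalfPlane) :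
    0 < (Complex.exp (-(κ.im * Complex.I)) * Complex.exp (h v)).re := by
  rw [← Complex.exp_add, Complex.exp_re]
  refine mul_pos (Real.exp_pos _) (Real.cos_pos_of_mem_Ioo ?_)
  have := abs_lt.1 (H.abs_im_sub_lt hv)
  simp
  constructor <;> linarith

theorem hasDerivAt_segment (H : IsConcavePrimitive F h b κ) {u v : ℂ} {t : ℝ}
    (hm : u + t * v ∈ rightHalfPlane) :
    HasDerivAt (fun t : ℝ => F (u + t * v)) (Complex.exp (h (u + t * v)) * v) t := by
  have h1 : HasDerivAt (fun z : ℂ => u + z * v) v (t : ℂ) := by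
    simpa using ((hasDerivAt_id (t : ℂ)).mul_const v).const_add u
  have h2 : HasDerivAt (F ∘ fun z : ℂ => u + z * v) (Complex.exp (h (u + t * v)) * v) (t : ℂ) :=
    HasDerivAt.comp (h₂ := F) (h := fun z : ℂ => u + z * v) (t : ℂ) (H.hasDerivAt _ hm) h1
  simpa [Function.comp_def] using h2.comp_ofReal

/-- Noshiro–Warschawski: a fixed rotation of F' has positive real part, so the real part of a
multiple of F increases strictly along the segment. -/
theorem injOn (H : IsConcavePrimitive F h b κ) : InjOn F rightHalfPlane := by
  intro u hu v hv huv
  by_contra hne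
  have hne' : v - u ≠ 0 := sub_ne_zero.2 (Ne.symm hne)
  have hm : ∀ t ∈ Icc (0 : ℝ) 1, u + t * (v - u) ∈ rightHalfPlane := fun t ht => by
    have := convex_rightHalfPlane.add_smul_sub_mem hu hv ht
    simpa using this
  set e : ℂ := Complex.exp (-(κ.im * Complex.I)) / (v - u)
  have hd : ∀ t ∈ Icc (0 : ℝ) 1, HasDerivAt (fun t : ℝ => (e * F (u + t * (v - u))).re)
      (Complex.exp (-(κ.im * Complex.I)) * Complex.exp (h (u + t * (v - u)))).re t := fun t ht => by
    refine (hasDerivAt_re ((H.hasDerivAt_segment (hm t ht)).const_mul e)).congr_deriv ?_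
    congr 1
    simp only [e]
    field_simp
  have hmono := strictMonoOn_of_deriv_pos (convex_Icc (0 : ℝ) 1)
    (f := fun t : ℝ => (e * F (u + t * (v - u))).re)
    (fun t ht => (hd t ht).continuousAt.continuousWithinAt) fun t ht => by
      rw [interior_Icc] at ht
      rw [(hd t ⟨ht.1.le, ht.2.le⟩).deriv]
      exact H.re_exp_mul_pos (hm t ⟨ht.1.le, ht.2.le⟩)
  have := hmono (left_mem_Icc.2 zero_le_one) (right_mem_Icc.2 zero_le_one) zero_lt_one
  simp [huv] at this

end IsConcavePrimitive

theorem eventually_cobounded_inf_iff {p : ℂ → Prop} :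
    (∀ᶠ v in cobounded ℂ ⊓ 𝓟 rightHalfPlane, p v) ↔
      ∃ R : ℝ, ∀ v ∈ rightHalfPlane, R ≤ ‖v‖ → p v := by
  rw [eventually_inf_principal, ← comap_norm_atTop, eventually_comap]
  refine ⟨fun h => ?_, fun ⟨R, hR⟩ => ?_⟩
  · obtain ⟨R, hR⟩ := eventually_atTop.1 h
    exact ⟨R, fun v hv hvR => hR _ hvR v rfl hv⟩
  · filter_upwards [eventually_ge_atTop R] with x hx v hvx hv
    exact hR v hv (hvx ▸ hx)

theorem abs_im_exp_sub_one_le {d : ℂ} {ε : ℝ} (hd : ‖d‖ ≤ ε / 16) (hε : ε ≤ 1) :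
    7 / 8 ≤ (Complex.exp d).re ∧ |(Complex.exp d).im| ≤ ε / 8 := by
  have h1 := Complex.norm_exp_sub_one_le (x := d) (by linarith)
  have h2 := (Complex.abs_re_le_norm (Complex.exp d - 1)).trans h1
  have h3 := (Complex.abs_im_le_norm (Complex.exp d - 1)).trans h1
  simp at h2 h3
  exact ⟨by linarith [(abs_le.1 h2).1], by linarith⟩

namespace IsConcavePrimitive

variable {F h : ℂ → ℂ} {b : ℝ} {κ : ℂ}

theorem exists_norm_sub_le (H : IsConcavePrimitive F h b κ) {δ : ℝ} (hδ : 0 < δ) :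
    ∃ R : ℝ, 1 ≤ R ∧ ∀ v ∈ rightHalfPlane, R ≤ ‖v‖ → ‖h v - b * Complex.log v - κ‖ ≤ δ := by
  obtain ⟨R, hR⟩ := eventually_cobounded_inf_iff.1
    (H.tendsto.eventually (Metric.closedBall_mem_nhds κ hδ))
  exact ⟨max R 1, le_max_right _ _, fun v hv hvR => by
    simpa [dist_eq_norm] using hR v hv ((le_max_left _ _).trans hvR)⟩

theorem re_le_re_add (H : IsConcavePrimitive F h b κ) {v : ℂ} (hv : v ∈ rightHalfPlane) {S : ℝ}
    (hS : 0 ≤ S) : (h v).re ≤ (h (v + S)).re := by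
  have hm : ∀ t : ℝ, 0 ≤ t → v + t ∈ rightHalfPlane := fun t ht => by
    have : 0 < v.re := hv
    rw [mem_rightHalfPlane]; simp; linarith
  have hd : ∀ t : ℝ, 0 ≤ t → HasDerivAt (fun t : ℝ => (h (v + t)).re) (deriv h (v + t)).re t :=
    fun t ht => by
      have h1 : HasDerivAt (fun z : ℂ => v + z) 1 (t : ℂ) := by
        simpa using (hasDerivAt_id (t : ℂ)).const_add v
      have h2 := ((H.differentiableOn.differentiableAt
        (isOpen_rightHalfPlane.mem_nhds (hm t ht))).hasDerivAt)
      have h3 := (HasDerivAt.comp (h₂ := h) (h := fun z : ℂ => v + z) (t : ℂ) h2 h1).comp_ofReal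
      simpa [Function.comp_def] using hasDerivAt_re h3
  have hmono := monotoneOn_of_deriv_nonneg (convex_Ici (0 : ℝ)) (f := fun t : ℝ => (h (v + t)).re)
    (fun t ht => (hd t ht).continuousAt.continuousWithinAt)
    (fun t ht => (hd t (interior_subset ht)).differentiableAt.differentiableWithinAt)
    fun t ht => by
      rw [(hd t (interior_subset ht)).deriv]
      exact H.re_deriv_nonneg _ (hm t (interior_subset ht))
  simpa using hmono (mem_Ici.2 le_rfl) (mem_Ici.2 hS) hS

/-- Re h increases to the right, so it suffices to bound it after a shift by S, which leads to where
h is within 1 of b Log v + κ. -/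
theorem exists_norm_exp_le (H : IsConcavePrimitive F h b κ) (R : ℝ) :
    ∃ C : ℝ, 0 ≤ C ∧ ∀ v ∈ rightHalfPlane, ‖v‖ ≤ R → ‖Complex.exp (h v)‖ ≤ C := by
  obtain ⟨S, hS1, hS⟩ := H.exists_norm_sub_le one_pos
  refine ⟨Real.exp (κ.re + 1 + (R + S)), (Real.exp_pos _).le, fun v hv hvR => ?_⟩
  rw [Complex.norm_exp]
  refine Real.exp_le_exp.2 ((H.re_le_re_add hv (by linarith : 0 ≤ S)).trans ?_)
  have hre : 0 < v.re := hv
  have hw : v + S ∈ rightHalfPlane := by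
    rw [mem_rightHalfPlane]; simp; linarith
  have hge : S ≤ ‖v + S‖ := by
    refine le_trans ?_ (Complex.re_le_norm (v + S))
    simp; linarith
  have h1 := (Complex.re_le_norm _).trans (hS _ hw hge)
  have hle : ‖v + S‖ ≤ R + S := (norm_add_le _ _).trans (by
    rw [Complex.norm_real, Real.norm_of_nonneg (by linarith)]; linarith)
  have hlog : b * Real.log ‖v + S‖ ≤ R + S := by
    have h0 : 0 ≤ Real.log ‖v + S‖ := Real.log_nonneg (by linarith)
    have h2 : Real.log ‖v + S‖ ≤ ‖v + S‖ := Real.log_le_self (norm_nonneg _)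
    calc b * Real.log ‖v + S‖ ≤ 1 * Real.log ‖v + S‖ :=
          mul_le_mul_of_nonneg_right H.le_one h0
      _ ≤ R + S := by linarith
  simp only [Complex.sub_re, Complex.re_ofReal_mul, Complex.log_re] at h1
  linarith

theorem exists_norm_le (H : IsConcavePrimitive F h b κ) (R : ℝ) :
    ∃ M : ℝ, 0 ≤ M ∧ ∀ v ∈ rightHalfPlane, ‖v‖ ≤ R → ‖F v‖ ≤ M := by
  set R' := max R 1
  obtain ⟨C, hC0, hC⟩ := H.exists_norm_exp_le R'
  have hR' : 0 ≤ R' := zero_le_one.trans (le_max_right _ _)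
  refine ⟨‖F 1‖ + C * (R' + 1), by positivity, fun v hv hvR => ?_⟩
  have hconv : Convex ℝ (rightHalfPlane ∩ Metric.closedBall 0 R') :=
    convex_rightHalfPlane.inter (convex_closedBall _ _)
  have h1 := hconv.norm_image_sub_le_of_norm_hasDerivWithin_le (f := F)
    (f' := fun v => Complex.exp (h v)) (C := C)
    (fun w hw => (H.hasDerivAt w hw.1).hasDerivWithinAt)
    (fun w hw => hC w hw.1 (by simpa using hw.2)) (x := 1) (y := v)
    ⟨by simp [mem_rightHalfPlane], by simp [R']⟩
    ⟨hv, mem_closedBall_zero_iff.2 (hvR.trans (le_max_left _ _))⟩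
  have h2 : ‖v - 1‖ ≤ R' + 1 := (norm_sub_le _ _).trans (by
    rw [norm_one]; linarith [hvR.trans (le_max_left R 1)])
  have h3 := norm_le_insert' (F v) (F 1)
  have h4 := mul_le_mul_of_nonneg_left h2 hC0
  linarith

theorem exists_le_norm_exp (H : IsConcavePrimitive F h b κ) :
    ∃ c > 0, ∃ R : ℝ, ∀ v ∈ rightHalfPlane, R ≤ ‖v‖ → c ≤ ‖Complex.exp (h v)‖ := by
  obtain ⟨S, hS1, hS⟩ := H.exists_norm_sub_le one_pos
  refine ⟨Real.exp (κ.re - 1), Real.exp_pos _, S, fun v hv hvS => ?_⟩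
  rw [Complex.norm_exp]
  refine Real.exp_le_exp.2 ?_
  have h1 := (abs_le.1 ((Complex.abs_re_le_norm _).trans (hS _ hv hvS))).1
  have h2 : 0 ≤ b * Real.log ‖v‖ := mul_nonneg H.nonneg (Real.log_nonneg (by linarith))
  simp only [Complex.sub_re, Complex.re_ofReal_mul, Complex.log_re] at h1
  linarith

/-- Comparison of `exp (h (t v))`, `t ≤ 1`, with `exp (h v)`. -/
theorem exp_sub_eq (H : IsConcavePrimitive F h b κ) {ε R : ℝ} (hε : ε ≤ 1)
    (hR : ∀ v ∈ rightHalfPlane, R ≤ ‖v‖ → ‖h v - b * Complex.log v - κ‖ ≤ ε / 32) {v : ℂ}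
    (hv : v ∈ rightHalfPlane) {t : ℝ} (ht : 0 < t) (ht1 : t ≤ 1) (htR : R ≤ t * ‖v‖) :
    ∃ ρ : ℝ, t ≤ ρ ∧ ∃ e : ℂ, Complex.exp (h (t * v)) / Complex.exp (h v) = ρ * e ∧
      7 / 8 ≤ e.re ∧ |e.im| ≤ ε / 8 := by
  have hn := norm_nonneg v
  have htv : (t : ℂ) * v ∈ rightHalfPlane := by
    rw [mem_rightHalfPlane, Complex.re_ofReal_mul]; exact mul_pos ht hv
  have hnt : ‖(t : ℂ) * v‖ = t * ‖v‖ := by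
    rw [norm_mul, Complex.norm_real, Real.norm_of_nonneg ht.le]
  have h1 := hR v hv (htR.trans (mul_le_of_le_one_left hn ht1))
  have h2 := hR _ htv (hnt ▸ htR)
  set d := (h (t * v) - b * Complex.log (t * v) - κ) - (h v - b * Complex.log v - κ) with hd
  have h3 : ‖d‖ ≤ ε / 16 := (norm_sub_le _ _).trans (by linarith)
  -- ρ = t^b, which is at least t because t ≤ 1 and b ≤ 1; e is the exponential of a difference of
  -- two error terms.
  refine ⟨Real.exp (b * Real.log t), ?_, Complex.exp d, ?_, abs_im_exp_sub_one_le h3 hε⟩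
  · have h4 : Real.log t ≤ b * Real.log t := by
      have := Real.log_nonpos ht.le ht1
      nlinarith [H.le_one]
    calc t = Real.exp (Real.log t) := (Real.exp_log ht).symm
      _ ≤ _ := Real.exp_le_exp.2 h4
  · rw [← Complex.exp_sub, Complex.ofReal_exp, ← Complex.exp_add]
    congr 1
    rw [hd, Complex.log_ofReal_mul ht (ne_zero_of_mem_rightHalfPlane hv)]
    push_cast
    ring

/-- Near infinity, `F v / (v F' v)` has almost positive values. -/
theorem exists_div_bounds (H : IsConcavePrimitive F h b κ) {ε : ℝ} (hε0 : 0 < ε) (hε : ε ≤ 1) :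
    ∃ R : ℝ, ∀ v ∈ rightHalfPlane, R ≤ ‖v‖ →
      1 / 16 ≤ (F v / (v * Complex.exp (h v))).re ∧
      |(F v / (v * Complex.exp (h v))).im| ≤ ε * (F v / (v * Complex.exp (h v))).re := by
  obtain ⟨R, hR1, hR⟩ := H.exists_norm_sub_le (by positivity : 0 < ε / 32)
  obtain ⟨M, hM0, hM⟩ := H.exists_norm_le R
  obtain ⟨c, hc0, S, hS⟩ := H.exists_le_norm_exp
  -- The bound 2R yields t₀ ≤ 1/2, S gives |F'| ≥ c, and the last bound makes |q t₀| ≤ ε/64.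
  refine ⟨max (max (2 * R) S) (64 * M / (c * ε)), fun v hv hvR => ?_⟩
  have hv2 : 2 * R ≤ ‖v‖ := (le_max_left _ _).trans ((le_max_left _ _).trans hvR)
  have hvS : S ≤ ‖v‖ := (le_max_right _ _).trans ((le_max_left _ _).trans hvR)
  have hvM : 64 * M / (c * ε) ≤ ‖v‖ := (le_max_right _ _).trans hvR
  have hv0 : 0 < ‖v‖ := by linarith
  have hvne : v ≠ 0 := norm_pos_iff.1 hv0
  set t₀ := R / ‖v‖ with ht₀
  have ht₀pos : 0 < t₀ := by positivity
  have ht₀half : t₀ ≤ 1 / 2 := by rw [ht₀, div_le_iff₀ hv0]; linarith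
  have hm : ∀ t : ℝ, 0 < t → (0 : ℂ) + t * v ∈ rightHalfPlane := fun t ht => by
    rw [zero_add, mem_rightHalfPlane, Complex.re_ofReal_mul]; exact mul_pos ht hv
  -- q' t = F'(tv)/F'(v) is close to a positive number that is at least t on [t₀, 1]. Integrating
  -- from the negligible q t₀ bounds Re q 1 below and Im q 1 by ε Re q 1.
  set q : ℝ → ℂ := fun t => F (0 + t * v) / (v * Complex.exp (h v)) with hq
  have hq1 : q 1 = F v / (v * Complex.exp (h v)) := by simp [hq]
  have hqd : ∀ t : ℝ, 0 < t → HasDerivAt q (Complex.exp (h (t * v)) / Complex.exp (h v)) t :=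
    fun t ht => by
      refine ((H.hasDerivAt_segment (hm t ht)).div_const _).congr_deriv ?_
      rw [zero_add]
      field_simp
  have hq0 : ‖q t₀‖ ≤ ε / 64 := by
    have h1 : ‖F (0 + t₀ * v)‖ ≤ M := by
      refine hM _ (hm _ ht₀pos) (le_of_eq ?_)
      rw [zero_add, norm_mul, Complex.norm_real, Real.norm_of_nonneg ht₀pos.le, ht₀,
        div_mul_cancel₀ _ hv0.ne']
    rw [hq, norm_div, norm_mul, div_le_iff₀ (mul_pos hv0 (by simp))]
    refine h1.trans ?_
    rw [div_le_iff₀ (by positivity)] at hvM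
    have := mul_le_mul_of_nonneg_left (hS v hv hvS) (by positivity : 0 ≤ ε * ‖v‖)
    nlinarith
  have hder : ∀ t ∈ Icc t₀ 1, ∃ ρ : ℝ, t ≤ ρ ∧ ∃ e : ℂ,
      Complex.exp (h (t * v)) / Complex.exp (h v) = ρ * e ∧ 7 / 8 ≤ e.re ∧ |e.im| ≤ ε / 8 :=
    fun t ht => H.exp_sub_eq hε hR hv (ht₀pos.trans_le ht.1) ht.2 (by
      have := mul_le_mul_of_nonneg_right ht.1 hv0.le
      rwa [ht₀, div_mul_cancel₀ _ hv0.ne'] at this)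
  have hmon : ∀ (g g' : ℝ → ℝ), (∀ t, 0 < t → HasDerivAt g (g' t) t) →
      (∀ t ∈ Icc t₀ 1, 0 ≤ g' t) → g t₀ ≤ g 1 := fun g g' hg hg' => by
    have := monotoneOn_of_deriv_nonneg (convex_Icc t₀ 1) (f := g)
      (fun t ht => (hg t (ht₀pos.trans_le ht.1)).continuousAt.continuousWithinAt)
      (fun t ht => (hg t (ht₀pos.trans_le (interior_subset ht).1)).differentiableAt.differentiableWithinAt)
      fun t ht => by
        rw [(hg t (ht₀pos.trans_le (interior_subset ht).1)).deriv]
        exact hg' t (interior_subset ht)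
    exact this ⟨le_rfl, by linarith⟩ ⟨by linarith, le_rfl⟩ (by linarith)
  have m1 := hmon (fun t => (q t).re - t ^ 2 / 4) _
    (fun t ht => (hasDerivAt_re (hqd t ht)).sub ((hasDerivAt_pow 2 t).div_const 4)) fun t ht => by
      obtain ⟨ρ, hρ, e, he, he1, he2⟩ := hder t ht
      rw [he, Complex.re_ofReal_mul]
      have ht0 : 0 < t := ht₀pos.trans_le ht.1
      norm_num
      nlinarith
  have m2 := hmon (fun t => ε / 2 * (q t).re + (q t).im) _
    (fun t ht => ((hasDerivAt_re (hqd t ht)).const_mul (ε / 2)).add (hasDerivAt_im (hqd t ht)))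
    fun t ht => by
      obtain ⟨ρ, hρ, e, he, he1, he2⟩ := hder t ht
      rw [he, Complex.re_ofReal_mul, Complex.im_ofReal_mul]
      have ht0 : 0 < t := ht₀pos.trans_le ht.1
      have : 0 ≤ ρ * (ε / 2 * e.re + e.im) := mul_nonneg (by linarith) (by
        nlinarith [(abs_le.1 he2).1])
      linarith
  have m3 := hmon (fun t => ε / 2 * (q t).re - (q t).im) _
    (fun t ht => ((hasDerivAt_re (hqd t ht)).const_mul (ε / 2)).sub (hasDerivAt_im (hqd t ht)))
    fun t ht => by
      obtain ⟨ρ, hρ, e, he, he1, he2⟩ := hder t ht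
      rw [he, Complex.re_ofReal_mul, Complex.im_ofReal_mul]
      have ht0 : 0 < t := ht₀pos.trans_le ht.1
      have : 0 ≤ ρ * (ε / 2 * e.re - e.im) := mul_nonneg (by linarith) (by
        nlinarith [(abs_le.1 he2).2])
      linarith
  rw [← hq1]
  have r1 := abs_le.1 ((Complex.abs_re_le_norm (q t₀)).trans hq0)
  have r2 := abs_le.1 ((Complex.abs_im_le_norm (q t₀)).trans hq0)
  have hre : 1 / 16 ≤ (q 1).re := by nlinarith
  refine ⟨hre, abs_le.2 ⟨?_, ?_⟩⟩ <;> nlinarith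

theorem exists_norm_ge (H : IsConcavePrimitive F h b κ) :
    ∃ R : ℝ, ∀ v ∈ rightHalfPlane, R ≤ ‖v‖ → ‖v‖ * ‖Complex.exp (h v)‖ / 16 ≤ ‖F v‖ := by
  obtain ⟨R, hR⟩ := H.exists_div_bounds one_pos le_rfl
  refine ⟨R, fun v hv hvR => ?_⟩
  have h1 := (hR v hv hvR).1.trans (Complex.re_le_norm _)
  rw [norm_div, norm_mul, le_div_iff₀ (mul_pos (norm_pos_iff.2 (ne_zero_of_mem_rightHalfPlane hv))
    (by simp))] at h1
  linarith

theorem tendsto_cobounded (H : IsConcavePrimitive F h b κ) :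
    Tendsto F (cobounded ℂ ⊓ 𝓟 rightHalfPlane) (cobounded ℂ) := by
  obtain ⟨R, hR⟩ := H.exists_norm_ge
  obtain ⟨c, hc0, S, hS⟩ := H.exists_le_norm_exp
  rw [← tendsto_norm_atTop_iff_cobounded]
  have h1 : Tendsto (fun v : ℂ => c / 16 * ‖v‖) (cobounded ℂ ⊓ 𝓟 rightHalfPlane) atTop :=
    (tendsto_norm_cobounded_atTop.const_mul_atTop (by positivity)).mono_left inf_le_left
  refine tendsto_atTop_mono' _ ?_ h1
  rw [EventuallyLE, eventually_cobounded_inf_iff]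
  refine ⟨max R S, fun v hv hvR => ?_⟩
  have h2 := hR v hv ((le_max_left _ _).trans hvR)
  have h3 := mul_le_mul_of_nonneg_left (hS v hv ((le_max_right _ _).trans hvR)) (norm_nonneg v)
  linarith

end IsConcavePrimitive

theorem inter_frontier_nonempty_of_isOpen {S U : Set ℂ} (hS : IsPreconnected S) (hU : IsOpen U)
    (h1 : (S ∩ U).Nonempty) (h2 : ¬S ⊆ U) : (S ∩ frontier U).Nonempty := by
  by_contra hne
  obtain ⟨x, hxS, hxU⟩ := not_subset.1 h2
  have key : ∀ y ∈ S, y ∉ U → y ∉ closure U := fun y hy hyU hyc =>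
    hne ⟨y, hy, hU.frontier_eq ▸ ⟨hyc, hyU⟩⟩
  obtain ⟨y, -, hy, hyc⟩ := hS U (closure U)ᶜ hU isClosed_closure.isOpen_compl
    (fun y hy => (em (y ∈ U)).imp_right (key y hy)) h1 ⟨x, hxS, key x hxS hxU⟩
  exact hyc (subset_closure hy)

namespace IsConcavePrimitive

variable {F h : ℂ → ℂ} {b : ℝ} {κ : ℂ}

/-! ### Sharpness: the opening angle of the image. -/

/-- F is bounded on bounded sets, so r exp(iθ) with r large is F v with v large. There arg F v is
close to φ = arg v + Im h v, with |arg v| ≤ π/2 and |Im h v - Im κ| ≤ bπ/2. -/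
theorem exists_angle (H : IsConcavePrimitive F h b κ) {θ : ℝ}
    (hθ : ∀ᶠ r : ℝ in atTop, (r : ℂ) * Complex.exp (θ * Complex.I) ∈ F '' rightHalfPlane)
    {ε : ℝ} (hε0 : 0 < ε) (hε : ε ≤ 1) :
    ∃ φ ∈ Icc (κ.im - (1 + b) * (Real.pi / 2)) (κ.im + (1 + b) * (Real.pi / 2)),
      0 ≤ Real.cos (θ - φ) ∧ |Real.sin (θ - φ)| ≤ ε := by
  obtain ⟨R, hR⟩ := H.exists_div_bounds hε0 hε
  obtain ⟨M, hM0, hM⟩ := H.exists_norm_le R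
  obtain ⟨r, ⟨v, hv, hvr⟩, hrM⟩ := (hθ.and (eventually_gt_atTop M)).exists
  have hr0 : 0 < r := hM0.trans_lt hrM
  have hvR : R ≤ ‖v‖ := by
    by_contra! hlt
    have := hM v hv hlt.le
    rw [hvr, norm_mul, Complex.norm_exp_ofReal_mul_I, Complex.norm_real, mul_one,
      Real.norm_of_nonneg hr0.le] at this
    linarith
  have hv0 : 0 < ‖v‖ := norm_pos_iff.2 (ne_zero_of_mem_rightHalfPlane hv)
  set φ := v.arg + (h v).im with hφ
  have harg := abs_le.1 (abs_arg_le_of_mem_rightHalfPlane hv)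
  have him := abs_le.1 (H.abs_im_sub_le hv)
  set ρ := r / (‖v‖ * Real.exp (h v).re) with hρ
  have hρ0 : 0 < ρ := by positivity
  have hq : F v / (v * Complex.exp (h v)) = ρ * Complex.exp (((θ - φ : ℝ) : ℂ) * Complex.I) := by
    have h1 : v * Complex.exp (h v) =
        ((‖v‖ * Real.exp (h v).re : ℝ) : ℂ) * Complex.exp ((φ : ℂ) * Complex.I) := by
      have a2 : Complex.exp (h v) = Complex.exp (h v).re * Complex.exp ((h v).im * Complex.I) := by
        rw [← Complex.exp_add, Complex.re_add_im]
      refine (congrArg₂ (· * ·) (Complex.norm_mul_exp_arg_mul_I v).symm a2).trans ?_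
      rw [hφ]
      push_cast
      rw [add_mul, Complex.exp_add]
      ring
    rw [hvr, h1, hρ, Complex.ofReal_sub, sub_mul, Complex.exp_sub, Complex.ofReal_div]
    have := Complex.exp_ne_zero ((φ : ℂ) * Complex.I)
    have h3 : ((‖v‖ * Real.exp (h v).re : ℝ) : ℂ) ≠ 0 := by
      exact_mod_cast (by positivity : ‖v‖ * Real.exp (h v).re ≠ 0)
    field_simp
  have h2 := hR v hv hvR
  rw [hq, Complex.re_ofReal_mul, Complex.im_ofReal_mul, Complex.exp_ofReal_mul_I_re,
    Complex.exp_ofReal_mul_I_im, abs_mul, abs_of_pos hρ0] at h2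
  have hcos : 0 ≤ Real.cos (θ - φ) := by
    by_contra! hlt
    have := mul_neg_of_pos_of_neg hρ0 hlt
    linarith [h2.1]
  refine ⟨φ, ⟨by linarith, by linarith⟩, hcos, ?_⟩
  have h3 : ρ * |Real.sin (θ - φ)| ≤ ρ * (ε * Real.cos (θ - φ)) := by linarith [h2.2]
  exact (le_of_mul_le_mul_left h3 hρ0).trans
    (mul_le_of_le_one_right hε0.le (Real.cos_le_one _))

/-- Let ε → 0: a limit point ψ of the angles has sin (θ - ψ) = 0 and cos (θ - ψ) ≥ 0. -/
theorem exists_int_mem_Icc (H : IsConcavePrimitive F h b κ) {θ : ℝ}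
    (hθ : ∀ᶠ r : ℝ in atTop, (r : ℂ) * Complex.exp (θ * Complex.I) ∈ F '' rightHalfPlane) :
    ∃ m : ℤ, θ + 2 * Real.pi * m ∈
      Icc (κ.im - (1 + b) * (Real.pi / 2)) (κ.im + (1 + b) * (Real.pi / 2)) := by
  choose φ hφ hcos hsin using fun n : ℕ => H.exists_angle hθ (Nat.one_div_pos_of_nat (n := n))
    (by rw [div_le_one (by positivity)]; linarith [Nat.cast_nonneg (α := ℝ) n])
  obtain ⟨ψ, hψ, k, hk, hlim⟩ := isCompact_Icc.tendsto_subseq hφ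
  have h1 : 0 ≤ Real.cos (θ - ψ) := ge_of_tendsto'
    ((Real.continuous_cos.tendsto _).comp (hlim.const_sub θ)) fun n => hcos (k n)
  have h2 : |Real.sin (θ - ψ)| ≤ 0 := le_of_tendsto_of_tendsto'
    ((Real.continuous_sin.tendsto _).comp (hlim.const_sub θ)).abs
    ((tendsto_one_div_add_atTop_nhds_zero_nat (𝕜 := ℝ)).comp hk.tendsto_atTop)
    fun n => hsin (k n)
  have h3 : Real.sin (θ - ψ) = 0 := abs_nonpos_iff.1 h2
  have h4 : Real.cos (θ - ψ) = 1 := by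
    have := Real.sin_sq_add_cos_sq (θ - ψ)
    rw [h3] at this
    nlinarith
  obtain ⟨m, hm⟩ := (Real.cos_eq_one_iff _).1 h4
  refine ⟨-m, ?_⟩
  rwa [show θ + 2 * Real.pi * ((-m : ℤ) : ℝ) = ψ by push_cast; linarith]

theorem openingAngle_le (H : IsConcavePrimitive F h b κ) :
    openingAngleAtInfinity (F '' rightHalfPlane) ≤ Real.pi * (1 + b) := by
  have h1 := volume_angles_le (κ.im - (1 + b) * (Real.pi / 2)) (κ.im + (1 + b) * (Real.pi / 2))
  have h2 : (κ.im + (1 + b) * (Real.pi / 2)) - (κ.im - (1 + b) * (Real.pi / 2)) =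
      Real.pi * (1 + b) := by ring
  rw [h2] at h1
  have h0 : 0 ≤ Real.pi * (1 + b) := mul_nonneg Real.pi_pos.le (by linarith [H.nonneg])
  exact ENNReal.toReal_le_of_le_ofReal h0
    (le_trans (measure_mono fun θ hθ => And.intro hθ.1 (H.exists_int_mem_Icc hθ.2)) h1)

/-! ### Sharpness: convexity of the complement. -/

theorem add_mul_I_mem {v : ℂ} (hv : v ∈ rightHalfPlane) (s : ℝ) :
    v + s * Complex.I ∈ rightHalfPlane := by
  have : 0 < v.re := hv
  rw [mem_rightHalfPlane]; simpa using this

-- The s-derivative is a positive multiple of sin (Im h(v + is) - Im h v). By monotonicity of Im h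
-- and b ≤ 1, that difference lies in [0, π] for s ≥ 0 and in [-π, 0] for s ≤ 0.
open ComplexConjugate in
theorem re_conj_mul_sub_nonneg (H : IsConcavePrimitive F h b κ) {v : ℂ} (hv : v ∈ rightHalfPlane)
    (s : ℝ) : 0 ≤ (conj (Complex.exp (h v)) * (F v - F (v + s * Complex.I))).re := by
  set φ : ℝ → ℝ := fun s => (conj (Complex.exp (h v)) * (F v - F (v + s * Complex.I))).re with hφ
  have hd : ∀ s : ℝ, HasDerivAt φ (Real.exp (h v).re * Real.exp (h (v + s * Complex.I)).re *
      Real.sin ((h (v + s * Complex.I)).im - (h v).im)) s := fun s => by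
    have h1 := ((H.hasDerivAt_segment (add_mul_I_mem hv s)).const_sub (F v)).const_mul
      (conj (Complex.exp (h v)))
    refine (hasDerivAt_re h1).congr_deriv ?_
    rw [Real.sin_sub]
    simp [Complex.exp_re, Complex.exp_im]
    ring
  have hbπ : b * Real.pi ≤ Real.pi := mul_le_of_le_one_left Real.pi_pos.le H.le_one
  have hφ0 : φ 0 = 0 := by simp [hφ]
  rw [show (conj (Complex.exp (h v)) * (F v - F (v + s * Complex.I))).re = φ s from rfl, ← hφ0]
  have hosc : ∀ u ∈ rightHalfPlane, ∀ w ∈ rightHalfPlane, (h u).im - (h w).im ≤ Real.pi :=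
    fun u hu w hw => by linarith [H.im_le hu, H.le_im hw]
  rcases le_total 0 s with hs | hs
  · refine monotoneOn_of_deriv_nonneg (convex_Icc 0 s)
      (fun t ht => (hd t).continuousAt.continuousWithinAt)
      (fun t ht => (hd t).differentiableAt.differentiableWithinAt) (fun t ht => ?_)
      ⟨le_rfl, hs⟩ ⟨hs, le_rfl⟩ hs
    have ht0 : 0 ≤ t := (interior_subset ht).1
    rw [(hd t).deriv]
    refine mul_nonneg (by positivity) (Real.sin_nonneg_of_nonneg_of_le_pi ?_
      (hosc _ (add_mul_I_mem hv t) _ hv))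
    have := im_le_im_add_mul_I H.differentiableOn H.re_deriv_nonneg hv ht0
    linarith
  · refine antitoneOn_of_deriv_nonpos (convex_Icc s 0)
      (fun t ht => (hd t).continuousAt.continuousWithinAt)
      (fun t ht => (hd t).differentiableAt.differentiableWithinAt) (fun t ht => ?_)
      ⟨le_rfl, hs⟩ ⟨hs, le_rfl⟩ hs
    have ht0 : t ≤ 0 := (interior_subset ht).2
    rw [(hd t).deriv]
    refine mul_nonpos_of_nonneg_of_nonpos (by positivity)
      (Real.sin_nonpos_of_nonpos_of_neg_pi_le ?_ ?_)
    · have := im_le_im_add_mul_I H.differentiableOn H.re_deriv_nonneg (add_mul_I_mem hv t)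
        (neg_nonneg.2 ht0)
      rw [show v + t * Complex.I + ((-t : ℝ) : ℂ) * Complex.I = v by push_cast; ring] at this
      linarith
    · linarith [hosc _ hv _ (add_mul_I_mem hv t)]

theorem re_div_sub_nonneg_of_re_eq (H : IsConcavePrimitive F h b κ) {v ζ : ℂ}
    (hv : v ∈ rightHalfPlane) (hre : ζ.re = v.re) :
    0 ≤ (Complex.exp (h v) / (F v - F ζ)).re := by
  have h1 := H.re_conj_mul_sub_nonneg hv (ζ.im - v.im)
  have h2 : v + ((ζ.im - v.im : ℝ) : ℂ) * Complex.I = ζ := by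
    apply Complex.ext <;> simp [hre]
  rw [h2] at h1
  rw [Complex.div_re, ← add_div]
  refine div_nonneg ?_ (Complex.normSq_nonneg _)
  simpa using h1

theorem dslope_ne_zero (H : IsConcavePrimitive F h b κ) {v ζ : ℂ} (hv : v ∈ rightHalfPlane)
    (hζ : ζ ∈ rightHalfPlane) : dslope F ζ v ≠ 0 := by
  by_cases hne : v = ζ
  · rw [hne, dslope_same, (H.hasDerivAt ζ hζ).deriv]; exact Complex.exp_ne_zero _
  · rw [dslope_of_ne _ hne, slope_def_field]
    exact div_ne_zero (sub_ne_zero.2 fun h2 => hne (H.injOn hv hζ h2)) (sub_ne_zero.2 hne)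

theorem differentiableOn_primitive (H : IsConcavePrimitive F h b κ) :
    DifferentiableOn ℂ F rightHalfPlane := fun v hv =>
  (H.hasDerivAt v hv).differentiableAt.differentiableWithinAt

theorem differentiableOn_logDeriv_dslope (H : IsConcavePrimitive F h b κ) {ζ : ℂ}
    (hζ : ζ ∈ rightHalfPlane) :
    DifferentiableOn ℂ (fun v => deriv (dslope F ζ) v / dslope F ζ v) rightHalfPlane := by
  have h1 := (Complex.differentiableOn_dslope (isOpen_rightHalfPlane.mem_nhds hζ)).2
    H.differentiableOn_primitive
  exact (h1.deriv isOpen_rightHalfPlane).div h1 fun v hv => H.dslope_ne_zero hv hζ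

theorem logDeriv_dslope_eq (H : IsConcavePrimitive F h b κ) {v ζ : ℂ} (hv : v ∈ rightHalfPlane)
    (hζ : ζ ∈ rightHalfPlane) (hne : v ≠ ζ) :
    deriv (dslope F ζ) v / dslope F ζ v = Complex.exp (h v) / (F v - F ζ) - 1 / (v - ζ) := by
  have h0 : v - ζ ≠ 0 := sub_ne_zero.2 hne
  have hF : F v - F ζ ≠ 0 := sub_ne_zero.2 fun h2 => hne (H.injOn hv hζ h2)
  have h1 : dslope F ζ =ᶠ[𝓝 v] fun w => (F w - F ζ) / (w - ζ) := by
    filter_upwards [isOpen_ne.mem_nhds hne] with w hw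
    rw [dslope_of_ne _ hw, slope_def_field]
  have h2 := ((H.hasDerivAt v hv).sub_const (F ζ)).div ((hasDerivAt_id v).sub_const ζ) h0
  rw [(HasDerivAt.congr_of_eventuallyEq h2 h1).deriv, h1.eq_of_nhds]
  simp only [id]
  field_simp

theorem logDeriv_dslope_same (H : IsConcavePrimitive F h b κ) {ζ : ℂ} (hζ : ζ ∈ rightHalfPlane) :
    deriv (dslope F ζ) ζ / dslope F ζ ζ = deriv h ζ / 2 := by
  rw [deriv_dslope_same isOpen_rightHalfPlane H.differentiableOn_primitive hζ, dslope_same,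
    (H.hasDerivAt ζ hζ).deriv]
  have h1 : deriv F =ᶠ[𝓝 ζ] fun v => Complex.exp (h v) := by
    filter_upwards [isOpen_rightHalfPlane.mem_nhds hζ] with v hv using (H.hasDerivAt v hv).deriv
  have h2 := (H.differentiableOn.differentiableAt
    (isOpen_rightHalfPlane.mem_nhds hζ)).hasDerivAt.cexp
  rw [(HasDerivAt.congr_of_eventuallyEq h2 h1).deriv]
  have := Complex.exp_ne_zero (h ζ)
  field_simp

/-- Both terms of F'/(F - F ζ) - 1/(v - ζ) tend to 0 at ∞, the first because |F v| ≥ |v||F' v|/16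
there. -/
theorem exists_logDeriv_dslope_small (H : IsConcavePrimitive F h b κ) {ζ : ℂ}
    (hζ : ζ ∈ rightHalfPlane) {η : ℝ} (hη : 0 < η) :
    ∃ R : ℝ, ∀ v ∈ rightHalfPlane, R ≤ ‖v‖ →
      -η ≤ (deriv (dslope F ζ) v / dslope F ζ v).re := by
  obtain ⟨R, hR⟩ := H.exists_norm_ge
  obtain ⟨c, hc0, S, hS⟩ := H.exists_le_norm_exp
  refine ⟨max (max R S) (max (32 * ‖F ζ‖ / c) (‖ζ‖ + 64 / η)), fun v hv hvR => ?_⟩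
  have v1 : R ≤ ‖v‖ := (le_max_left _ _).trans ((le_max_left _ _).trans hvR)
  have v2 : S ≤ ‖v‖ := (le_max_right _ _).trans ((le_max_left _ _).trans hvR)
  have v3 : 32 * ‖F ζ‖ / c ≤ ‖v‖ := (le_max_left _ _).trans ((le_max_right _ _).trans hvR)
  have v4 : ‖ζ‖ + 64 / η ≤ ‖v‖ := (le_max_right _ _).trans ((le_max_right _ _).trans hvR)
  have hη' : 0 < 64 / η := by positivity
  have hn := norm_nonneg ζ
  have hv0 : 0 < ‖v‖ := by linarith
  have hne : v ≠ ζ := by rintro rfl; linarith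
  have e1 := hR v hv v1
  have e2 := hS v hv v2
  rw [div_le_iff₀ hc0] at v3
  have e3 : ‖v‖ * ‖Complex.exp (h v)‖ / 32 ≤ ‖F v - F ζ‖ := by
    have := norm_sub_norm_le (F v) (F ζ)
    have := mul_le_mul_of_nonneg_left e2 hv0.le
    linarith
  have hexp : 0 < ‖Complex.exp (h v)‖ := by simp
  have e4 : ‖Complex.exp (h v) / (F v - F ζ)‖ ≤ η / 2 := by
    rw [norm_div, div_le_iff₀ (lt_of_lt_of_le (by positivity) e3)]
    have e5 : 64 ≤ ‖v‖ * η := by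
      rw [← div_le_iff₀ hη]; linarith
    have e6 := mul_le_mul_of_nonneg_left e3 hη.le
    have e7 := mul_le_mul_of_nonneg_right e5 hexp.le
    nlinarith
  have e8 : ‖1 / (v - ζ)‖ ≤ η / 2 := by
    have := norm_sub_norm_le v ζ
    rw [norm_div, norm_one, div_le_iff₀ (by linarith)]
    have e5 : 64 ≤ ‖v - ζ‖ * η := by
      rw [← div_le_iff₀ hη]; linarith
    linarith
  rw [H.logDeriv_dslope_eq hv hζ hne]
  have := (abs_le.1 ((Complex.abs_re_le_norm _).trans ((norm_sub_le _ _).trans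
    (add_le_add e4 e8)))).1
  linarith

theorem re_one_div_sub_le (H : IsConcavePrimitive F h b κ) {v ζ : ℂ} (hv : v ∈ rightHalfPlane)
    (hζ : ζ ∈ rightHalfPlane) (hre : ζ.re < v.re) :
    (1 / (v - ζ)).re ≤ (Complex.exp (h v) / (F v - F ζ)).re := by
  have hζ0 : 0 < ζ.re := hζ
  set G : ℂ → ℂ := fun v => deriv (dslope F ζ) v / dslope F ζ v with hG
  have hGd := H.differentiableOn_logDeriv_dslope hζ
  have hm : ∀ w : ℂ, 0 ≤ w.re → w + ζ.re ∈ rightHalfPlane := fun w hw => by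
    rw [mem_rightHalfPlane]; simp; linarith
  have hb0 : ∀ y : ℝ, 0 ≤ (G (y * Complex.I + ζ.re)).re := fun y => by
    have hp := hm (y * Complex.I) (by simp)
    by_cases hne : y * Complex.I + ζ.re = ζ
    · rw [hne, hG]
      simp only
      rw [H.logDeriv_dslope_same hζ, Complex.div_ofNat_re]
      linarith [H.re_deriv_nonneg ζ hζ]
    · simp only [hG]
      rw [H.logDeriv_dslope_eq hp hζ hne, Complex.sub_re]
      have h1 := H.re_div_sub_nonneg_of_re_eq hp (ζ := ζ) (by simp)
      have h2 : (1 / (y * Complex.I + ζ.re - ζ)).re = 0 := by simp [Complex.inv_re]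
      rw [h2, sub_zero]; exact h1
  have key := re_nonneg_of_forall_boundary (g := fun w => G (w + ζ.re)) ?_ ?_ ?_
    (v := v - ζ.re) (by rw [mem_rightHalfPlane]; simpa using hre)
  · have hne : v ≠ ζ := by rintro rfl; exact lt_irrefl _ hre
    simp only [sub_add_cancel, hG] at key
    rw [H.logDeriv_dslope_eq hv hζ hne, Complex.sub_re] at key
    linarith
  · exact hGd.comp (by fun_prop) fun w hw => hm w (le_of_lt hw)
  · intro y η hη
    have hp := hm (y * Complex.I) (by simp)
    have h1 : ContinuousAt G (y * Complex.I + ζ.re) :=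
      (hGd.differentiableAt (isOpen_rightHalfPlane.mem_nhds hp)).continuousAt
    have h2 : Tendsto (fun w : ℂ => (G (w + ζ.re)).re) (𝓝 (y * Complex.I))
        (𝓝 (G (y * Complex.I + ζ.re)).re) :=
      (Complex.continuous_re.tendsto _).comp (h1.tendsto.comp
        ((continuous_add_const (ζ.re : ℂ)).tendsto _))
    filter_upwards [nhdsWithin_le_nhds (h2.eventually (lt_mem_nhds
      (show -η < (G (y * Complex.I + ζ.re)).re by linarith [hb0 y])))] with w hw using hw.le
  · intro η hη
    obtain ⟨R, hR⟩ := H.exists_logDeriv_dslope_small hζ hη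
    rw [eventually_cobounded_inf_iff]
    refine ⟨R + ζ.re, fun w hw hwR => hR _ (hm w (le_of_lt hw)) ?_⟩
    have h1 := norm_sub_norm_le w (-(ζ.re : ℂ))
    rw [sub_neg_eq_add, norm_neg, Complex.norm_real, Real.norm_of_nonneg hζ0.le] at h1
    linarith

/-- The analytic criterion at boundary points of the image. -/
theorem re_div_sub_frontier_pos (H : IsConcavePrimitive F h b κ) {v k : ℂ} (hv : v ∈ rightHalfPlane)
    (hk : k ∈ frontier (F '' rightHalfPlane)) :
    0 < (Complex.exp (h v) / (F v - k)).re := by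
  have hopen : IsOpen (F '' rightHalfPlane) :=
    isOpen_image_of_injOn isOpen_rightHalfPlane H.differentiableOn_primitive H.injOn
  rw [hopen.frontier_eq] at hk
  obtain ⟨x, hx, hxk⟩ := mem_closure_iff_seq_limit.1 hk.1
  -- The preimages stay bounded because F(∞) = ∞, and a limit point a has Re a = 0 because k is not
  -- a value. In the limit `re_one_div_sub_le` leaves the positive lower bound Re 1/(v - a).
  choose ζ hζ hζx using hx
  have hxk' : Tendsto (fun n => F (ζ n)) atTop (𝓝 k) := by simpa [hζx] using hxk
  obtain ⟨R, hR⟩ := eventually_cobounded_inf_iff.1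
    ((tendsto_norm_cobounded_atTop.comp H.tendsto_cobounded).eventually (eventually_gt_atTop (‖k‖ + 1)))
  have hbdd : ∀ᶠ n in atTop, ζ n ∈ Metric.ball (0 : ℂ) R := by
    filter_upwards [hxk'.norm.eventually (gt_mem_nhds (lt_add_one ‖k‖))] with n hn
    rw [mem_ball_zero_iff]
    by_contra! hlt
    exact lt_asymm hn (hR _ (hζ n) hlt)
  obtain ⟨a, -, φ, hφ, ha⟩ := tendsto_subseq_of_frequently_bounded Metric.isBounded_ball
    hbdd.frequently
  have ha0 : 0 ≤ a.re := ge_of_tendsto' ((Complex.continuous_re.tendsto a).comp ha)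
    fun n => le_of_lt (hζ (φ n))
  have hF : Tendsto (fun n => F (ζ (φ n))) atTop (𝓝 k) := hxk'.comp hφ.tendsto_atTop
  have hare : a.re = 0 := by
    by_contra hne
    have haH : a ∈ rightHalfPlane := lt_of_le_of_ne ha0 (Ne.symm hne)
    have := (H.hasDerivAt a haH).continuousAt.tendsto.comp ha
    exact hk.2 ⟨a, haH, tendsto_nhds_unique this hF⟩
  have hv0 : 0 < v.re := hv
  have hva : 0 < (v - a).re := by rw [Complex.sub_re, hare]; linarith
  have hvane : v - a ≠ 0 := ne_zero_of_mem_rightHalfPlane hva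
  have hpos : 0 < (1 / (v - a)).re := by
    rw [one_div, Complex.inv_re]
    exact div_pos hva (Complex.normSq_pos.2 hvane)
  have hFk : F v - k ≠ 0 := sub_ne_zero.2 fun h2 => hk.2 ⟨v, hv, h2⟩
  refine hpos.trans_le (le_of_tendsto_of_tendsto
    ((Complex.continuous_re.tendsto _).comp (tendsto_const_nhds.div (ha.const_sub v) hvane))
    ((Complex.continuous_re.tendsto _).comp (tendsto_const_nhds.div (hF.const_sub (F v)) hFk))
    ?_)
  filter_upwards [((Complex.continuous_re.tendsto a).comp ha).eventually
    (gt_mem_nhds (by rw [hare]; exact hv0))] with n hn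
  exact H.re_one_div_sub_le hv (hζ _) hn

/-- The segment from F v to an omitted k meets the frontier, and moving along it changes F'/(F v -
k) by a positive factor only. If F v were between omitted k₁ and k₂, then F v - k₁ and F v - k₂
would be opposite and both real parts could not be positive. -/
theorem convex_compl (H : IsConcavePrimitive F h b κ) : Convex ℝ (F '' rightHalfPlane)ᶜ := by
  have hopen : IsOpen (F '' rightHalfPlane) :=
    isOpen_image_of_injOn isOpen_rightHalfPlane H.differentiableOn_primitive H.injOn
  have key : ∀ v ∈ rightHalfPlane, ∀ k ∉ F '' rightHalfPlane,
      0 < (Complex.exp (h v) / (F v - k)).re := fun v hv k hk => by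
    obtain ⟨p, hp, hpf⟩ := inter_frontier_nonempty_of_isOpen
      (convex_segment (𝕜 := ℝ) (F v) k).isPreconnected hopen
      ⟨F v, left_mem_segment ℝ _ _, mem_image_of_mem F hv⟩
      fun hsub => hk (hsub (right_mem_segment ℝ _ _))
    rw [segment_eq_image'] at hp
    obtain ⟨t, ht, rfl⟩ := hp
    have h1 := H.re_div_sub_frontier_pos hv hpf
    simp only [Complex.real_smul] at h1
    rw [show Complex.exp (h v) / (F v - (F v + t * (k - F v))) =
      ((t⁻¹ : ℝ) : ℂ) * (Complex.exp (h v) / (F v - k)) by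
        rw [show F v - (F v + t * (k - F v)) = t * (F v - k) by ring, div_mul_eq_div_div_swap]
        push_cast; ring, Complex.re_ofReal_mul] at h1
    exact pos_of_mul_pos_right h1 (inv_nonneg.2 ht.1)
  intro k₁ hk₁ k₂ hk₂ s t hs ht hst
  rintro ⟨v, hv, hvk⟩
  have h1 := key v hv k₁ hk₁
  have h2 := key v hv k₂ hk₂
  have hst' : (s : ℂ) + t = 1 := by exact_mod_cast hst
  rw [hvk, Complex.real_smul, Complex.real_smul] at h1 h2
  rw [show (s : ℂ) * k₁ + t * k₂ - k₁ = ((-t : ℝ) : ℂ) * (k₁ - k₂) by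
    rw [eq_sub_of_add_eq hst']; push_cast; ring, div_mul_eq_div_div_swap] at h1
  rw [show (s : ℂ) * k₁ + t * k₂ - k₂ = (s : ℂ) * (k₁ - k₂) by
    rw [eq_sub_of_add_eq' hst']; ring, div_mul_eq_div_div_swap] at h2
  rw [Complex.div_ofReal_re] at h1 h2
  rcases hs.eq_or_lt with rfl | hs0
  · simp at h2
  rcases ht.eq_or_lt with rfl | ht0
  · simp at h1
  have h3 := (div_pos_iff_of_pos_right hs0).1 h2
  rw [div_neg] at h1
  have := div_pos h3 ht0
  linarith

end IsConcavePrimitive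

/-! ### The extremal functions. -/

theorem log_mul_of_mem_rightHalfPlane {u v : ℂ} (hu : u ∈ rightHalfPlane)
    (hv : v ∈ rightHalfPlane) : Complex.log (u * v) = Complex.log u + Complex.log v := by
  refine (Complex.log_mul_eq_add_log_iff (ne_zero_of_mem_rightHalfPlane hu)
    (ne_zero_of_mem_rightHalfPlane hv)).2 ?_
  have h1 := abs_lt.1 (Complex.abs_arg_lt_pi_div_two_iff.2 (Or.inl hu))
  have h2 := abs_lt.1 (Complex.abs_arg_lt_pi_div_two_iff.2 (Or.inl hv))
  exact ⟨by linarith, by linarith⟩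

theorem one_sub_mem_rightHalfPlane {z : ℂ} (hz : z ∈ Metric.ball (0 : ℂ) 1) :
    1 - z ∈ rightHalfPlane := one_sub_re_pos hz

/-- 2 Re ((1 - p)(1 - q) conj (1 - pq)) = (1 - |p|²)|1 - q|² + (1 - |q|²)|1 - p|². -/
theorem re_one_sub_mul_one_sub_div_nonneg {p q : ℂ} (hp : Complex.normSq p ≤ 1)
    (hq : Complex.normSq q ≤ 1) : 0 ≤ ((1 - p) * (1 - q) / (1 - p * q)).re := by
  rw [Complex.div_re, ← add_div]
  refine div_nonneg ?_ (Complex.normSq_nonneg _)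
  have h1 := mul_nonneg (sub_nonneg.2 hp) (Complex.normSq_nonneg (1 - q))
  have h2 := mul_nonneg (sub_nonneg.2 hq) (Complex.normSq_nonneg (1 - p))
  simp only [Complex.normSq_apply, Complex.sub_re, Complex.sub_im, Complex.mul_re, Complex.mul_im,
    Complex.one_re, Complex.one_im] at h1 h2 ⊢
  nlinarith

/-- The logarithm of the derivative of the extremal function, in the half-plane variable. -/
noncomputable def extremalLog (β : ℝ) (n : ℕ) (c : ℂ) (v : ℂ) : ℂ :=
  (β / n : ℂ) * Complex.log (1 - c * cayley v ^ n) - β * Complex.log (1 - cayley v) - Real.log 2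

/-- Written with p = z and q = c z^(n-1), z = `cayley v`, so that
`re_one_sub_mul_one_sub_div_nonneg` applies. -/
theorem hasDerivAt_extremalLog (β : ℝ) {n : ℕ} (hn : 1 ≤ n) {c : ℂ} (hc : ‖c‖ = 1) {v : ℂ}
    (hv : v ∈ rightHalfPlane) : HasDerivAt (extremalLog β n c)
      (((β / 2 : ℝ) : ℂ) * ((1 - cayley v) * (1 - c * cayley v ^ (n - 1)) /
        (1 - cayley v * (c * cayley v ^ (n - 1))))) v := by
  have hz := cayley_mem hv
  have hd := hasDerivAt_cayley hv
  have hs : 1 - cayley v = 2 / (v + 1) := one_sub_cayley (add_one_ne_zero hv)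
  have hv1 := add_one_ne_zero hv
  have hn0 : (n : ℂ) ≠ 0 := by exact_mod_cast (by omega : n ≠ 0)
  have hm1 := mem_ball_mul_pow hc hn hz
  have h1 := (((hd.pow n).const_mul c).const_sub 1).clog (Or.inl (one_sub_re_pos hm1))
  have h2 := (hd.const_sub 1).clog (Or.inl (one_sub_re_pos hz))
  have h3 := ((h1.const_mul (β / n : ℂ)).sub (h2.const_mul (β : ℂ))).sub_const ((Real.log 2 : ℝ) : ℂ)
  refine h3.congr_deriv ?_
  have e1 := one_sub_ne_zero_of_mem_ball hm1
  have e2 := one_sub_ne_zero_of_mem_ball hz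
  have e3 : 2 / (v + 1) ^ 2 = (1 - cayley v) ^ 2 / 2 := by rw [hs]; field_simp
  rw [e3]
  simp only [Pi.pow_apply]
  generalize cayley v = z at e1 e2
  obtain ⟨m, rfl⟩ : ∃ m, n = m + 1 := ⟨n - 1, by omega⟩
  rw [Nat.add_sub_cancel]
  have e4 : z * (c * z ^ m) = c * z ^ (m + 1) := by ring
  rw [e4]
  push_cast at hn0 ⊢
  field_simp
  ring

theorem re_deriv_extremalLog_nonneg {β : ℝ} (hβ : 0 < β) {n : ℕ} (hn : 1 ≤ n) {c : ℂ}
    (hc : ‖c‖ = 1) {v : ℂ} (hv : v ∈ rightHalfPlane) : 0 ≤ (deriv (extremalLog β n c) v).re := by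
  have hz := cayley_mem hv
  rw [(hasDerivAt_extremalLog β hn hc hv).deriv, Complex.re_ofReal_mul]
  refine mul_nonneg (by positivity) (re_one_sub_mul_one_sub_div_nonneg (normSq_lt_one hz).le ?_)
  rw [Complex.normSq_eq_norm_sq, norm_mul, hc, one_mul, norm_pow]
  exact pow_le_one₀ (by positivity) (pow_le_one₀ (norm_nonneg _) (mem_ball_zero_iff.1 hz).le)

theorem log_one_sub_cayley {v : ℂ} (hv : v ∈ rightHalfPlane) :
    Complex.log (1 - cayley v) = Real.log 2 - Complex.log (v + 1) := by
  have hv0 : 0 < v.re := hv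
  have h1 : v + 1 ∈ rightHalfPlane := by rw [mem_rightHalfPlane]; simp; linarith
  have h2 := log_mul_of_mem_rightHalfPlane (one_sub_mem_rightHalfPlane (cayley_mem hv)) h1
  have hs : 1 - cayley v = 2 / (v + 1) := one_sub_cayley (add_one_ne_zero hv)
  rw [hs, div_mul_cancel₀ _ (add_one_ne_zero hv)] at h2
  rw [hs, Complex.ofReal_log zero_le_two, Complex.ofReal_ofNat, h2]
  ring

theorem eventually_mem_rightHalfPlane :
    ∀ᶠ v in cobounded ℂ ⊓ 𝓟 rightHalfPlane, v ∈ rightHalfPlane :=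
  mem_inf_of_right (mem_principal_self _)

theorem tendsto_log_add_one_sub_log :
    Tendsto (fun v => Complex.log (v + 1) - Complex.log v) (cobounded ℂ ⊓ 𝓟 rightHalfPlane)
      (𝓝 0) := by
  have h1 : Tendsto (fun v : ℂ => 1 + v⁻¹) (cobounded ℂ ⊓ 𝓟 rightHalfPlane) (𝓝 1) := by
    simpa using (tendsto_inv₀_cobounded.const_add (1 : ℂ)).mono_left
      (inf_le_left : cobounded ℂ ⊓ 𝓟 rightHalfPlane ≤ cobounded ℂ)
  have h2 := (continuousAt_clog (x := 1) (by simp)).tendsto.comp h1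
  rw [Complex.log_one] at h2
  refine h2.congr' (eventually_mem_rightHalfPlane.mono fun v hv => ?_)
  have hv0 := ne_zero_of_mem_rightHalfPlane hv
  have hinv : 1 + v⁻¹ ∈ rightHalfPlane := by
    have : 0 < v.re := hv
    rw [mem_rightHalfPlane, Complex.add_re, Complex.inv_re, Complex.one_re]
    have := div_pos this (Complex.normSq_pos.2 hv0)
    linarith
  have h3 := log_mul_of_mem_rightHalfPlane hv hinv
  rw [mul_add, mul_one, mul_inv_cancel₀ hv0] at h3
  simp only [Function.comp_apply, h3]
  ring

/-- The behaviour of `Log (1 - c z ^ n)` as `z → 1`. -/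
theorem exists_tendsto_log_one_sub_mul_pow {n : ℕ} (hn : 1 ≤ n) {c : ℂ} (hc : ‖c‖ = 1) :
    ∃ (j : ℝ) (_ : j = 0 ∨ j = 1) (L : ℂ), Tendsto (fun v => Complex.log (1 - c * cayley v ^ n) -
      j * Complex.log (1 - cayley v)) (cobounded ℂ ⊓ 𝓟 rightHalfPlane) (𝓝 L) := by
  have ht : Tendsto cayley (cobounded ℂ ⊓ 𝓟 rightHalfPlane) (𝓝 1) :=
    tendsto_cayley.mono_right nhdsWithin_le_nhds
  by_cases hc1 : c = 1
  · subst hc1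
    -- For c = 1, 1 - z^n is 1 - z times a geometric sum tending to n; for any other unimodular c, 1
    -- - c z^n tends to 1 - c, which has positive real part.
    refine ⟨1, Or.inr rfl, Complex.log n, ?_⟩
    have h1 : Tendsto (fun v => ∑ k ∈ Finset.range n, cayley v ^ k)
        (cobounded ℂ ⊓ 𝓟 rightHalfPlane) (𝓝 (n : ℂ)) := by
      have : Continuous fun z : ℂ => ∑ k ∈ Finset.range n, z ^ k := by fun_prop
      simpa [Function.comp_def] using (this.tendsto 1).comp ht
    have hn0 : (0 : ℝ) < (n : ℂ).re := by simpa using (by omega : 0 < n)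
    have h2 := (continuousAt_clog (x := (n : ℂ)) (Or.inl hn0)).tendsto.comp h1
    refine h2.congr' ?_
    filter_upwards [eventually_mem_rightHalfPlane,
      h1.eventually (isOpen_rightHalfPlane.mem_nhds hn0)] with v hv hS
    have h3 := log_mul_of_mem_rightHalfPlane (one_sub_mem_rightHalfPlane (cayley_mem hv)) hS
    rw [mul_neg_geom_sum] at h3
    rw [one_mul, h3, Function.comp_apply]
    push_cast
    ring
  · refine ⟨0, Or.inl rfl, Complex.log (1 - c * 1 ^ n), ?_⟩
    have hre : 0 < (1 - c * 1 ^ n).re := by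
      have h1 : c.re ≤ 1 := hc ▸ Complex.re_le_norm c
      have h2 : c.re ≠ 1 := fun h => hc1 (by
        have h3 := Complex.sq_norm c
        rw [Complex.normSq_apply, h, hc] at h3
        apply Complex.ext <;> simp [h]
        nlinarith)
      have := lt_of_le_of_ne h1 h2
      simpa using this
    simpa [Function.comp_def] using ((continuousAt_clog (Or.inl hre)).tendsto.comp
      (((ht.pow n).const_mul c).const_sub 1))

theorem exists_isConcavePrimitive {α : ℝ} (hα : 1 < α) (hα' : α ≤ 2) {n : ℕ} (hn : 1 ≤ n) (θ : ℝ)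
    {f : ℂ → ℂ} (hf : ∀ z ∈ Metric.ball (0 : ℂ) 1, HasDerivAt f (extremalDeriv α n θ z) z) :
    ∃ b ≤ α - 1, ∃ κ : ℂ, IsConcavePrimitive (f ∘ cayley)
      (extremalLog (α - 1) n (Complex.exp (θ * Complex.I))) b κ := by
  set c := Complex.exp (θ * Complex.I)
  have hc : ‖c‖ = 1 := Complex.norm_exp_ofReal_mul_I θ
  obtain ⟨j, hj, L, hL⟩ := exists_tendsto_log_one_sub_mul_pow hn hc
  set β := α - 1 with hβ
  have hβ0 : 0 < β := by rw [hβ]; linarith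
  have hn0 : (1 : ℝ) ≤ n := by exact_mod_cast hn
  have hγ : β / n ≤ β := div_le_self hβ0.le hn0
  have hγ0 : 0 < β / n := by positivity
  have hj0 : 0 ≤ j ∧ j ≤ 1 := by rcases hj with rfl | rfl <;> norm_num
  have hjγ : β / n * j ≤ β / n := mul_le_of_le_one_right hγ0.le hj0.2
  have hjγ0 : 0 ≤ β / n * j := mul_nonneg hγ0.le hj0.1
  -- -Log (1 - z) grows like Log v, so the two logarithms in `extremalLog` contribute -(β/n) j and β
  -- to b.
  refine ⟨β - β / n * j, by linarith, (β / n : ℂ) * L + ((β - β / n * j : ℝ) : ℂ) * 0 -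
    ((β - β / n * j : ℝ) : ℂ) * Real.log 2 - Real.log 2, ?_, ?_, ?_, ?_, by linarith, by linarith⟩
  · intro v hv
    have hz := cayley_mem hv
    refine (HasDerivAt.comp (h₂ := f) (h := cayley) v (hf _ hz) (hasDerivAt_cayley hv)).congr_deriv ?_
    have hs : 1 - cayley v = 2 / (v + 1) := one_sub_cayley (add_one_ne_zero hv)
    have hv1 := add_one_ne_zero hv
    have e1 := one_sub_ne_zero_of_mem_ball (mem_ball_mul_pow hc hn hz)
    have e2 := one_sub_ne_zero_of_mem_ball hz
    -- The derivative of `cayley` in terms of z: its square lowers the exponent α + 1 to β, and its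
    -- factor 1/2 is the term log 2 of `extremalLog`.
    have e3 : 2 / (v + 1) ^ 2 = (1 - cayley v) ^ 2 / 2 := by rw [hs]; field_simp
    have e4 : (α : ℂ) + 1 = (β : ℂ) + 2 := by rw [hβ]; push_cast; ring
    have e5 : (α : ℂ) - 1 = (β : ℂ) := by rw [hβ]; push_cast; ring
    rw [extremalLog, Complex.exp_sub, Complex.exp_sub, ← Complex.ofReal_exp,
      Real.exp_log two_pos, extremalDeriv, e3, e4, e5, Complex.cpow_add _ _ e2,
      Complex.cpow_ofNat, Complex.cpow_def_of_ne_zero e1, Complex.cpow_def_of_ne_zero e2,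
      mul_comm (Complex.log _), mul_comm (Complex.log _)]
    have := Complex.exp_ne_zero (β * Complex.log (1 - cayley v))
    push_cast
    field_simp
  · exact fun v hv =>
      (hasDerivAt_extremalLog β hn hc hv).differentiableAt.differentiableWithinAt
  · exact fun v hv => re_deriv_extremalLog_nonneg hβ0 hn hc hv
  · refine ((((hL.const_mul (β / n : ℂ)).add (tendsto_log_add_one_sub_log.const_mul
      ((β - β / n * j : ℝ) : ℂ))).sub_const _).sub_const _).congr'
      (eventually_mem_rightHalfPlane.mono fun v hv => ?_)
    simp only [extremalLog, log_one_sub_cayley hv]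
    push_cast
    ring

theorem tendsto_invCayley :
    Tendsto invCayley (𝓝[Metric.ball (0 : ℂ) 1] 1) (cobounded ℂ ⊓ 𝓟 rightHalfPlane) := by
  refine tendsto_inf.2 ⟨?_, tendsto_principal.2
    (eventually_of_mem self_mem_nhdsWithin fun z hz => invCayley_mem hz)⟩
  have h0 : Tendsto (fun z : ℂ => 1 - z) (𝓝[Metric.ball (0 : ℂ) 1] 1) (𝓝[≠] 0) := by
    refine tendsto_nhdsWithin_iff.2 ⟨?_,
      eventually_of_mem self_mem_nhdsWithin fun z hz => one_sub_ne_zero_of_mem_ball hz⟩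
    have : Tendsto (fun z : ℂ => 1 - z) (𝓝 1) (𝓝 (1 - 1)) :=
      (continuous_const.sub continuous_id).tendsto 1
    rw [sub_self] at this
    exact this.mono_left nhdsWithin_le_nhds
  have h1 := (tendsto_add_const_cobounded (-1 : ℂ)).comp
    ((tendsto_mul_left_cobounded (two_ne_zero (α := ℂ))).comp (tendsto_inv₀_nhdsNE_zero.comp h0))
  refine h1.congr' (eventually_of_mem self_mem_nhdsWithin fun z hz => ?_)
  have := one_sub_ne_zero_of_mem_ball hz
  simp only [Function.comp_apply, invCayley]
  field_simp
  ring

theorem IsConcavePrimitive.isConcaveUnivalent {f h : ℂ → ℂ} {b : ℝ} {κ : ℂ}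
    (H : IsConcavePrimitive (f ∘ cayley) h b κ) (hf : DifferentiableOn ℂ f (Metric.ball 0 1))
    (hf0 : f 0 = 0) (hf1 : deriv f 0 = 1) {α : ℝ} (hb : b ≤ α - 1) : IsConcaveUnivalent α f where
  analytic := hf.analyticOnNhd Metric.isOpen_ball
  map_zero := hf0
  deriv_zero := hf1
  tendsto_infinity := (H.tendsto_cobounded.comp tendsto_invCayley).congr'
    (eventually_of_mem self_mem_nhdsWithin fun z hz => by
      simp only [Function.comp_apply, cayley_invCayley hz])
  injective := fun z hz w hw hzw => by
    rw [← cayley_invCayley hz, ← cayley_invCayley hw, H.injOn (invCayley_mem hz) (invCayley_mem hw)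
      (by simpa only [Function.comp_apply, cayley_invCayley hz, cayley_invCayley hw] using hzw)]
  convex_compl := image_comp_cayley f ▸ H.convex_compl
  opening_angle := by
    rw [← image_comp_cayley f]
    exact H.openingAngle_le.trans (mul_le_mul_of_nonneg_left (by linarith) Real.pi_pos.le)

theorem exists_isConcaveUnivalent_deriv_eq {α : ℝ} (hα : 1 < α) (hα' : α ≤ 2) {n : ℕ} (hn : 1 ≤ n)
    (θ : ℝ) : ∃ f : ℂ → ℂ, IsConcaveUnivalent α f ∧
      ∀ z ∈ Metric.ball (0 : ℂ) 1, deriv f z = extremalDeriv α n θ z := by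
  have hd : DifferentiableOn ℂ (extremalDeriv α n θ) (Metric.ball 0 1) := by
    have h1 := differentiableOn_one_sub_mul_pow_cpow (c := 1) norm_one le_rfl ((α : ℂ) + 1)
    simp only [one_mul, pow_one] at h1
    exact (differentiableOn_one_sub_mul_pow_cpow (Complex.norm_exp_ofReal_mul_I θ) hn _).div h1
      fun z hz => one_sub_cpow_ne_zero hz _
  obtain ⟨f, hf0, hf⟩ := hd.isExactOn_ball.with_val_at 0 0
  obtain ⟨b, hb, κ, H⟩ := exists_isConcavePrimitive hα hα' hn θ hf
  refine ⟨f, H.isConcaveUnivalent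
    (fun z hz => (hf z hz).differentiableAt.differentiableWithinAt) hf0 ?_ hb,
    fun z hz => (hf z hz).deriv⟩
  rw [(hf 0 (Metric.mem_ball_self one_pos)).deriv]
  simp [extremalDeriv, zero_pow (by omega : n ≠ 0)]

theorem mainTheorem8 (α : ℝ) (hα : 1 < α) (hα' : α ≤ 2) :
    (∀ f : ℂ → ℂ, IsConcaveUnivalent α f → ∀ n : ℕ, 1 ≤ n →
      ‖concaveCoeffSum α f n‖ ≤ (α - 1) / n ∧
      taylorCoeff (concaveFactor α f) n = (-1) ^ n * concaveCoeffSum α f n ∧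
      ‖taylorCoeff (concaveFactor α f) n‖ ≤ (α - 1) / n ∧
      (‖concaveCoeffSum α f n‖ = (α - 1) / n ↔
        ∃ θ : ℝ, ∀ z ∈ Metric.ball (0 : ℂ) 1, deriv f z = extremalDeriv α n θ z)) ∧
    (∀ n : ℕ, 1 ≤ n → ∀ θ : ℝ, ∃ f : ℂ → ℂ, IsConcaveUnivalent α f ∧
      ∀ z ∈ Metric.ball (0 : ℂ) 1, deriv f z = extremalDeriv α n θ z) ∧
    (∀ f : ℂ → ℂ, IsConcaveUnivalent α f →
      ‖taylorCoeff f 2 - ((α : ℂ) + 1) / 2‖ ≤ (α - 1) / 2 ∧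
      ‖3 * taylorCoeff f 3 - 2 * ((α : ℂ) + 1) * taylorCoeff f 2
        + (α : ℂ) * ((α : ℂ) + 1) / 2‖ ≤ (α - 1) / 2) :=
  ⟨fun _ hf n hn => ⟨hf.norm_concaveCoeffSum_le hα hα' hn,
      taylorCoeff_concaveFactor hf.differentiableOn n,
      (hf.norm_concaveCoeffSum n).symm.trans_le (hf.norm_concaveCoeffSum_le hα hα' hn),
      hf.norm_concaveCoeffSum_eq_iff hα hα' hn⟩,
    fun _ hn θ => exists_isConcaveUnivalent_deriv_eq hα hα' hn θ,
    fun _ hf => ⟨hf.norm_taylorCoeff_two_sub_le hα hα', hf.norm_taylorCoeff_three_sub_le hα hα'⟩⟩
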